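/- Let $\Gamma\subset\mathbb R^n\times\mathbb R^n\times\mathbb R$ be a domain (open, connected) such that for all $x,y$ the set $I(x,y)=\{z:(x,y,z)\in\Gamma\}$ is an open interval (possibly empty), and let $g\in C^2(\Gamma)$ with $g_z<0$ in $\Gamma$. Put $$\mathcal U=\{(x,g(x,y,z),g_x(x,y,z)):(x,y,z)\in\Gamma\},\qquad \mathcal U(x,u)=\{p:(x,u,p)\in\mathcal U\},$$ $$\Gamma^*=\{(x,y,g(x,y,z)):(x,y,z)\in\Gamma\},$$ let $g^*$ be the function on $\Gamma^*$ defined by $g(x,y,g^*(x,y,u))=u$, and put $P(x,y,u)=g_x(x,y,g^*(x,y,u))$ and $Q(x,y,z)=-g_y(x,y,z)/g_z(x,y,z)$. Assume: * **A1**: for each $(x,u,p)\in\mathcal U$ there is a unique point $(x,y,z)\in\Gamma$ with $g(x,y,z)=u$ and $g_x(x,y,z)=p$; write $y=Y(x,u,p)$, $z=Z(x,u,p)$. * **A2**: $\det E\neq0$ in $\Gamma$, where $E=g_{xy}-(g_z)^{-1}g_{xz}\otimes g_y$. * **A1\***: for all $(y,z)$ the mapping $Q(\cdot,y,z)$ is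 one-to-one on $\{x:(x,y,z)\in\Gamma\}$. * **A3w**: with $A(x,u,p)=g_{xx}(x,Y(x,u,p),Z(x,u,p))$, for all $x,u$ and all $\xi\in\mathbb R^n$ the function $p\mapsto A(x,u,p)\xi\cdot\xi$ is convex along the line segments contained in $\mathcal U(x,u)$ that are orthogonal to $\xi$. Let $\Omega\subset\mathbb R^n$ be a (nonempty, open, connected) domain and let $u\in C^0(\overline\Omega)$ be locally $g$-convex in $\Omega$: every $x_0\in\Omega$ has a neighbourhood $\mathcal N_0\subset\Omega$ and a pair $(y_0,z_0)$ with $\mathcal N_0\times\{(y_0,z_0)\}\subset\Gamma$, $u(x_0)=g(x_0,y_0,z_0)$ and $u\ge g(\cdot,y_0,z_0)$ in $\mathcal N_0$. Let $\partial u(x)$ be the set of all $p$ with $u(x')\ge u(x)+p\cdot(x'-x)+o(|x'-x|)$ as $x'\to x$, and put $$\Sigma_u(\Omega)=\{Y(x,u(x),p):x\in\Omega,\ p\in\partial u(x),\ (x,u(x),p)\in\mathcal U\}.$$ Assume also: 1. $\Omega$ is $g$-convex with respect to $(y,z)$, that is, $\Omega\times\{(y,z)\}\subset\Gamma$ and $Q(\cdot,y,z)(\Omega)$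 is convex, for all $y\in\Sigma_u(\Omega)$ and all $z=g^*(x,y,u(x))$ with $x\in\overline\Omega$, $(x,y,u(x))\in\Gamma^*$; 2. $\Sigma_u(\Omega)$ is sub $g^*$-convex with respect to $u$ on $\Omega$, that is, for all $x\in\Omega$ and $y_0,y_1\in\Sigma_u(\Omega)$ we have $(x,y_0,u(x)),(x,y_1,u(x))\in\Gamma^*$, and the segment joining $P(x,y_0,u(x))$ and $P(x,y_1,u(x))$ lies in $\mathcal U(x,u(x))$. Then $u$ is $g$-convex in $\Omega$: for each $x_0\in\Omega$ there is $(y_0,z_0)\in\mathbb R^n\times\mathbb R$ with $\Omega\times\{(y_0,z_0)\}\subset\Gamma$, $u(x_0)=g(x_0,y_0,z_0)$ and $u\ge g(\cdot,y_0,z_0)$ in $\Omega$. -/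

import Mathlib

open Set Filter Topology

noncomputable section

namespace GenFun

/-- Euclidean space `ℝⁿ`. -/
abbrev Eu (n : ℕ) : Type := EuclideanSpace ℝ (Fin n)

section Basic

variable {n : ℕ}

/-- The partial gradient `g_x(x, y, z)`. -/
def gx (g : Eu n → Eu n → ℝ → ℝ) (x y : Eu n) (z : ℝ) : Eu n :=
  gradient (fun x' => g x' y z) x

/-- The partial gradient `g_y(x, y, z)`. -/
def gy (g : Eu n → Eu n → ℝ → ℝ) (x y : Eu n) (z : ℝ) : Eu n :=
  gradient (fun y' => g x y' z) y

/-- The partial derivative `g_z(x, y, z)`. -/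
def gz (g : Eu n → Eu n → ℝ → ℝ) (x y : Eu n) (z : ℝ) : ℝ :=
  deriv (fun z' => g x y z') z

/-- The second derivative `g_xx`, the derivative of `g_x` in `x`, as a linear map (the matrix
`∂²g / ∂x_i ∂x_j` acting on vectors). -/
def gxx (g : Eu n → Eu n → ℝ → ℝ) (x y : Eu n) (z : ℝ) : Eu n →L[ℝ] Eu n :=
  fderiv ℝ (fun x' => gx g x' y z) x

/-- The mixed derivative `g_xy`, the derivative of `g_x` in `y`, as a linear map (the matrix
`∂²g / ∂x_i ∂y_j` with row index `i` acting on vectors). -/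
def gxy (g : Eu n → Eu n → ℝ → ℝ) (x y : Eu n) (z : ℝ) : Eu n →L[ℝ] Eu n :=
  fderiv ℝ (fun y' => gx g x y' z) y

/-- The mixed derivative `g_xz`, the derivative of `g_x` in `z`. -/
def gxz (g : Eu n → Eu n → ℝ → ℝ) (x y : Eu n) (z : ℝ) : Eu n :=
  deriv (fun z' => gx g x y z') z

/-- `E = g_xy - (g_z)⁻¹ g_xz ⊗ g_y`, where `(a ⊗ b) η = ⟨b, η⟩ a`. -/
def matE (g : Eu n → Eu n → ℝ → ℝ) (x y : Eu n) (z : ℝ) : Eu n →L[ℝ] Eu n :=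
  gxy g x y z - (gz g x y z)⁻¹ • (innerSL ℝ (gy g x y z)).smulRight (gxz g x y z)

/-- `Q = - g_y / g_z`. -/
def Q (g : Eu n → Eu n → ℝ → ℝ) (x y : Eu n) (z : ℝ) : Eu n :=
  -((gz g x y z)⁻¹ • gy g x y z)

/-- `g` is a generating function on `Γ`: `Γ` is a domain (open and connected) whose projections
`I(x, y) = {z | (x, y, z) ∈ Γ}` are (possibly empty) intervals, open since `Γ` is; `g` is of class
`C²` in `Γ`, and `g_z < 0` in `Γ`. -/
structure IsGeneratingFunction (Γ : Set (Eu n × Eu n × ℝ)) (g : Eu n → Eu n → ℝ → ℝ) :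
    Prop where
  isOpen : IsOpen Γ
  isConnected : IsConnected Γ
  interval : ∀ x y : Eu n, {z : ℝ | (x, y, z) ∈ Γ}.OrdConnected
  contDiffOn : ContDiffOn ℝ 2 (fun w : Eu n × Eu n × ℝ => g w.1 w.2.1 w.2.2) Γ
  gz_neg : ∀ x y z, (x, y, z) ∈ Γ → gz g x y z < 0

/-- `𝒰(x, u) = {p | (x, u, p) ∈ 𝒰}` where
`𝒰 = {(x, g(x, y, z), g_x(x, y, z)) | (x, y, z) ∈ Γ}`. -/
def USet (Γ : Set (Eu n × Eu n × ℝ)) (g : Eu n → Eu n → ℝ → ℝ) (x : Eu n) (u : ℝ) :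
    Set (Eu n) :=
  {p | ∃ (y : Eu n) (z : ℝ), (x, y, z) ∈ Γ ∧ g x y z = u ∧ gx g x y z = p}

/-- Condition A1: for `(x, u, p) ∈ 𝒰` there is a unique `(x, y, z) ∈ Γ` with
`g(x, y, z) = u` and `g_x(x, y, z) = p`. -/
def CondA1 (Γ : Set (Eu n × Eu n × ℝ)) (g : Eu n → Eu n → ℝ → ℝ) : Prop :=
  ∀ (x : Eu n) (u : ℝ), ∀ p ∈ USet Γ g x u,
    ∃! yz : Eu n × ℝ, (x, yz.1, yz.2) ∈ Γ ∧ g x yz.1 yz.2 = u ∧ gx g x yz.1 yz.2 = p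

/-- Condition A2: `det E ≠ 0` in `Γ`. -/
def CondA2 (Γ : Set (Eu n × Eu n × ℝ)) (g : Eu n → Eu n → ℝ → ℝ) : Prop :=
  ∀ x y z, (x, y, z) ∈ Γ → (matE g x y z).det ≠ 0

/-- Condition A1*: `Q(·, y, z)` is one-to-one on `{x | (x, y, z) ∈ Γ}`. -/
def CondA1Star (Γ : Set (Eu n × Eu n × ℝ)) (g : Eu n → Eu n → ℝ → ℝ) : Prop :=
  ∀ y z, InjOn (fun x => Q g x y z) {x | (x, y, z) ∈ Γ}

open Classical in
/-- The pair `(Y, Z)(x, u, p)`: the solution `(y, z)` of `g(x, y, z) = u`, `g_x(x, y, z) = p` with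
`(x, y, z) ∈ Γ` (unique under A1); the value is irrelevant for `(x, u, p) ∉ 𝒰`. -/
def YZ (Γ : Set (Eu n × Eu n × ℝ)) (g : Eu n → Eu n → ℝ → ℝ) (x : Eu n) (u : ℝ) (p : Eu n) :
    Eu n × ℝ :=
  if h : ∃ yz : Eu n × ℝ, (x, yz.1, yz.2) ∈ Γ ∧ g x yz.1 yz.2 = u ∧ gx g x yz.1 yz.2 = p
    then h.choose else 0

/-- The matrix function `A(x, u, p) = g_xx(x, Y(x, u, p), Z(x, u, p))`, as a linear map. -/
def matA (Γ : Set (Eu n × Eu n × ℝ)) (g : Eu n → Eu n → ℝ → ℝ) (x : Eu n) (u : ℝ) (p : Eu n) :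
    Eu n →L[ℝ] Eu n :=
  gxx g x (YZ Γ g x u p).1 (YZ Γ g x u p).2

/-- Condition A3w: for every `ξ`, the function `p ↦ (A(x, u, p) ξ, ξ)` is convex along the line
segments in `𝒰(x, u)` that are orthogonal to `ξ`. -/
def CondA3w (Γ : Set (Eu n × Eu n × ℝ)) (g : Eu n → Eu n → ℝ → ℝ) : Prop :=
  ∀ (x : Eu n) (u : ℝ) (p₀ p₁ ξ : Eu n), segment ℝ p₀ p₁ ⊆ USet Γ g x u →
    inner ℝ ξ (p₁ - p₀) = 0 →
    ConvexOn ℝ (segment ℝ p₀ p₁) (fun p => inner ℝ (matA Γ g x u p ξ) ξ)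

/-- `Γ* = {(x, y, g(x, y, z)) | (x, y, z) ∈ Γ}`, the domain of the dual generating function. -/
def GammaStar (Γ : Set (Eu n × Eu n × ℝ)) (g : Eu n → Eu n → ℝ → ℝ) :
    Set (Eu n × Eu n × ℝ) :=
  {w | ∃ z : ℝ, (w.1, w.2.1, z) ∈ Γ ∧ g w.1 w.2.1 z = w.2.2}

open Classical in
/-- The dual generating function `g*`: on `Γ*`, `g*(x, y, u)` is the `z` with `(x, y, z) ∈ Γ` and
`g(x, y, z) = u` (unique since `g_z < 0`); the value is irrelevant outside `Γ*`. -/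
def gStar (Γ : Set (Eu n × Eu n × ℝ)) (g : Eu n → Eu n → ℝ → ℝ) (x y : Eu n) (u : ℝ) : ℝ :=
  if h : ∃ z : ℝ, (x, y, z) ∈ Γ ∧ g x y z = u then h.choose else 0

/-- `P(x, y, u) = g_x(x, y, g*(x, y, u))`. -/
def P (Γ : Set (Eu n × Eu n × ℝ)) (g : Eu n → Eu n → ℝ → ℝ) (x y : Eu n) (u : ℝ) : Eu n :=
  gx g x y (gStar Γ g x y u)

/-- `Ω` is `g`-convex with respect to `(y, z)`: `Ω × {(y, z)} ⊆ Γ` and the image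
`Q(·, y, z)(Ω)` is convex. -/
def IsGConvexSet (Γ : Set (Eu n × Eu n × ℝ)) (g : Eu n → Eu n → ℝ → ℝ) (Ω : Set (Eu n))
    (y : Eu n) (z : ℝ) : Prop :=
  (∀ x ∈ Ω, (x, y, z) ∈ Γ) ∧ Convex ℝ ((fun x => Q g x y z) '' Ω)

/-- `V` is sub `g*`-convex with respect to the function `u` on `Ω`: for every `x ∈ Ω`, any two
points `y₀, y₁` of `V` are joined by a well-defined `g*`-segment with respect to `(x, u(x))`, that
is, `(x, y, u(x)) ∈ Γ*` for `y ∈ V` and the segment joining `P(x, y₀, u(x))` and `P(x, y₁, u(x))`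
lies in `𝒰(x, u(x))`. -/
def IsSubGStarConvex (Γ : Set (Eu n × Eu n × ℝ)) (g : Eu n → Eu n → ℝ → ℝ) (V : Set (Eu n))
    (u : Eu n → ℝ) (Ω : Set (Eu n)) : Prop :=
  ∀ x ∈ Ω, (∀ y ∈ V, (x, y, u x) ∈ GammaStar Γ g) ∧
    ∀ y₀ ∈ V, ∀ y₁ ∈ V, segment ℝ (P Γ g x y₀ (u x)) (P Γ g x y₁ (u x)) ⊆ USet Γ g x (u x)

/-- `g(·, y, z)` is a `g`-support of `u` at `x₀` in the set `N`. -/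
def IsGSupport (Γ : Set (Eu n × Eu n × ℝ)) (g : Eu n → Eu n → ℝ → ℝ) (u : Eu n → ℝ)
    (N : Set (Eu n)) (x₀ y : Eu n) (z : ℝ) : Prop :=
  (∀ x ∈ N, (x, y, z) ∈ Γ) ∧ u x₀ = g x₀ y z ∧ ∀ x ∈ N, g x y z ≤ u x

/-- `u` is `g`-convex in `Ω`: `u ∈ C⁰(Ω)` has a `g`-support in `Ω` at every point of `Ω`. -/
def IsGConvex (Γ : Set (Eu n × Eu n × ℝ)) (g : Eu n → Eu n → ℝ → ℝ) (u : Eu n → ℝ)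
    (Ω : Set (Eu n)) : Prop :=
  ContinuousOn u Ω ∧ ∀ x₀ ∈ Ω, ∃ (y : Eu n) (z : ℝ), IsGSupport Γ g u Ω x₀ y z

/-- `u` is locally `g`-convex in `Ω`: `u ∈ C⁰(Ω)` has at every point `x₀` of `Ω` a `g`-support in
some neighbourhood of `x₀`. -/
def IsLocallyGConvex (Γ : Set (Eu n × Eu n × ℝ)) (g : Eu n → Eu n → ℝ → ℝ) (u : Eu n → ℝ)
    (Ω : Set (Eu n)) : Prop :=
  ContinuousOn u Ω ∧ ∀ x₀ ∈ Ω, ∃ N ∈ 𝓝 x₀, N ⊆ Ω ∧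
    ∃ (y : Eu n) (z : ℝ), IsGSupport Γ g u N x₀ y z

/-- The subdifferential `∂u(x₀)` of a (locally semi-convex) function: all `p` with
`u(x) ≥ u(x₀) + p · (x - x₀) + o(|x - x₀|)` as `x → x₀`. -/
def subdiff (u : Eu n → ℝ) (x₀ : Eu n) : Set (Eu n) :=
  {p | ∀ ε > 0, ∀ᶠ x in 𝓝 x₀, u x₀ + inner ℝ p (x - x₀) - ε * ‖x - x₀‖ ≤ u x}

/-- `Σ_u(Ω) = ⋃_{x ∈ Ω} Y(x, u(x), ∂u(x))`. If the one jets `(x, u(x), p)`, `p ∈ ∂u(x)`, do not all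
lie in `𝒰`, only those in `𝒰` are used. -/
def SigmaSet (Γ : Set (Eu n × Eu n × ℝ)) (g : Eu n → Eu n → ℝ → ℝ) (u : Eu n → ℝ)
    (Ω : Set (Eu n)) : Set (Eu n) :=
  {y | ∃ x ∈ Ω, ∃ p ∈ subdiff u x, p ∈ USet Γ g x (u x) ∧ y = (YZ Γ g x (u x) p).1}

/-- `g*(·, y, u)(S) = {g*(x, y, u(x)) | x ∈ S}`, with `x` such that `(x, y, u(x)) ∈ Γ*`. -/
def gStarImage (Γ : Set (Eu n × Eu n × ℝ)) (g : Eu n → Eu n → ℝ → ℝ) (u : Eu n → ℝ)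
    (S : Set (Eu n)) (y : Eu n) : Set ℝ :=
  {z | ∃ x ∈ S, (x, y, u x) ∈ GammaStar Γ g ∧ z = gStar Γ g x y (u x)}

end Basic

end GenFun

end

/-! Fix a local support `g(·, y, z)` of `u` at `x₀` and put v(x) = g*(x, y, u(x)). Since `g`
decreases in `z`, the support is global exactly when v ≤ z in Ω; near `x₀` this holds, with equality
at `x₀`. Suppose that v(x₁) > z at some x₁ in Ω.

Global part. Along g-segments with respect to (y, z'), the curves that Q(·, y, z') straightens, v
obeys a strong minimum principle: if v ≥ z' on the segment with equality at an interior point, then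
v = z' on all of it (`gStar_gSegment_eq`). Hence, while both endpoints satisfy v > z', the property
v ≥ z' on the segment survives deformations. At a low level m one moves the second endpoint along a
path from x₀ to x₁; then the level is raised from m to z with the endpoints fixed. This gives v ≥ z
on the g-segment from x₀ to x₁ with respect to (y, z). Near x₀ also v ≤ z, so v touches z at an
interior point and v(x₁) = z, a contradiction.

Local part. At a touching point a, let g(·, y₁, z₁) be a local support of `u` and F = g(·, y₁, z₁) -
g(·, y, z). Then F(a) = 0 and F ≤ 0 along the segment, and the minimum principle needs F ≥ 0 there
near a (`eventually_le_of_gSegment`). It suffices that in the coordinates q = Q(x, y, z) the set {F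
≥ 0} contains its tangent hyperplane near a (`exists_tangent_nonneg`). As `g` is only C², A3w is
used through barriers instead of differential inequalities. Join (y, z) to (y₁, z₁) by the
g*-segment (y_θ, z_θ) with respect to a, and write g_θ = g(·, y_θ, z_θ), with g₀ = g(·, y, z). For
small θ the first variation puts each point of the half-space ⟨Q(x) - Q(a), η⟩ > 0 near a into {g_θ
> g₀} (`eventually_lt_gStarLine`), while A3w keeps {g_θ > g₀} above a paraboloid that osculates {F =
0}, uniformly in θ (`eventually_inner_le`, `eventually_paraboloid`). So F ≥ -ε|x - a|² on the
half-space (`eventually_neg_sq_le`). This holds at every zero of F near a, and sliding a parabola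
until it touches {F = 0} turns it into the local inclusion. -/

namespace GenFun

/-! ### Partial derivatives of the generating function and the derivative of Q. -/

variable {n : ℕ}

/-- The uncurried generating function. -/
abbrev unc (g : Eu n → Eu n → ℝ → ℝ) : Eu n × Eu n × ℝ → ℝ := fun w => g w.1 w.2.1 w.2.2

/-- The map `g_x` on triples. -/
noncomputable abbrev uncGx (g : Eu n → Eu n → ℝ → ℝ) : Eu n × Eu n × ℝ → Eu n := fun w => gx g w.1 w.2.1 w.2.2

/-- The map `g_y` on triples. -/
noncomputable abbrev uncGy (g : Eu n → Eu n → ℝ → ℝ) : Eu n × Eu n × ℝ → Eu n := fun w => gy g w.1 w.2.1 w.2.2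

/-- The map `g_z` on triples. -/
noncomputable abbrev uncGz (g : Eu n → Eu n → ℝ → ℝ) : Eu n × Eu n × ℝ → ℝ := fun w => gz g w.1 w.2.1 w.2.2

/-- The map `Q` on triples. -/
noncomputable abbrev uncQ (g : Eu n → Eu n → ℝ → ℝ) : Eu n × Eu n × ℝ → Eu n := fun w => Q g w.1 w.2.1 w.2.2

theorem contDiffAt_euclidean_of_inner {E : Type*} [NormedAddCommGroup E] [NormedSpace ℝ E]
    {m : WithTop ℕ∞} {F : E → Eu n} {w : E}
    (h : ∀ v : Eu n, ContDiffAt ℝ m (fun w' => inner ℝ (F w') v) w) : ContDiffAt ℝ m F w := by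
  rw [contDiffAt_euclidean]
  intro i
  simpa [EuclideanSpace.inner_single_right] using h (EuclideanSpace.single i 1)

variable {Γ : Set (Eu n × Eu n × ℝ)} {g : Eu n → Eu n → ℝ → ℝ} {w : Eu n × Eu n × ℝ}

theorem IsGeneratingFunction.contDiffAt (hg : IsGeneratingFunction Γ g) (hw : w ∈ Γ) :
    ContDiffAt ℝ 2 (unc g) w :=
  hg.contDiffOn.contDiffAt (hg.isOpen.mem_nhds hw)

theorem IsGeneratingFunction.hasFDerivAt (hg : IsGeneratingFunction Γ g) (hw : w ∈ Γ) :
    HasFDerivAt (unc g) (fderiv ℝ (unc g) w) w :=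
  ((hg.contDiffAt hw).differentiableAt (by norm_num)).hasFDerivAt

theorem hasFDerivAt_slice_fst {F : Type*} [NormedAddCommGroup F] [NormedSpace ℝ F]
    {f : Eu n × Eu n × ℝ → F} {f' : Eu n × Eu n × ℝ →L[ℝ] F} {x y : Eu n} {z : ℝ}
    (h : HasFDerivAt f f' (x, y, z)) : HasFDerivAt (fun x' => f (x', y, z))
      (f'.comp (ContinuousLinearMap.inl ℝ (Eu n) (Eu n × ℝ))) x :=
  _root_.HasFDerivAt.comp (g := f) x h (hasFDerivAt_prodMk_left x (y, z))

theorem hasFDerivAt_slice_snd {F : Type*} [NormedAddCommGroup F] [NormedSpace ℝ F]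
    {f : Eu n × Eu n × ℝ → F} {f' : Eu n × Eu n × ℝ →L[ℝ] F} {x y : Eu n} {z : ℝ}
    (h : HasFDerivAt f f' (x, y, z)) : HasFDerivAt (fun y' => f (x, y', z))
      (f'.comp ((ContinuousLinearMap.inr ℝ (Eu n) (Eu n × ℝ)).comp
        (ContinuousLinearMap.inl ℝ (Eu n) ℝ))) y :=
  _root_.HasFDerivAt.comp (g := f) y h
    (_root_.HasFDerivAt.comp (g := Prod.mk x) y (hasFDerivAt_prodMk_right x (y, z))
      (hasFDerivAt_prodMk_left y z))

theorem hasFDerivAt_slice_thd {F : Type*} [NormedAddCommGroup F] [NormedSpace ℝ F]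
    {f : Eu n × Eu n × ℝ → F} {f' : Eu n × Eu n × ℝ →L[ℝ] F} {x y : Eu n} {z : ℝ}
    (h : HasFDerivAt f f' (x, y, z)) :
    HasDerivAt (fun z' => f (x, y, z')) (f' (0, 0, 1)) z := by
  have := (_root_.HasFDerivAt.comp (g := f) z h
    (_root_.HasFDerivAt.comp (g := Prod.mk x) z (hasFDerivAt_prodMk_right x (y, z))
      (hasFDerivAt_prodMk_right (𝕜 := ℝ) y z))).hasDerivAt
  simp only [ContinuousLinearMap.comp_apply, ContinuousLinearMap.inr_apply] at this
  exact this

theorem IsGeneratingFunction.inner_gx (hg : IsGeneratingFunction Γ g) (hw : w ∈ Γ) (v : Eu n) :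
    inner ℝ (uncGx g w) v = fderiv ℝ (unc g) w (v, 0, 0) := by
  obtain ⟨x, y, z⟩ := w
  have h : HasFDerivAt (fun x' => g x' y z) _ x :=
    hasFDerivAt_slice_fst (f := unc g) (hg.hasFDerivAt hw)
  simp [uncGx, gx, gradient, h.fderiv, InnerProductSpace.toDual_symm_apply]
  rfl

theorem IsGeneratingFunction.inner_gy (hg : IsGeneratingFunction Γ g) (hw : w ∈ Γ) (v : Eu n) :
    inner ℝ (uncGy g w) v = fderiv ℝ (unc g) w (0, v, 0) := by
  obtain ⟨x, y, z⟩ := w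
  have h : HasFDerivAt (fun y' => g x y' z) _ y :=
    hasFDerivAt_slice_snd (f := unc g) (hg.hasFDerivAt hw)
  simp [uncGy, gy, gradient, h.fderiv, InnerProductSpace.toDual_symm_apply]

theorem IsGeneratingFunction.gz_eq (hg : IsGeneratingFunction Γ g) (hw : w ∈ Γ) :
    uncGz g w = fderiv ℝ (unc g) w (0, 0, 1) := by
  obtain ⟨x, y, z⟩ := w
  have h : HasDerivAt (fun z' => g x y z') _ z :=
    hasFDerivAt_slice_thd (f := unc g) (hg.hasFDerivAt hw)
  exact h.deriv

theorem IsGeneratingFunction.hasFDerivAt_fst (hg : IsGeneratingFunction Γ g) {x y : Eu n} {z : ℝ}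
    (hw : (x, y, z) ∈ Γ) : HasFDerivAt (fun x' => g x' y z) (innerSL ℝ (gx g x y z)) x := by
  have h : HasFDerivAt (fun x' => g x' y z) _ x :=
    hasFDerivAt_slice_fst (f := unc g) (hg.hasFDerivAt hw)
  have e : (fderiv ℝ (unc g) (x, y, z)).comp (ContinuousLinearMap.inl ℝ (Eu n) (Eu n × ℝ)) =
      innerSL ℝ (gx g x y z) := by
    ext v
    exact (hg.inner_gx hw v).symm
  exact e ▸ h

theorem IsGeneratingFunction.contDiffAt_fderiv (hg : IsGeneratingFunction Γ g) (hw : w ∈ Γ) :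
    ContDiffAt ℝ 1 (fderiv ℝ (unc g)) w :=
  (hg.contDiffAt hw).fderiv_right (by norm_num)

theorem IsGeneratingFunction.contDiffAt_fderiv_apply (hg : IsGeneratingFunction Γ g) (hw : w ∈ Γ)
    (dw : Eu n × Eu n × ℝ) : ContDiffAt ℝ 1 (fun w' => fderiv ℝ (unc g) w' dw) w :=
  (hg.contDiffAt_fderiv hw).clm_apply contDiffAt_const

theorem IsGeneratingFunction.hasFDerivAt_fderiv_apply (hg : IsGeneratingFunction Γ g) (hw : w ∈ Γ)
    (dw : Eu n × Eu n × ℝ) : HasFDerivAt (fun w' => fderiv ℝ (unc g) w' dw)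
      ((fderiv ℝ (fderiv ℝ (unc g)) w).flip dw) w := by
  have h := ((hg.contDiffAt_fderiv hw).differentiableAt (by norm_num)).hasFDerivAt.clm_apply
    (hasFDerivAt_const dw w)
  have e : (fderiv ℝ (unc g) w).comp (0 : Eu n × Eu n × ℝ →L[ℝ] Eu n × Eu n × ℝ) +
      (fderiv ℝ (fderiv ℝ (unc g)) w).flip dw = (fderiv ℝ (fderiv ℝ (unc g)) w).flip dw := by
    simp
  exact e ▸ h

theorem IsGeneratingFunction.fderiv_fderiv_comm (hg : IsGeneratingFunction Γ g) (hw : w ∈ Γ)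
    (a b : Eu n × Eu n × ℝ) :
    fderiv ℝ (fderiv ℝ (unc g)) w a b = fderiv ℝ (fderiv ℝ (unc g)) w b a :=
  ((hg.contDiffAt hw).isSymmSndFDerivAt (by simp)).eq a b

theorem IsGeneratingFunction.eventually_mem (hg : IsGeneratingFunction Γ g) (hw : w ∈ Γ) :
    ∀ᶠ w' in 𝓝 w, w' ∈ Γ := hg.isOpen.mem_nhds hw

theorem IsGeneratingFunction.contDiffAt_gx (hg : IsGeneratingFunction Γ g) (hw : w ∈ Γ) :
    ContDiffAt ℝ 1 (uncGx g) w :=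
  contDiffAt_euclidean_of_inner fun v => (hg.contDiffAt_fderiv_apply hw (v, 0, 0)).congr_of_eventuallyEq
    ((hg.eventually_mem hw).mono fun _ h => hg.inner_gx h v)

theorem IsGeneratingFunction.contDiffAt_gy (hg : IsGeneratingFunction Γ g) (hw : w ∈ Γ) :
    ContDiffAt ℝ 1 (uncGy g) w :=
  contDiffAt_euclidean_of_inner fun v => (hg.contDiffAt_fderiv_apply hw (0, v, 0)).congr_of_eventuallyEq
    ((hg.eventually_mem hw).mono fun _ h => hg.inner_gy h v)

theorem IsGeneratingFunction.contDiffAt_gz (hg : IsGeneratingFunction Γ g) (hw : w ∈ Γ) :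
    ContDiffAt ℝ 1 (uncGz g) w :=
  (hg.contDiffAt_fderiv_apply hw (0, 0, 1)).congr_of_eventuallyEq
    ((hg.eventually_mem hw).mono fun _ h => hg.gz_eq h)

theorem IsGeneratingFunction.gz_ne_zero (hg : IsGeneratingFunction Γ g) (hw : w ∈ Γ) :
    uncGz g w ≠ 0 := (hg.gz_neg w.1 w.2.1 w.2.2 hw).ne

theorem IsGeneratingFunction.contDiffAt_Q (hg : IsGeneratingFunction Γ g) (hw : w ∈ Γ) :
    ContDiffAt ℝ 1 (uncQ g) w :=
  (((hg.contDiffAt_gz hw).inv (hg.gz_ne_zero hw)).smul (hg.contDiffAt_gy hw)).neg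

theorem IsGeneratingFunction.inner_fderiv_gx (hg : IsGeneratingFunction Γ g) (hw : w ∈ Γ)
    (dw : Eu n × Eu n × ℝ) (v : Eu n) :
    inner ℝ (fderiv ℝ (uncGx g) w dw) v = fderiv ℝ (fderiv ℝ (unc g)) w dw (v, 0, 0) := by
  have h1 := ((hg.contDiffAt_gx hw).differentiableAt (by norm_num)).hasFDerivAt.inner ℝ
    (hasFDerivAt_const v w)
  have h2 := (hg.hasFDerivAt_fderiv_apply hw (v, 0, 0)).congr_of_eventuallyEq
    ((hg.eventually_mem hw).mono fun _ h => hg.inner_gx h v)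
  have := congrArg (fun L => L dw) (h1.unique h2)
  simpa [fderivInnerCLM_apply] using this

theorem IsGeneratingFunction.inner_fderiv_gy (hg : IsGeneratingFunction Γ g) (hw : w ∈ Γ)
    (dw : Eu n × Eu n × ℝ) (v : Eu n) :
    inner ℝ (fderiv ℝ (uncGy g) w dw) v = fderiv ℝ (fderiv ℝ (unc g)) w dw (0, v, 0) := by
  have h1 := ((hg.contDiffAt_gy hw).differentiableAt (by norm_num)).hasFDerivAt.inner ℝ
    (hasFDerivAt_const v w)
  have h2 := (hg.hasFDerivAt_fderiv_apply hw (0, v, 0)).congr_of_eventuallyEq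
    ((hg.eventually_mem hw).mono fun _ h => hg.inner_gy h v)
  have := congrArg (fun L => L dw) (h1.unique h2)
  simpa [fderivInnerCLM_apply] using this

theorem IsGeneratingFunction.fderiv_gz (hg : IsGeneratingFunction Γ g) (hw : w ∈ Γ)
    (dw : Eu n × Eu n × ℝ) :
    fderiv ℝ (uncGz g) w dw = fderiv ℝ (fderiv ℝ (unc g)) w dw (0, 0, 1) := by
  have h2 := (hg.hasFDerivAt_fderiv_apply hw (0, 0, 1)).congr_of_eventuallyEq
    ((hg.eventually_mem hw).mono fun _ h => hg.gz_eq h)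
  rw [h2.fderiv]; rfl

theorem IsGeneratingFunction.hasFDerivAt_gx (hg : IsGeneratingFunction Γ g) (hw : w ∈ Γ) :
    HasFDerivAt (uncGx g) (fderiv ℝ (uncGx g) w) w :=
  ((hg.contDiffAt_gx hw).differentiableAt (by norm_num)).hasFDerivAt

theorem IsGeneratingFunction.hasFDerivAt_gx_fst (hg : IsGeneratingFunction Γ g) {x y : Eu n}
    {z : ℝ} (hw : (x, y, z) ∈ Γ) : HasFDerivAt (fun x' => gx g x' y z) (gxx g x y z) x := by
  have h : HasFDerivAt (fun x' => gx g x' y z) _ x :=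
    hasFDerivAt_slice_fst (f := uncGx g) (hg.hasFDerivAt_gx hw)
  exact h.differentiableAt.hasFDerivAt

theorem IsGeneratingFunction.gxx_eq (hg : IsGeneratingFunction Γ g) {x y : Eu n}
    {z : ℝ} (hw : (x, y, z) ∈ Γ) (v : Eu n) :
    gxx g x y z v = fderiv ℝ (uncGx g) (x, y, z) (v, 0, 0) := by
  have h : HasFDerivAt (fun x' => gx g x' y z) _ x :=
    hasFDerivAt_slice_fst (f := uncGx g) (hg.hasFDerivAt_gx hw)
  rw [gxx, h.fderiv]; rfl

theorem IsGeneratingFunction.gxy_eq (hg : IsGeneratingFunction Γ g) {x y : Eu n}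
    {z : ℝ} (hw : (x, y, z) ∈ Γ) (v : Eu n) :
    gxy g x y z v = fderiv ℝ (uncGx g) (x, y, z) (0, v, 0) := by
  have h : HasFDerivAt (fun y' => gx g x y' z) _ y :=
    hasFDerivAt_slice_snd (f := uncGx g) (hg.hasFDerivAt_gx hw)
  rw [gxy, h.fderiv]; rfl

theorem IsGeneratingFunction.gxz_eq (hg : IsGeneratingFunction Γ g) {x y : Eu n}
    {z : ℝ} (hw : (x, y, z) ∈ Γ) :
    gxz g x y z = fderiv ℝ (uncGx g) (x, y, z) (0, 0, 1) := by
  have h : HasDerivAt (fun z' => gx g x y z') _ z :=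
    hasFDerivAt_slice_thd (f := uncGx g) (hg.hasFDerivAt_gx hw)
  exact h.deriv

theorem IsGeneratingFunction.fderiv_gx_yz (hg : IsGeneratingFunction Γ g) {x y : Eu n}
    {z : ℝ} (hw : (x, y, z) ∈ Γ) (η : Eu n) (c : ℝ) :
    fderiv ℝ (uncGx g) (x, y, z) (0, η, c) = gxy g x y z η + c • gxz g x y z := by
  rw [hg.gxy_eq hw, hg.gxz_eq hw, ← map_smul, ← map_add]
  simp

theorem matE_apply (x y : Eu n) (z : ℝ) (η : Eu n) :
    matE g x y z η =
      gxy g x y z η - ((gz g x y z)⁻¹ * inner ℝ (gy g x y z) η) • gxz g x y z := by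
  simp [matE, smul_smul]

/-- Symmetry of the second derivatives turns the x-derivative of -g_y/g_z into -1/g_z times the
transpose of E. This is how A2 controls the coordinates Q. -/
theorem IsGeneratingFunction.inner_fderiv_Q (hg : IsGeneratingFunction Γ g) {x y : Eu n}
    {z : ℝ} (hw : (x, y, z) ∈ Γ) (v η : Eu n) :
    inner ℝ (fderiv ℝ (uncQ g) (x, y, z) (v, 0, 0)) η =
      -((gz g x y z)⁻¹ * inner ℝ v (matE g x y z η)) := by
  have hz : gz g x y z ≠ 0 := hg.gz_ne_zero hw
  have h1 : HasFDerivAt (uncGz g) (fderiv ℝ (uncGz g) (x, y, z)) (x, y, z) :=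
    ((hg.contDiffAt_gz hw).differentiableAt (by norm_num)).hasFDerivAt
  have h2 : HasFDerivAt (uncGy g) (fderiv ℝ (uncGy g) (x, y, z)) (x, y, z) :=
    ((hg.contDiffAt_gy hw).differentiableAt (by norm_num)).hasFDerivAt
  have h3 : HasFDerivAt (uncQ g) _ (x, y, z) := (((hasDerivAt_inv hz).comp_hasFDerivAt (x, y, z) h1).smul h2).neg
  rw [h3.fderiv]
  have e1 := hg.inner_fderiv_gy hw (v, 0, 0) η
  have e2 := hg.fderiv_gz hw (v, 0, 0)
  have e3 := hg.inner_fderiv_gx hw (0, η, 0) v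
  have e4 := hg.inner_fderiv_gx hw (0, 0, 1) v
  rw [hg.fderiv_fderiv_comm hw, ← hg.gxy_eq hw] at e3
  rw [hg.fderiv_fderiv_comm hw, ← hg.gxz_eq hw] at e4
  rw [← e3] at e1
  rw [← e4] at e2
  rw [matE_apply]
  simp only [neg_apply, add_apply,
    smul_apply, ContinuousLinearMap.smulRight_apply, inner_neg_left,
    inner_add_left, inner_smul_left, e1, e2, inner_sub_right, inner_smul_right, smul_eq_mul]
  simp only [Function.comp_apply, uncGy, uncGz, real_inner_comm v, conj_trivial]
  field_simp
  ring

end GenFun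

/-! ### The one-jet map and the regularity of (Y, Z). -/

namespace GenFun

variable {n : ℕ} {Γ : Set (Eu n × Eu n × ℝ)} {g : Eu n → Eu n → ℝ → ℝ}

theorem gx_mem_USet {x y : Eu n} {z : ℝ} (hw : (x, y, z) ∈ Γ) :
    gx g x y z ∈ USet Γ g x (g x y z) := ⟨y, z, hw, rfl, rfl⟩

theorem YZ_spec {x p : Eu n} {u : ℝ} (hp : p ∈ USet Γ g x u) :
    (x, (YZ Γ g x u p).1, (YZ Γ g x u p).2) ∈ Γ ∧ g x (YZ Γ g x u p).1 (YZ Γ g x u p).2 = u ∧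
      gx g x (YZ Γ g x u p).1 (YZ Γ g x u p).2 = p := by
  have h : ∃ yz : Eu n × ℝ, (x, yz.1, yz.2) ∈ Γ ∧ g x yz.1 yz.2 = u ∧ gx g x yz.1 yz.2 = p := by
    obtain ⟨y, z, h⟩ := hp
    exact ⟨(y, z), h⟩
  rw [YZ, dif_pos h]
  exact h.choose_spec

theorem CondA1.YZ_eq (hA1 : CondA1 Γ g) {x y p : Eu n} {z u : ℝ} (hw : (x, y, z) ∈ Γ)
    (hu : g x y z = u) (hp : gx g x y z = p) : YZ Γ g x u p = (y, z) := by
  have hm : p ∈ USet Γ g x u := ⟨y, z, hw, hu, hp⟩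
  exact (hA1 x u p hm).unique (YZ_spec hm) ⟨hw, hu, hp⟩

theorem CondA2.matE_injective (hA2 : CondA2 Γ g) {x y : Eu n} {z : ℝ} (hw : (x, y, z) ∈ Γ) :
    Function.Injective (matE g x y z) := by
  have h : IsUnit (LinearMap.det (matE g x y z : Eu n →ₗ[ℝ] Eu n)) := (hA2 x y z hw).isUnit
  exact ((Module.End.isUnit_iff _).1 ((LinearMap.isUnit_iff_isUnit_det _).2 h)).1

theorem CondA2.matE_surjective (hA2 : CondA2 Γ g) {x y : Eu n} {z : ℝ} (hw : (x, y, z) ∈ Γ) :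
    Function.Surjective (matE g x y z) :=
  LinearMap.surjective_of_injective (f := (matE g x y z : Eu n →ₗ[ℝ] Eu n)) (hA2.matE_injective hw)

/-- The map `(x, y, z) ↦ (x, g, g_x)`. -/
noncomputable def jet (g : Eu n → Eu n → ℝ → ℝ) : Eu n × Eu n × ℝ → Eu n × ℝ × Eu n :=
  fun w => (w.1, unc g w, uncGx g w)

theorem continuousLinearEquiv_of_injective {E F : Type*} [NormedAddCommGroup E] [NormedSpace ℝ E]
    [NormedAddCommGroup F] [NormedSpace ℝ F] [FiniteDimensional ℝ E] [FiniteDimensional ℝ F]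
    (L : E →L[ℝ] F) (hL : ∀ v, L v = 0 → v = 0)
    (hd : Module.finrank ℝ E = Module.finrank ℝ F) : ∃ e : E ≃L[ℝ] F, (e : E →L[ℝ] F) = L := by
  have hi : Function.Injective (L : E →ₗ[ℝ] F) := by
    rw [← LinearMap.ker_eq_bot, LinearMap.ker_eq_bot']
    exact hL
  refine ⟨(LinearEquiv.ofInjectiveOfFinrankEq (L : E →ₗ[ℝ] F) hi hd).toContinuousLinearEquiv, ?_⟩
  ext v
  rfl

/-- On the kernel, the equation for `g` gives the z-increment -⟨g_y, η⟩/g_z; inserted into the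
equation for g_x it leaves E η = 0, and A2 applies. -/
theorem IsGeneratingFunction.exists_jet_hasStrictFDerivAt (hg : IsGeneratingFunction Γ g)
    (hA2 : CondA2 Γ g) {x y : Eu n} {z : ℝ} (hw : (x, y, z) ∈ Γ) :
    ∃ e : (Eu n × Eu n × ℝ) ≃L[ℝ] (Eu n × ℝ × Eu n),
      HasStrictFDerivAt (jet g) (e : (Eu n × Eu n × ℝ) →L[ℝ] (Eu n × ℝ × Eu n)) (x, y, z) := by
  have h : HasStrictFDerivAt (jet g) _ (x, y, z) :=
    (hasStrictFDerivAt_fst (𝕜 := ℝ) (p := (x, y, z))).prodMk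
    (((hg.contDiffAt hw).hasStrictFDerivAt (by norm_num)).prodMk
      ((hg.contDiffAt_gx hw).hasStrictFDerivAt (by norm_num)))
  obtain ⟨e, he⟩ := continuousLinearEquiv_of_injective (L := (ContinuousLinearMap.fst ℝ (Eu n)
    (Eu n × ℝ)).prod ((fderiv ℝ (unc g) (x, y, z)).prod (fderiv ℝ (uncGx g) (x, y, z)))) (by
      rintro ⟨a, η, c⟩ hv
      simp only [ContinuousLinearMap.prod_apply, ContinuousLinearMap.coe_fst', Prod.mk_eq_zero] at hv
      obtain ⟨rfl, h1, h2⟩ := hv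
      rw [hg.fderiv_gx_yz hw] at h2
      have e1 : (0, η, c) = ((0, η, 0) : Eu n × Eu n × ℝ) + c • (0, 0, 1) := by simp
      rw [e1, map_add, map_smul, ← hg.inner_gy hw, ← hg.gz_eq hw] at h1
      have hz : gz g x y z ≠ 0 := hg.gz_ne_zero hw
      simp only [uncGy, uncGz, smul_eq_mul] at h1
      have hc : c = -((gz g x y z)⁻¹ * inner ℝ (gy g x y z) η) := by
        field_simp
        linarith
      have hE : matE g x y z η = 0 := by
        rw [matE_apply, ← h2, hc]
        module
      have hη : η = 0 := hA2.matE_injective hw (by rw [hE, map_zero])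
      subst hη
      simp at hc
      simp [hc]) (by simp; ring)
  exact ⟨e, he ▸ h⟩

/-- By A1 the chosen solution must coincide with the local inverse of `jet`, so it inherits
differentiability, and 𝒰 is open. -/
theorem IsGeneratingFunction.YZ_regular (hg : IsGeneratingFunction Γ g) (hA1 : CondA1 Γ g)
    (hA2 : CondA2 Γ g) {x p : Eu n} {u : ℝ} (hp : p ∈ USet Γ g x u) :
    (∀ᶠ q : Eu n × ℝ × Eu n in 𝓝 (x, u, p), q.2.2 ∈ USet Γ g q.1 q.2.1) ∧
      DifferentiableAt ℝ (fun q : Eu n × ℝ × Eu n => YZ Γ g q.1 q.2.1 q.2.2) (x, u, p) := by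
  obtain ⟨y, z, hw, rfl, rfl⟩ := hp
  obtain ⟨e, he⟩ := hg.exists_jet_hasStrictFDerivAt hA2 hw
  have h1 := he.eventually_right_inverse
  have h2 := he.localInverse_tendsto.eventually (hg.eventually_mem hw)
  have h3 := he.to_localInverse.hasFDerivAt.snd
  set Λ := he.localInverse
  have h4 : ∀ᶠ q : Eu n × ℝ × Eu n in 𝓝 (x, g x y z, gx g x y z),
      q.2.2 ∈ USet Γ g q.1 q.2.1 ∧ YZ Γ g q.1 q.2.1 q.2.2 = (Λ q).2 := by
    refine (h1.and h2).mono ?_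
    rintro ⟨x', u', p'⟩ ⟨hq, hm⟩
    simp only [jet, Prod.mk.injEq] at hq
    obtain ⟨q1, q2, q3⟩ := hq
    have hm' : (x', (Λ (x', u', p')).2.1, (Λ (x', u', p')).2.2) ∈ Γ := by
      conv at hm => rw [← Prod.eta (Λ (x', u', p')), q1]
      exact hm
    simp only [unc, uncGx, q1] at q2 q3
    exact ⟨⟨_, _, hm', q2, q3⟩, hA1.YZ_eq hm' q2 q3⟩
  exact ⟨h4.mono fun _ h => h.1,
    (h3.congr_of_eventuallyEq (h4.mono fun _ h => h.2)).differentiableAt⟩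

theorem IsGeneratingFunction.continuousAt_YZ (hg : IsGeneratingFunction Γ g) (hA1 : CondA1 Γ g)
    (hA2 : CondA2 Γ g) {x p : Eu n} {u : ℝ} (hp : p ∈ USet Γ g x u) :
    ContinuousAt (fun q : Eu n × ℝ × Eu n => YZ Γ g q.1 q.2.1 q.2.2) (x, u, p) :=
  (hg.YZ_regular hA1 hA2 hp).2.continuousAt

/-- The derivative of `(Y, Z)` in `p` at fixed `(x, u)`. -/
theorem IsGeneratingFunction.hasDerivAt_YZ_line (hg : IsGeneratingFunction Γ g)
    (hA1 : CondA1 Γ g) (hA2 : CondA2 Γ g) {x y v : Eu n} {z : ℝ} (hw : (x, y, z) ∈ Γ)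
    {η : Eu n} (hη : matE g x y z η = v) :
    HasDerivAt (fun θ : ℝ => YZ Γ g x (g x y z) (gx g x y z + θ • v))
      (η, -((gz g x y z)⁻¹ * inner ℝ (gy g x y z) η)) 0 := by
  have hp := gx_mem_USet (g := g) hw
  obtain ⟨hU, hd⟩ := hg.YZ_regular hA1 hA2 hp
  have hline : HasDerivAt (fun θ : ℝ => ((x, g x y z, gx g x y z + θ • v) : Eu n × ℝ × Eu n))
      (0, 0, v) 0 := by
    refine (hasDerivAt_const _ _).prodMk ((hasDerivAt_const _ _).prodMk ?_)
    simpa using ((hasDerivAt_id (0 : ℝ)).smul_const v).const_add (gx g x y z)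
  have h0 : ((x, g x y z, gx g x y z + (0 : ℝ) • v) : Eu n × ℝ × Eu n) =
      (x, g x y z, gx g x y z) := by simp
  have hY : HasDerivAt (fun θ : ℝ => YZ Γ g x (g x y z) (gx g x y z + θ • v))
      (fderiv ℝ (fun q : Eu n × ℝ × Eu n => YZ Γ g q.1 q.2.1 q.2.2)
        (x, g x y z, gx g x y z) (0, 0, v)) 0 :=
    HasFDerivAt.comp_hasDerivAt_of_eq (0 : ℝ) hd.hasFDerivAt hline h0.symm
  generalize hD : fderiv ℝ (fun q : Eu n × ℝ × Eu n => YZ Γ g q.1 q.2.1 q.2.2)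
        (x, g x y z, gx g x y z) (0, 0, v) = D at hY
  obtain ⟨η', c⟩ := D
  have hev : ∀ᶠ θ : ℝ in 𝓝 0, gx g x y z + θ • v ∈ USet Γ g x (g x y z) := by
    have := hline.continuousAt.tendsto
    simp only [h0] at this
    exact this.eventually hU
  have hY0 : YZ Γ g x (g x y z) (gx g x y z + (0 : ℝ) • v) = (y, z) := by
    simpa using hA1.YZ_eq hw rfl rfl
  have hYx : HasDerivAt (fun θ : ℝ => (x, YZ Γ g x (g x y z) (gx g x y z + θ • v)))
      (0, η', c) 0 := (hasDerivAt_const _ _).prodMk hY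
  have d1 : HasDerivAt (fun θ : ℝ => unc g (x, YZ Γ g x (g x y z) (gx g x y z + θ • v)))
      (fderiv ℝ (unc g) (x, y, z) (0, η', c)) 0 :=
    HasFDerivAt.comp_hasDerivAt_of_eq (0 : ℝ) (hg.hasFDerivAt hw) hYx (by rw [hY0])
  have d2 : HasDerivAt (fun θ : ℝ => uncGx g (x, YZ Γ g x (g x y z) (gx g x y z + θ • v)))
      (fderiv ℝ (uncGx g) (x, y, z) (0, η', c)) 0 :=
    HasFDerivAt.comp_hasDerivAt_of_eq (0 : ℝ) (hg.hasFDerivAt_gx hw) hYx (by rw [hY0])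
  -- Along the line `g` stays constant and g_x moves with velocity v. Differentiating these two
  -- identities gives a linear system for (η', c), which A2 makes uniquely solvable.
  have d1' : HasDerivAt (fun θ : ℝ => unc g (x, YZ Γ g x (g x y z) (gx g x y z + θ • v))) 0 0 :=
    (hasDerivAt_const (0 : ℝ) (g x y z)).congr_of_eventuallyEq
      (hev.mono fun θ h => (YZ_spec h).2.1)
  have d2' : HasDerivAt (fun θ : ℝ => uncGx g (x, YZ Γ g x (g x y z) (gx g x y z + θ • v))) v 0 := by
    have : HasDerivAt (fun θ : ℝ => gx g x y z + θ • v) v 0 := by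
      simpa using ((hasDerivAt_id (0 : ℝ)).smul_const v).const_add (gx g x y z)
    exact this.congr_of_eventuallyEq (hev.mono fun θ h => (YZ_spec h).2.2)
  have e1 := d1.unique d1'
  have e2 := d2.unique d2'
  rw [hg.fderiv_gx_yz hw] at e2
  have es : (0, η', c) = ((0, η', 0) : Eu n × Eu n × ℝ) + c • (0, 0, 1) := by simp
  rw [es, map_add, map_smul, ← hg.inner_gy hw, ← hg.gz_eq hw] at e1
  have hz : gz g x y z ≠ 0 := hg.gz_ne_zero hw
  simp only [uncGy, uncGz, smul_eq_mul] at e1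
  have hc : c = -((gz g x y z)⁻¹ * inner ℝ (gy g x y z) η') := by
    field_simp
    linarith
  have hη' : η' = η := by
    apply hA2.matE_injective hw
    rw [hη, ← e2, matE_apply, hc]
    module
  rw [← hη', ← hc]
  exact hY

end GenFun

/-! ### Sliding lines and parabolas. -/

namespace GenFun

/-- A barrier argument: if `f` is increasing in its second variable, `f(0, 0) = 0 > f(T, 0)` and
`f(t, βt) > 0` for small `t > 0`, then some line of small positive slope lies in `{f ≤ 0}` and
touches `{f = 0}` at an interior point. -/
theorem exists_touching_line {f : ℝ → ℝ → ℝ} {T R η : ℝ} (hT : 0 < T) (hR : 0 < R) (hη : 0 < η)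
    (hc : ContinuousOn (fun q : ℝ × ℝ => f q.1 q.2) (Icc 0 T ×ˢ Icc (-R) R))
    (hmono : ∀ t ∈ Icc 0 T, StrictMonoOn (f t) (Icc (-R) R))
    (h0 : f 0 0 = 0) (hneg : f T 0 < 0) (hpos : ∀ β > 0, ∀ᶠ t in 𝓝[>] (0 : ℝ), 0 < f t (β * t))
    (hlow : ∀ t ∈ Icc 0 T, f t (-(R / 2)) < 0) :
    ∃ β ∈ Ioo 0 η, ∃ k < 0, ∃ t₀ ∈ Ioo 0 T, f t₀ (β * t₀ + k) = 0 ∧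
      (∀ t ∈ Icc 0 T, f t (β * t + k) ≤ 0) ∧ ∀ t ∈ Icc 0 T, β * t + k ∈ Icc (-R) (R / 2) := by
  have hcT : ContinuousOn (f T) (Icc (-R) R) := by
    have : ContinuousOn (fun s : ℝ => (T, s)) (Icc (-R) R) := by fun_prop
    exact hc.comp this fun s hs => ⟨⟨hT.le, le_rfl⟩, hs⟩
  have hnear : ∀ᶠ s in 𝓝 (0 : ℝ), f T s < 0 :=
    (hcT.continuousAt (Icc_mem_nhds (by linarith) hR)).eventually_lt continuousAt_const hneg
  -- The slope is small enough that the tilted line is still in {f < 0} at T and that its translates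
  -- by k in [-R, 0] stay in the domain.
  obtain ⟨β, hβη, hβT, hβR⟩ : ∃ β, β ∈ Ioo 0 η ∧ f T (β * T) < 0 ∧ β * T ≤ R / 2 := by
    have h1 : ∀ᶠ β in 𝓝 (0 : ℝ), f T (β * T) < 0 := by
      have : Tendsto (fun β : ℝ => β * T) (𝓝 0) (𝓝 0) := by
        have : ContinuousAt (fun β : ℝ => β * T) 0 := by fun_prop
        simpa [ContinuousAt] using this
      exact this.eventually hnear
    have h2 : ∀ᶠ β in 𝓝[>] (0 : ℝ), β ∈ Ioo 0 η := Ioo_mem_nhdsGT hη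
    have h3 : ∀ᶠ β in 𝓝[>] (0 : ℝ), β ∈ Ioo 0 (R / 2 / T) := Ioo_mem_nhdsGT (by positivity)
    obtain ⟨β, hβ1, hβ2, hβ3⟩ := ((h1.filter_mono nhdsWithin_le_nhds).and (h2.and h3)).exists
    exact ⟨β, hβ2, hβ1, (le_div_iff₀ hT).1 hβ3.2.le⟩
  have hβ := hβη.1
  have hrange : ∀ t ∈ Icc 0 T, 0 ≤ β * t ∧ β * t ≤ R / 2 := fun t ht =>
    ⟨by have := ht.1; positivity, (mul_le_mul_of_nonneg_left ht.2 hβ.le).trans hβR⟩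
  set K : Set (ℝ × ℝ) := Icc 0 T ×ˢ Icc (-R) 0 with hKdef
  have hmaps : MapsTo (fun q : ℝ × ℝ => (q.1, β * q.1 + q.2)) K (Icc 0 T ×ˢ Icc (-R) R) := by
    rintro ⟨t, s⟩ ⟨ht, hs⟩
    have := hrange t ht
    exact ⟨ht, by dsimp only; linarith [hs.1], by dsimp only; linarith [hs.2]⟩
  have hcK : ContinuousOn (fun q : ℝ × ℝ => f q.1 (β * q.1 + q.2)) K := by
    have : ContinuousOn (fun q : ℝ × ℝ => (q.1, β * q.1 + q.2)) K := by fun_prop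
    exact hc.comp this hmaps
  have hKc : IsCompact K := isCompact_Icc.prod isCompact_Icc
  -- Pairs (t, k) at which the translate by k meets {f ≥ 0}. Compactness yields the lowest such k,
  -- which is the touching line.
  set Z : Set (ℝ × ℝ) := K ∩ (fun q : ℝ × ℝ => f q.1 (β * q.1 + q.2)) ⁻¹' Ici 0 with hZdef
  have hZc : IsCompact Z := hKc.of_isClosed_subset
    (hcK.preimage_isClosed_of_isClosed hKc.isClosed isClosed_Ici) inter_subset_left
  obtain ⟨t₁, ht₁, hft₁⟩ : ∃ t₁ ∈ Ioo 0 T, 0 < f t₁ (β * t₁) :=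
    (((hpos β hβ).and (Ioo_mem_nhdsGT hT)).exists).imp fun _ h => ⟨h.2, h.1⟩
  have ht₁' : t₁ ∈ Icc 0 T := ⟨ht₁.1.le, ht₁.2.le⟩
  obtain ⟨s₁, hs₁, hfs₁⟩ : ∃ s₁ ∈ Ioo (-R) 0, 0 < f t₁ (β * t₁ + s₁) := by
    have hcont : ContinuousOn (fun s => f t₁ (β * t₁ + s)) (Icc (-R) 0) := by
      have : ContinuousOn (fun s : ℝ => (t₁, s)) (Icc (-R) 0) := by fun_prop
      exact hcK.comp this fun s hs => ⟨ht₁', hs⟩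
    have h1 : ∀ᶠ s in 𝓝[Icc (-R) 0] (0 : ℝ), 0 < f t₁ (β * t₁ + s) :=
      (hcont 0 ⟨by linarith, le_rfl⟩).eventually_const_lt (by simpa using hft₁)
    rw [nhdsWithin_Icc_eq_nhdsLE (by linarith)] at h1
    obtain ⟨s, hs1, hs2⟩ := ((h1.filter_mono (nhdsWithin_mono _ Iio_subset_Iic_self)).and
      (Ioo_mem_nhdsLT (show -R < 0 by linarith))).exists
    exact ⟨s, hs2, hs1⟩
  have hZne : Z.Nonempty := ⟨(t₁, s₁), ⟨ht₁', hs₁.1.le, hs₁.2.le⟩, hfs₁.le⟩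
  obtain ⟨⟨t₀, k⟩, ⟨⟨ht₀, hk⟩, hfk⟩, hmin⟩ := hZc.exists_isMinOn hZne continuousOn_snd
  simp only [mem_preimage, mem_Ici] at hfk ht₀ hk
  have hk0 : k < 0 := lt_of_le_of_lt (hmin (show (t₁, s₁) ∈ Z from
    ⟨⟨ht₁', hs₁.1.le, hs₁.2.le⟩, hfs₁.le⟩)) hs₁.2
  have hkR : -R < k := by
    refine lt_of_le_of_ne hk.1 fun h => ?_
    have hr := hrange t₀ ht₀
    have := (hmono t₀ ht₀).monotoneOn (a := β * t₀ + k) (b := -(R / 2))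
      ⟨by linarith, by linarith⟩ ⟨by linarith, by linarith⟩ (by linarith)
    linarith [hlow t₀ ht₀]
  have hle : ∀ t ∈ Icc 0 T, f t (β * t + k) ≤ 0 := by
    intro t ht
    have hcont : ContinuousOn (fun s => f t (β * t + s)) (Icc (-R) 0) := by
      have : ContinuousOn (fun s : ℝ => (t, s)) (Icc (-R) 0) := by fun_prop
      exact hcK.comp this fun s hs => ⟨ht, hs⟩
    have h1 : Tendsto (fun s => f t (β * t + s)) (𝓝[<] k) (𝓝 (f t (β * t + k))) :=
      (hcont.continuousAt (Icc_mem_nhds hkR hk0)).tendsto.mono_left nhdsWithin_le_nhds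
    refine le_of_tendsto h1 ?_
    filter_upwards [Ioo_mem_nhdsLT hkR] with s hs
    by_contra! hcon
    have : k ≤ s := hmin (show (t, s) ∈ Z from ⟨⟨ht, hs.1.le, (hs.2.trans hk0).le⟩, hcon.le⟩)
    linarith [hs.2]
  refine ⟨β, hβη, k, hk0, t₀, ⟨?_, ?_⟩, le_antisymm (hle t₀ ht₀) hfk, hle, fun t ht => ?_⟩
  -- No contact at the ends: since k < 0, monotonicity gives a value below f 0 0 = 0 at t = 0 and
  -- below f T (β T) < 0 at t = T.
  · refine lt_of_le_of_ne ht₀.1 fun h => ?_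
    rw [← h] at hfk ht₀
    have := hmono 0 ht₀ (a := β * 0 + k) (b := 0) ⟨by linarith, by linarith⟩
      ⟨by linarith, by linarith⟩ (by linarith)
    linarith
  · refine lt_of_le_of_ne ht₀.2 fun h => ?_
    rw [h] at hfk ht₀
    have hr := hrange T ht₀
    have := hmono T ht₀ (a := β * T + k) (b := β * T) ⟨by linarith, by linarith⟩
      ⟨by linarith, by linarith⟩ (by linarith)
    linarith
  · have := hrange t ht
    exact ⟨by linarith, by linarith⟩

/-- The barrier argument with parabolas in a plane of a normed space. -/
theorem exists_touching_parabola {E : Type*} [NormedAddCommGroup E] [NormedSpace ℝ E]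
    {F : E → ℝ} {L : E →L[ℝ] ℝ} {e ξ ν : E} {r κ c T η : ℝ}
    (hF : ∀ a ∈ Metric.ball e r, ∀ b ∈ Metric.ball e r, |F a - F b - L (a - b)| ≤ κ * ‖a - b‖)
    (h0 : F e = 0) (hd : HasFDerivAt F L e) (hξ : L ξ = 0) (hκ0 : 0 ≤ κ) (hκ : 2 * κ < L ν)
    (hξ1 : ‖ξ‖ ≤ 1) (hν1 : ‖ν‖ ≤ 1) (hT : 0 < T) (hTr : 10 * T < r) (hcT : |c| * T ≤ 1)
    (hη : 0 < η) (hneg : F (e + (T • ξ + (c * T ^ 2) • ν)) < 0) :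
    ∃ β ∈ Ioo 0 η, ∃ k : ℝ, ∃ t₀ ∈ Ioo 0 T,
      F (e + (t₀ • ξ + (c * t₀ ^ 2 + (β * t₀ + k)) • ν)) = 0 ∧
      (∀ t ∈ Icc 0 T, F (e + (t • ξ + (c * t ^ 2 + (β * t + k)) • ν)) ≤ 0) ∧
      ∀ t ∈ Icc 0 T, ‖t • ξ + (c * t ^ 2 + (β * t + k)) • ν‖ ≤ 10 * T := by
  have hct : ∀ t ∈ Icc 0 T, |c * t ^ 2| ≤ T := by
    intro t ht
    rw [abs_mul, abs_of_nonneg (sq_nonneg t)]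
    have h1 : t ^ 2 ≤ T ^ 2 := pow_le_pow_left₀ ht.1 ht.2 2
    calc |c| * t ^ 2 ≤ |c| * T ^ 2 := by gcongr
      _ = (|c| * T) * T := by ring
      _ ≤ 1 * T := by gcongr
      _ = T := one_mul T
  have hbd : ∀ t ∈ Icc 0 T, ∀ s : ℝ, ‖t • ξ + (c * t ^ 2 + s) • ν‖ ≤ 2 * T + |s| := by
    intro t ht s
    calc ‖t • ξ + (c * t ^ 2 + s) • ν‖ ≤ ‖t • ξ‖ + ‖(c * t ^ 2 + s) • ν‖ := norm_add_le _ _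
      _ = |t| * ‖ξ‖ + |c * t ^ 2 + s| * ‖ν‖ := by simp [norm_smul]
      _ ≤ |t| * 1 + (|c * t ^ 2| + |s|) * 1 := by
        gcongr
        exact abs_add_le _ _
      _ ≤ 2 * T + |s| := by
        have := hct t ht
        rw [abs_of_nonneg ht.1]
        linarith [ht.2]
  have hmem : ∀ t ∈ Icc 0 T, ∀ s ∈ Icc (-(8 * T)) (8 * T),
      e + (t • ξ + (c * t ^ 2 + s) • ν) ∈ Metric.ball e r := by
    intro t ht s hs
    rw [mem_ball_iff_norm, add_sub_cancel_left]
    have := hbd t ht s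
    have := abs_le.2 hs
    linarith
  have hcont : ContinuousOn F (Metric.ball e r) := by
    intro a ha
    have h1 : Tendsto (fun b => F b - F a - L (b - a)) (𝓝[Metric.ball e r] a) (𝓝 0) := by
      have h2 : Tendsto (fun b => κ * ‖b - a‖) (𝓝[Metric.ball e r] a) (𝓝 0) := by
        have : Continuous fun b => κ * ‖b - a‖ := by fun_prop
        simpa using (this.tendsto a).mono_left nhdsWithin_le_nhds
      exact squeeze_zero_norm' (eventually_nhdsWithin_of_forall fun b hb => hF b hb a ha) h2
    have h3 : Tendsto (fun b => F a + L (b - a)) (𝓝[Metric.ball e r] a) (𝓝 (F a)) := by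
      have : Continuous fun b => F a + L (b - a) := by fun_prop
      simpa using (this.tendsto a).mono_left nhdsWithin_le_nhds
    have := h1.add h3
    simp only [zero_add] at this
    refine this.congr fun b => by ring
  -- Heights are measured from the parabola c t². With R = 8T and |c t²| ≤ T all points stay within
  -- 10T of e, inside the ball where F is nearly linear.
  have key := exists_touching_line (f := fun t s => F (e + (t • ξ + (c * t ^ 2 + s) • ν)))
    (T := T) (R := 8 * T) (η := η) hT (by positivity) hη ?_ ?_ (by simpa using h0)
    (by simpa using hneg) ?_ ?_
  · obtain ⟨β, hβ, k, -, t₀, ht₀, h1, h2, h3⟩ := key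
    refine ⟨β, hβ, k, t₀, ht₀, h1, h2, fun t ht => ?_⟩
    have := hbd t ht (β * t + k)
    have h4 : |β * t + k| ≤ 8 * T := abs_le.2 ⟨(h3 t ht).1, by linarith [(h3 t ht).2]⟩
    linarith
  · refine hcont.comp (by fun_prop) ?_
    rintro ⟨t, s⟩ ⟨ht, hs⟩
    exact hmem t ht s hs
  · intro t ht s hs s' hs' hss
    have h1 := hF _ (hmem t ht s' hs') _ (hmem t ht s hs)
    have h2 : e + (t • ξ + (c * t ^ 2 + s') • ν) - (e + (t • ξ + (c * t ^ 2 + s) • ν)) =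
        (s' - s) • ν := by module
    rw [h2, map_smul, norm_smul, Real.norm_eq_abs, abs_of_pos (sub_pos.2 hss), smul_eq_mul] at h1
    have h3 := (abs_le.1 h1).1
    have h4 : κ * ((s' - s) * ‖ν‖) ≤ κ * ((s' - s) * 1) := by
      have := sub_pos.2 hss
      gcongr
    have h5 : κ * (s' - s) < (s' - s) * L ν := by nlinarith [sub_pos.2 hss]
    show F _ < F _
    linarith
  · intro β hβ
    have hline : HasDerivAt (fun t : ℝ => e + (t • ξ + (c * t ^ 2 + β * t) • ν)) (ξ + β • ν) 0 := by
      have h1 : HasDerivAt (fun t : ℝ => c * t ^ 2 + β * t) β 0 := by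
        have := ((hasDerivAt_pow 2 (0 : ℝ)).const_mul c).fun_add ((hasDerivAt_id (0 : ℝ)).const_mul β)
        simpa using this
      have h2 := (((hasDerivAt_id (0 : ℝ)).smul_const ξ).add (h1.smul_const ν)).const_add e
      simpa using h2
    have hcomp : HasDerivAt (fun t : ℝ => F (e + (t • ξ + (c * t ^ 2 + β * t) • ν)))
        (L (ξ + β • ν)) 0 :=
      HasFDerivAt.comp_hasDerivAt_of_eq (0 : ℝ) hd hline (by simp)
    have hL : 0 < L (ξ + β • ν) := by
      rw [map_add, map_smul, hξ, zero_add, smul_eq_mul]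
      have : 0 < L ν := by linarith
      positivity
    have h3 := (hasDerivAt_iff_tendsto_slope.1 hcomp).eventually (lt_mem_nhds hL)
    have h4 := h3.filter_mono (nhdsWithin_mono (0 : ℝ) (fun t (ht : 0 < t) => ht.ne'))
    filter_upwards [h4, self_mem_nhdsWithin] with t ht ht0
    have ht0' : (0 : ℝ) < t := ht0
    simp only [slope, sub_zero, vsub_eq_sub, smul_eq_mul] at ht
    have h6 := (pos_iff_pos_of_mul_pos ht).1 (by positivity)
    simpa [h0] using h6
  -- At height -4T the linear part is at most -3T · L ν and the error at most 6κT, so 2κ < L ν makes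
  -- F negative.
  · intro t ht
    have hm := hmem t ht (-(8 * T / 2)) ⟨by linarith, by linarith⟩
    have h1 := hF _ hm e (Metric.mem_ball_self (by linarith))
    rw [add_sub_cancel_left, h0, map_add, map_smul, map_smul, hξ, smul_zero, zero_add,
      smul_eq_mul] at h1
    have h2 := (abs_le.1 h1).2
    have h3 := hbd t ht (-(8 * T / 2))
    have h4 : |-(8 * T / 2)| = 4 * T := by rw [abs_neg, abs_of_pos (by positivity)]; ring
    rw [h4] at h3
    have h5 := mul_le_mul_of_nonneg_left h3 hκ0
    have h6 : (c * t ^ 2 + -(8 * T / 2)) * L ν ≤ (-(3 * T)) * L ν := by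
      have : 0 ≤ L ν := by linarith
      refine mul_le_mul_of_nonneg_right ?_ this
      linarith [(abs_le.1 (hct t ht)).2]
    show F _ < 0
    nlinarith

end GenFun

/-! ### A3w for the functions of a g*-segment near its base point. -/

namespace GenFun

variable {n : ℕ} {Γ : Set (Eu n × Eu n × ℝ)} {g : Eu n → Eu n → ℝ → ℝ}

/-- If d were negative, t₀ would also be a local maximum, so φ would be constant nearby and d would
vanish. -/
theorem deriv_eq_zero_and_nonneg_of_isLocalMin {φ φ' : ℝ → ℝ} {t₀ d : ℝ}
    (h1 : ∀ᶠ t in 𝓝 t₀, HasDerivAt φ (φ' t) t) (h2 : HasDerivAt φ' d t₀)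
    (hmin : IsLocalMin φ t₀) : φ' t₀ = 0 ∧ 0 ≤ d := by
  have h3 : φ' t₀ = 0 := hmin.hasDerivAt_eq_zero h1.self_of_nhds
  refine ⟨h3, ?_⟩
  by_contra! hd
  have hev : deriv φ =ᶠ[𝓝 t₀] φ' := h1.mono fun t ht => ht.deriv
  have hdd : deriv (deriv φ) t₀ = d := (h2.congr_of_eventuallyEq hev).deriv
  have hmax := isLocalMax_of_deriv_deriv_neg (f := φ) (x₀ := t₀) (by rw [hdd]; exact hd)
    (by rw [hev.eq_of_nhds, h3]) h1.self_of_nhds.continuousAt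
  have hconst : φ =ᶠ[𝓝 t₀] fun _ => φ t₀ := by
    filter_upwards [hmin, hmax] with t ht1 ht2 using le_antisymm ht2 ht1
  have hφ' : φ' =ᶠ[𝓝 t₀] fun _ => 0 := by
    filter_upwards [hconst.eventuallyEq_nhds, h1] with t ht1 ht2
    exact ht2.unique ((hasDerivAt_const t (φ t₀)).congr_of_eventuallyEq ht1)
  have := h2.unique ((hasDerivAt_const t₀ (0 : ℝ)).congr_of_eventuallyEq hφ')
  linarith

/-- Openness of 𝒰 and compactness of the segment let A3w be used at points near a. -/
theorem IsGeneratingFunction.eventually_segment_subset (hg : IsGeneratingFunction Γ g)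
    (hA1 : CondA1 Γ g) (hA2 : CondA2 Γ g) {a p₀ p₁ : Eu n} {u : ℝ}
    (hseg : segment ℝ p₀ p₁ ⊆ USet Γ g a u) :
    ∀ᶠ q : Eu n × ℝ × Eu n × Eu n in 𝓝 (a, u, p₀, p₁),
      segment ℝ q.2.2.1 q.2.2.2 ⊆ USet Γ g q.1 q.2.1 := by
  have h : ∀ᶠ q : Eu n × ℝ × Eu n × Eu n in 𝓝 (a, u, p₀, p₁), ∀ t ∈ Icc (0 : ℝ) 1,
      (1 - t) • q.2.2.1 + t • q.2.2.2 ∈ USet Γ g q.1 q.2.1 := by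
    refine isCompact_Icc.eventually_forall_of_forall_eventually fun t ht => ?_
    have hm : (1 - t) • p₀ + t • p₁ ∈ USet Γ g a u :=
      hseg ⟨1 - t, t, by linarith [ht.2], ht.1, by ring, rfl⟩
    have hc : Continuous (fun r : (Eu n × ℝ × Eu n × Eu n) × ℝ =>
        ((r.1.1, r.1.2.1, (1 - r.2) • r.1.2.2.1 + r.2 • r.1.2.2.2) : Eu n × ℝ × Eu n)) := by
      fun_prop
    exact (hc.tendsto ((a, u, p₀, p₁), t)).eventually (hg.YZ_regular hA1 hA2 hm).1
  filter_upwards [h] with q hq p hp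
  rw [segment_eq_image] at hp
  obtain ⟨t, ht, rfl⟩ := hp
  exact hq t ht

theorem IsGeneratingFunction.continuousAt_gxx (hg : IsGeneratingFunction Γ g)
    {w : Eu n × Eu n × ℝ} (hw : w ∈ Γ) :
    ContinuousAt (fun w : Eu n × Eu n × ℝ => gxx g w.1 w.2.1 w.2.2) w := by
  have h1 : ContinuousAt (fderiv ℝ (uncGx g)) w :=
    ((hg.contDiffAt_gx hw).fderiv_right (m := 0) (by norm_num)).continuousAt
  have h2 : ContinuousAt (fun w => (fderiv ℝ (uncGx g) w).comp
      (ContinuousLinearMap.inl ℝ (Eu n) (Eu n × ℝ))) w := h1.clm_comp continuousAt_const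
  refine h2.congr ((hg.eventually_mem hw).mono fun w' hw' => ?_)
  ext1 v
  exact (hg.gxx_eq hw' v).symm

theorem IsGeneratingFunction.continuousAt_matA (hg : IsGeneratingFunction Γ g)
    (hA1 : CondA1 Γ g) (hA2 : CondA2 Γ g) {a p : Eu n} {u : ℝ} (hp : p ∈ USet Γ g a u) :
    ContinuousAt (fun q : Eu n × ℝ × Eu n => matA Γ g q.1 q.2.1 q.2.2) (a, u, p) := by
  have h1 : ContinuousAt (fun q : Eu n × ℝ × Eu n => (q.1, YZ Γ g q.1 q.2.1 q.2.2)) (a, u, p) :=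
    continuousAt_fst.prodMk (hg.continuousAt_YZ hA1 hA2 hp)
  exact ContinuousAt.comp (f := fun q : Eu n × ℝ × Eu n => (q.1, YZ Γ g q.1 q.2.1 q.2.2))
    (hg.continuousAt_gxx (YZ_spec hp).1) h1

theorem CondA1.matA_eq (hA1 : CondA1 Γ g) {x y p : Eu n} {z u : ℝ} (hw : (x, y, z) ∈ Γ)
    (hu : g x y z = u) (hp : gx g x y z = p) : matA Γ g x u p = gxx g x y z := by
  rw [matA, hA1.YZ_eq hw hu hp]

/-- The `g*`-segment with respect to `(a, g(a, y, z))` starting at `(y, z)` in direction `v`. -/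
noncomputable def gStarLine (Γ : Set (Eu n × Eu n × ℝ)) (g : Eu n → Eu n → ℝ → ℝ) (a y : Eu n)
    (z : ℝ) (v : Eu n) (θ : ℝ) : Eu n × ℝ :=
  YZ Γ g a (g a y z) (gx g a y z + θ • v)

/-- The difference quotient along a `g*`-segment of the gradients of the functions `g(·, y, z)`. -/
noncomputable def gradQuot (Γ : Set (Eu n × Eu n × ℝ)) (g : Eu n → Eu n → ℝ → ℝ) (a y : Eu n)
    (z : ℝ) (v x : Eu n) (θ : ℝ) : Eu n :=
  θ⁻¹ • (uncGx g (x, gStarLine Γ g a y z v θ) - gx g x y z)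

variable {a y₀ v η₀ : Eu n} {z₀ : ℝ}

theorem CondA1.gStarLine_zero (hA1 : CondA1 Γ g) (hw : (a, y₀, z₀) ∈ Γ) :
    gStarLine Γ g a y₀ z₀ v 0 = (y₀, z₀) := by
  rw [gStarLine, zero_smul, add_zero, hA1.YZ_eq hw rfl rfl]

theorem IsGeneratingFunction.tendsto_gStarLine (hg : IsGeneratingFunction Γ g)
    (hA1 : CondA1 Γ g) (hA2 : CondA2 Γ g) (hw : (a, y₀, z₀) ∈ Γ) :
    Tendsto (gStarLine Γ g a y₀ z₀ v) (𝓝 0) (𝓝 (y₀, z₀)) := by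
  obtain ⟨η, hη⟩ := hA2.matE_surjective hw v
  have := (hg.hasDerivAt_YZ_line hA1 hA2 hw hη).continuousAt.tendsto
  rw [zero_smul, add_zero, hA1.YZ_eq hw rfl rfl] at this
  exact this

/-- Strict differentiability of g_x makes the difference quotients converge jointly in x and θ. The
limit is D g_x applied to the initial velocity (0, η, c) of the g*-segment, which is E η = v. -/
theorem IsGeneratingFunction.tendsto_gradQuot (hg : IsGeneratingFunction Γ g)
    (hA1 : CondA1 Γ g) (hA2 : CondA2 Γ g) (hw : (a, y₀, z₀) ∈ Γ) :
    Tendsto (fun q : Eu n × ℝ => gradQuot Γ g a y₀ z₀ v q.1 q.2) (𝓝 a ×ˢ 𝓝[>] 0) (𝓝 v) := by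
  obtain ⟨η, hη⟩ := hA2.matE_surjective hw v
  have hd := hg.hasDerivAt_YZ_line hA1 hA2 hw hη
  set c : ℝ := -((gz g a y₀ z₀)⁻¹ * inner ℝ (gy g a y₀ z₀) η) with hc
  have hstr : HasStrictFDerivAt (uncGx g) (fderiv ℝ (uncGx g) (a, y₀, z₀)) (a, y₀, z₀) :=
    (hg.contDiffAt_gx hw).hasStrictFDerivAt (by norm_num)
  set D := fderiv ℝ (uncGx g) (a, y₀, z₀) with hD
  have hDv : D (0, η, c) = v := by
    rw [hD, hg.fderiv_gx_yz hw, ← hη, matE_apply, hc]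
    module
  set l : Filter (Eu n × ℝ) := 𝓝 a ×ˢ 𝓝[>] 0
  have hl1 : Tendsto (fun q : Eu n × ℝ => q.1) l (𝓝 a) := tendsto_fst
  have hl2 : Tendsto (fun q : Eu n × ℝ => q.2) l (𝓝[>] 0) := tendsto_snd
  have hl20 : Tendsto (fun q : Eu n × ℝ => q.2) l (𝓝 0) := hl2.mono_right nhdsWithin_le_nhds
  have hY := (hg.tendsto_gStarLine (v := v) hA1 hA2 hw).comp hl20
  have hpair : Tendsto (fun q : Eu n × ℝ => ((q.1, gStarLine Γ g a y₀ z₀ v q.2),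
      ((q.1, y₀, z₀) : Eu n × Eu n × ℝ))) l (𝓝 ((a, y₀, z₀), (a, y₀, z₀))) := by
    refine Tendsto.prodMk_nhds (hl1.prodMk_nhds hY) (hl1.prodMk_nhds tendsto_const_nhds)
  have ho := (hasStrictFDerivAt_iff_isLittleO.1 hstr).comp_tendsto hpair
  have hslope : Tendsto (fun θ : ℝ => θ⁻¹ • (gStarLine Γ g a y₀ z₀ v θ - (y₀, z₀))) (𝓝[>] 0)
      (𝓝 (η, c)) := by
    have := (hasDerivAt_iff_tendsto_slope.1 hd).mono_left
      (nhdsWithin_mono (0 : ℝ) (fun t (ht : 0 < t) => ht.ne'))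
    refine this.congr fun θ => ?_
    simp [slope, gStarLine, hA1.YZ_eq hw rfl rfl]
  have hbig : (fun q : Eu n × ℝ => ((q.1, gStarLine Γ g a y₀ z₀ v q.2) : Eu n × Eu n × ℝ) -
      (q.1, y₀, z₀)) =O[l] fun q => q.2 := by
    have h1 : (fun θ : ℝ => gStarLine Γ g a y₀ z₀ v θ - (y₀, z₀)) =O[𝓝[>] 0] fun θ => θ := by
      have h2 : (fun θ : ℝ => θ • (θ⁻¹ • (gStarLine Γ g a y₀ z₀ v θ - (y₀, z₀)))) =O[𝓝[>] 0]
          fun θ : ℝ => θ • (1 : ℝ) :=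
        (Asymptotics.isBigO_refl _ _).smul (hslope.isBigO_one ℝ)
      refine (h2.congr' ?_ ?_)
      · filter_upwards [self_mem_nhdsWithin] with θ hθ
        rw [smul_smul, mul_inv_cancel₀ (ne_of_gt hθ), one_smul]
      · filter_upwards with θ
        simp
    have h3 := h1.comp_tendsto hl2
    refine (Asymptotics.IsBigO.of_bound 1 (Eventually.of_forall fun q => ?_)).trans h3
    simp [Prod.norm_def]
  have ho2 := ho.trans_isBigO hbig
  have ho3 : Tendsto (fun q : Eu n × ℝ => q.2⁻¹ • (uncGx g (q.1, gStarLine Γ g a y₀ z₀ v q.2) -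
      uncGx g (q.1, y₀, z₀) - D ((q.1, gStarLine Γ g a y₀ z₀ v q.2) - (q.1, y₀, z₀)))) l (𝓝 0) :=
    ho2.tendsto_inv_smul_nhds_zero
  have h4 : Tendsto (fun q : Eu n × ℝ => q.2⁻¹ • D ((q.1, gStarLine Γ g a y₀ z₀ v q.2) -
      (q.1, y₀, z₀))) l (𝓝 v) := by
    have h5 : Tendsto (fun q : Eu n × ℝ => D (0, q.2⁻¹ • (gStarLine Γ g a y₀ z₀ v q.2 -
        (y₀, z₀)))) l (𝓝 (D (0, η, c))) :=
      (D.continuous.tendsto _).comp (tendsto_const_nhds.prodMk_nhds (hslope.comp hl2))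
    rw [hDv] at h5
    refine h5.congr fun q => ?_
    rw [← map_smul]
    simp
  have h6 := ho3.add h4
  rw [zero_add] at h6
  refine h6.congr fun q => ?_
  rw [← smul_add, sub_add_cancel, gradQuot]

theorem IsGeneratingFunction.hasFDerivAt_fst' (hg : IsGeneratingFunction Γ g) {x : Eu n}
    {q : Eu n × ℝ} (hw : (x, q) ∈ Γ) :
    HasFDerivAt (fun x' => unc g (x', q)) (innerSL ℝ (uncGx g (x, q))) x :=
  hg.hasFDerivAt_fst hw

/-- Condition A3w, near a point `a`, for the tangent vectors of the level surfaces
`{g(·, y_θ, z_θ) = g(·, y₀, z₀)}`, where `(y_θ, z_θ)` is a `g*`-segment with respect to `a`. -/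
theorem CondA3w.eventually_inner_le (hA3w : CondA3w Γ g) (hg : IsGeneratingFunction Γ g)
    (hA1 : CondA1 Γ g) (hA2 : CondA2 Γ g) {y₁ : Eu n} {z₁ : ℝ} (hw₀ : (a, y₀, z₀) ∈ Γ)
    (hw₁ : (a, y₁, z₁) ∈ Γ) (hu : g a y₁ z₁ = g a y₀ z₀)
    (hv : gx g a y₁ z₁ - gx g a y₀ z₀ = v)
    (hseg : segment ℝ (gx g a y₀ z₀) (gx g a y₁ z₁) ⊆ USet Γ g a (g a y₀ z₀)) {η : ℝ}
    (hη : 0 < η) :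
    ∀ᶠ q : Eu n × ℝ in 𝓝 a ×ˢ 𝓝[>] 0, (q.1, gStarLine Γ g a y₀ z₀ v q.2) ∈ Γ ∧
      (q.1, y₀, z₀) ∈ Γ ∧ ‖gradQuot Γ g a y₀ z₀ v q.1 q.2 - v‖ ≤ η ∧
      (unc g (q.1, gStarLine Γ g a y₀ z₀ v q.2) = g q.1 y₀ z₀ → ∀ τ : Eu n,
        inner ℝ (gradQuot Γ g a y₀ z₀ v q.1 q.2) τ = 0 →
        inner ℝ ((gxx g q.1 (gStarLine Γ g a y₀ z₀ v q.2).1 (gStarLine Γ g a y₀ z₀ v q.2).2 -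
          gxx g q.1 y₀ z₀) τ) τ ≤
          q.2 * (inner ℝ ((gxx g a y₁ z₁ - gxx g a y₀ z₀) τ) τ + η * ‖τ‖ ^ 2)) := by
  set l : Filter (Eu n × ℝ) := 𝓝 a ×ˢ 𝓝[>] 0
  have hl1 : Tendsto (fun q : Eu n × ℝ => q.1) l (𝓝 a) := tendsto_fst
  have hl2 : Tendsto (fun q : Eu n × ℝ => q.2) l (𝓝[>] 0) := tendsto_snd
  have hl20 : Tendsto (fun q : Eu n × ℝ => q.2) l (𝓝 0) := hl2.mono_right nhdsWithin_le_nhds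
  have hY := (hg.tendsto_gStarLine (v := v) hA1 hA2 hw₀).comp hl20
  have hG := hg.tendsto_gradQuot (v := v) hA1 hA2 hw₀
  have hw0 : Tendsto (fun q : Eu n × ℝ => ((q.1, y₀, z₀) : Eu n × Eu n × ℝ)) l
      (𝓝 (a, y₀, z₀)) := hl1.prodMk_nhds tendsto_const_nhds
  have hp0 : Tendsto (fun q : Eu n × ℝ => gx g q.1 y₀ z₀) l (𝓝 (gx g a y₀ z₀)) :=
    (hg.contDiffAt_gx hw₀).continuousAt.tendsto.comp hw0
  have hu0 : Tendsto (fun q : Eu n × ℝ => g q.1 y₀ z₀) l (𝓝 (g a y₀ z₀)) :=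
    (hg.contDiffAt hw₀).continuousAt.tendsto.comp hw0
  have hp1 : Tendsto (fun q : Eu n × ℝ => gx g q.1 y₀ z₀ + gradQuot Γ g a y₀ z₀ v q.1 q.2) l
      (𝓝 (gx g a y₁ z₁)) := by
    have := hp0.add hG
    have e : gx g a y₀ z₀ + v = gx g a y₁ z₁ := by rw [← hv, add_sub_cancel]
    rwa [e] at this
  have hm0 : gx g a y₀ z₀ ∈ USet Γ g a (g a y₀ z₀) := hseg (left_mem_segment ℝ _ _)
  have hm1 : gx g a y₁ z₁ ∈ USet Γ g a (g a y₀ z₀) := hseg (right_mem_segment ℝ _ _)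
  have hA : Tendsto (fun q : Eu n × ℝ =>
      matA Γ g q.1 (g q.1 y₀ z₀) (gx g q.1 y₀ z₀ + gradQuot Γ g a y₀ z₀ v q.1 q.2) -
      matA Γ g q.1 (g q.1 y₀ z₀) (gx g q.1 y₀ z₀)) l
      (𝓝 (gxx g a y₁ z₁ - gxx g a y₀ z₀)) := by
    have h1 := (hg.continuousAt_matA hA1 hA2 hm1).tendsto.comp
      (hl1.prodMk_nhds (hu0.prodMk_nhds hp1))
    have h0 := (hg.continuousAt_matA hA1 hA2 hm0).tendsto.comp
      (hl1.prodMk_nhds (hu0.prodMk_nhds hp0))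
    have := h1.sub h0
    rwa [hA1.matA_eq hw₁ hu rfl, hA1.matA_eq hw₀ rfl rfl] at this
  have e1 : ∀ᶠ q in l, (q.1, gStarLine Γ g a y₀ z₀ v q.2) ∈ Γ :=
    (hl1.prodMk_nhds hY).eventually (hg.eventually_mem hw₀)
  have e2 : ∀ᶠ q in l, (q.1, y₀, z₀) ∈ Γ := hw0.eventually (hg.eventually_mem hw₀)
  have e3 : ∀ᶠ q in l, ‖gradQuot Γ g a y₀ z₀ v q.1 q.2 - v‖ ≤ η := by
    filter_upwards [hG.eventually (Metric.closedBall_mem_nhds v hη)] with q hq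
    rwa [dist_eq_norm] at hq
  have e4 := (hl1.prodMk_nhds (hu0.prodMk_nhds (hp0.prodMk_nhds hp1))).eventually
    (hg.eventually_segment_subset hA1 hA2 hseg)
  have e5 := hA.eventually (Metric.closedBall_mem_nhds _ hη)
  have e6 : ∀ᶠ q in l, q.2 ∈ Ioo (0 : ℝ) 1 := hl2.eventually (Ioo_mem_nhdsGT one_pos)
  filter_upwards [e1, e2, e3, e4, e5, e6] with ⟨x, θ⟩ h1 h2 h3 h4 h5 h6
  refine ⟨h1, h2, h3, fun hzero τ hτ => ?_⟩
  simp only at h1 h2 h3 h4 h5 h6 hzero hτ ⊢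
  set p := gx g x y₀ z₀
  set d := gradQuot Γ g a y₀ z₀ v x θ with hd
  set yz := gStarLine Γ g a y₀ z₀ v θ with hyz
  have hpθ : gx g x yz.1 yz.2 = p + θ • d := by
    rw [hd, gradQuot, smul_smul, mul_inv_cancel₀ h6.1.ne', one_smul, add_sub_cancel]
  -- Where the two functions agree at x, the gradient of the θ-function is p + θ d, a point of the
  -- segment from p to p + d. Convexity bounds A there by its values at the two ends, so no
  -- derivative of A in p is needed; d is close to v, so the far end is close to `gx g a y₁ z₁`.
  have hconv := hA3w x (g x y₀ z₀) p (p + d) τ h4 (by rwa [add_sub_cancel_left, real_inner_comm])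
  have hineq := hconv.2 (left_mem_segment ℝ p (p + d)) (right_mem_segment ℝ p (p + d))
    (show (0 : ℝ) ≤ 1 - θ by linarith [h6.2]) h6.1.le (by ring)
  have hmid : (1 - θ) • p + θ • (p + d) = p + θ • d := by module
  rw [hmid] at hineq
  beta_reduce at hineq
  rw [hA1.matA_eq (y := yz.1) (z := yz.2) h1 hzero hpθ, hA1.matA_eq h2 rfl rfl] at hineq
  rw [dist_eq_norm, hA1.matA_eq h2 rfl rfl] at h5
  set A₁ := matA Γ g x (g x y₀ z₀) (p + d)
  set K := gxx g a y₁ z₁ - gxx g a y₀ z₀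
  have h7 : inner ℝ ((A₁ - gxx g x y₀ z₀ - K) τ) τ ≤ η * ‖τ‖ ^ 2 := by
    calc inner ℝ ((A₁ - gxx g x y₀ z₀ - K) τ) τ ≤ ‖(A₁ - gxx g x y₀ z₀ - K) τ‖ * ‖τ‖ :=
          real_inner_le_norm _ _
      _ ≤ (η * ‖τ‖) * ‖τ‖ := by
          gcongr
          exact ((A₁ - gxx g x y₀ z₀ - K).le_opNorm τ).trans (by gcongr)
      _ = η * ‖τ‖ ^ 2 := by ring
  simp only [sub_apply, inner_sub_left, smul_eq_mul] at h7 hineq ⊢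
  have h8 := mul_le_mul_of_nonneg_left h7 h6.1.le
  linarith

end GenFun

/-! ### Comparison with paraboloids, uniformly in θ. -/

namespace GenFun

variable {n : ℕ} {Γ : Set (Eu n × Eu n × ℝ)} {g : Eu n → Eu n → ℝ → ℝ}

/-- First and second order necessary conditions at a minimum along a parabola. -/
theorem inner_eq_zero_and_nonneg_of_isLocalMin_parabola {G : Eu n → ℝ} {G' : Eu n → Eu n}
    {H : Eu n →L[ℝ] Eu n} {a ξ ν : Eu n} {c β k t₀ : ℝ}
    (hG : ∀ᶠ x in 𝓝 (a + (t₀ • ξ + (c * t₀ ^ 2 + (β * t₀ + k)) • ν)),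
      HasFDerivAt G (innerSL ℝ (G' x)) x)
    (hH : HasFDerivAt G' H (a + (t₀ • ξ + (c * t₀ ^ 2 + (β * t₀ + k)) • ν)))
    (hmin : IsLocalMin (fun t => G (a + (t • ξ + (c * t ^ 2 + (β * t + k)) • ν))) t₀) :
    inner ℝ (G' (a + (t₀ • ξ + (c * t₀ ^ 2 + (β * t₀ + k)) • ν))) (ξ + (2 * c * t₀ + β) • ν) = 0 ∧
      0 ≤ inner ℝ (H (ξ + (2 * c * t₀ + β) • ν)) (ξ + (2 * c * t₀ + β) • ν) +
        2 * c * inner ℝ (G' (a + (t₀ • ξ + (c * t₀ ^ 2 + (β * t₀ + k)) • ν))) ν := by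
  set p : ℝ → Eu n := fun t => a + (t • ξ + (c * t ^ 2 + (β * t + k)) • ν) with hp
  have hp' : ∀ t, HasDerivAt p (ξ + (2 * c * t + β) • ν) t := by
    intro t
    have h1 : HasDerivAt (fun t : ℝ => c * t ^ 2 + (β * t + k)) (2 * c * t + β) t := by
      have := ((hasDerivAt_pow 2 t).const_mul c).fun_add
        (((hasDerivAt_id t).const_mul β).add_const k)
      refine this.congr_deriv ?_
      simp
      ring
    have h2 := (((hasDerivAt_id t).smul_const ξ).fun_add (h1.smul_const ν)).const_add a
    rw [one_smul] at h2
    exact h2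
  have hp'' : HasDerivAt (fun t : ℝ => ξ + (2 * c * t + β) • ν) ((2 * c) • ν) t₀ := by
    have h1 : HasDerivAt (fun t : ℝ => 2 * c * t + β) (2 * c) t₀ := by
      simpa using ((hasDerivAt_id t₀).const_mul (2 * c)).add_const β
    exact (h1.smul_const ν).const_add ξ
  have hφ : ∀ᶠ t in 𝓝 t₀, HasDerivAt (fun t => G (p t))
      (inner ℝ (G' (p t)) (ξ + (2 * c * t + β) • ν)) t := by
    have := (hp' t₀).continuousAt.tendsto.eventually hG
    filter_upwards [this] with t ht
    exact ht.comp_hasDerivAt t (hp' t)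
  have hφ' : HasDerivAt (fun t => inner ℝ (G' (p t)) (ξ + (2 * c * t + β) • ν)) _ t₀ :=
    HasDerivAt.inner ℝ (hH.comp_hasDerivAt t₀ (hp' t₀)) hp''
  obtain ⟨h1, h2⟩ := deriv_eq_zero_and_nonneg_of_isLocalMin hφ hφ' hmin
  refine ⟨h1, ?_⟩
  rw [inner_smul_right] at h2
  linarith

theorem norm_add_smul_sq_le {E : Type*} [NormedAddCommGroup E] [NormedSpace ℝ E] {ξ ν : E} {m : ℝ}
    (hξ : ‖ξ‖ = 1) (hν : ‖ν‖ = 1) (hm : |m| ≤ 1) : ‖ξ + m • ν‖ ^ 2 ≤ 4 := by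
  have h : ‖ξ + m • ν‖ ≤ 2 := by
    calc ‖ξ + m • ν‖ ≤ ‖ξ‖ + ‖m • ν‖ := norm_add_le _ _
      _ = 1 + |m| := by rw [norm_smul, hξ, hν, Real.norm_eq_abs, mul_one]
      _ ≤ 2 := by linarith
  nlinarith [norm_nonneg (ξ + m • ν)]

theorem abs_inner_apply_le {E : Type*} [NormedAddCommGroup E] [InnerProductSpace ℝ E]
    (K : E →L[ℝ] E) (b b' : E) : |inner ℝ (K b) b'| ≤ ‖K‖ * ‖b‖ * ‖b'‖ :=
  (abs_real_inner_le_norm _ _).trans (by gcongr; exact K.le_opNorm b)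

/-- Expanding the quadratic form leaves three error terms, each at most μ ‖K‖. -/
theorem inner_apply_add_smul_le {E : Type*} [NormedAddCommGroup E] [InnerProductSpace ℝ E]
    (K : E →L[ℝ] E) {ξ ν : E} {m μ : ℝ} (hξ : ‖ξ‖ = 1) (hν : ‖ν‖ = 1) (hm : |m| ≤ μ)
    (hμ : μ ≤ 1) :
    inner ℝ (K (ξ + m • ν)) (ξ + m • ν) ≤ inner ℝ (K ξ) ξ + 3 * ‖K‖ * μ := by
  have hμ0 : 0 ≤ μ := (abs_nonneg m).trans hm
  have hb : ∀ {x : ℝ} {b b' : E}, ‖b‖ = 1 → ‖b'‖ = 1 → |x| ≤ μ →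
      x * inner ℝ (K b) b' ≤ μ * ‖K‖ := by
    intro x b b' h1 h2 hx
    have h5 := abs_inner_apply_le K b b'
    rw [h1, h2, mul_one, mul_one] at h5
    calc x * inner ℝ (K b) b' ≤ |x * inner ℝ (K b) b'| := le_abs_self _
      _ = |x| * |inner ℝ (K b) b'| := abs_mul _ _
      _ ≤ μ * ‖K‖ := by gcongr
  have e : inner ℝ (K (ξ + m • ν)) (ξ + m • ν) = inner ℝ (K ξ) ξ + m * inner ℝ (K ξ) ν +
      m * inner ℝ (K ν) ξ + m ^ 2 * inner ℝ (K ν) ν := by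
    simp only [map_add, map_smul, inner_add_left, inner_add_right, inner_smul_left,
      inner_smul_right, conj_trivial]
    ring
  have hm2 : |m ^ 2| ≤ μ := by
    rw [abs_pow]
    nlinarith [abs_nonneg m]
  have b1 := hb hξ hν hm
  have b2 := hb hν hξ hm
  have b3 := hb hν hν hm2
  rw [e]
  linarith

set_option maxHeartbeats 1000000 in
/-- Comparison of the level surfaces `{g(·, y_θ, z_θ) = g(·, y₀, z₀)}` with a paraboloid, uniformly
for small `θ > 0`. -/
theorem CondA3w.eventually_paraboloid (hA3w : CondA3w Γ g) (hg : IsGeneratingFunction Γ g)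
    (hA1 : CondA1 Γ g) (hA2 : CondA2 Γ g) {a y₀ y₁ v : Eu n} {z₀ z₁ : ℝ}
    (hw₀ : (a, y₀, z₀) ∈ Γ) (hw₁ : (a, y₁, z₁) ∈ Γ) (hu : g a y₁ z₁ = g a y₀ z₀)
    (hv : gx g a y₁ z₁ - gx g a y₀ z₀ = v) (hv0 : v ≠ 0)
    (hseg : segment ℝ (gx g a y₀ z₀) (gx g a y₁ z₁) ⊆ USet Γ g a (g a y₀ z₀)) {ε : ℝ}
    (hε : 0 < ε) :
    ∀ᶠ q : Eu n × ℝ in 𝓝 a ×ˢ 𝓝[>] 0,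
      g q.1 y₀ z₀ < unc g (q.1, gStarLine Γ g a y₀ z₀ v q.2) →
      ∀ (s : ℝ) (h : Eu n), q.1 - a = h + s • (‖v‖⁻¹ • v) → inner ℝ v h = 0 →
      -(ε / 2 * ‖h‖ ^ 2) ≤ s * ‖v‖ + inner ℝ ((gxx g a y₁ z₁ - gxx g a y₀ z₀) h) h / 2 := by
  set K := gxx g a y₁ z₁ - gxx g a y₀ z₀ with hK
  set lam : ℝ := ‖v‖ with hlam
  have hlam0 : 0 < lam := norm_pos_iff.2 hv0
  set ν : Eu n := lam⁻¹ • v with hν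
  have hν1 : ‖ν‖ = 1 := by
    rw [hν, norm_smul, norm_inv, norm_norm, ← hlam, inv_mul_cancel₀ hlam0.ne']
  have hvν : inner ℝ v ν = lam := by
    rw [hν, inner_smul_right, real_inner_self_eq_norm_sq, ← hlam]
    field_simp
  set M : ℝ := ‖K‖
  have hM : 0 ≤ M := norm_nonneg _
  -- C bounds the coefficient c of the parabola below. The later errors are (4 + 2C)κ and 3Mμ; the
  -- choices of κ and μ make each at most ε/4.
  set C : ℝ := (M + ε) / (2 * lam) with hC
  have hC0 : 0 < C := by positivity
  set κ : ℝ := min (lam / 4) (ε / (4 * (4 + 2 * C))) with hκ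
  have hκ0 : 0 < κ := by positivity
  have hκ1 : κ ≤ lam / 4 := min_le_left _ _
  have hκ2 : (4 + 2 * C) * κ ≤ ε / 4 := by
    have : κ ≤ ε / (4 * (4 + 2 * C)) := min_le_right _ _
    rw [le_div_iff₀ (by positivity)] at this
    linarith
  set μ : ℝ := min 1 (ε / (4 * (3 * M + 1))) with hμ
  have hμ0 : 0 < μ := by positivity
  have hμ1 : μ ≤ 1 := min_le_left _ _
  have hμ2 : 3 * M * μ ≤ ε / 4 := by
    have : μ ≤ ε / (4 * (3 * M + 1)) := min_le_right _ _
    rw [le_div_iff₀ (by positivity)] at this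
    nlinarith
  obtain ⟨⟨r, θ₁⟩, ⟨hr, hθ₁⟩, hball⟩ := ((Metric.nhds_basis_ball (x := a)).prod
    (nhdsGT_basis (0 : ℝ))).eventually_iff.1
    (hA3w.eventually_inner_le hg hA1 hA2 hw₀ hw₁ hu hv hseg hκ0)
  simp only at hr hθ₁ hball
  -- The first bound leaves room for the 10T of the touching lemma, the second makes the slope 2 c
  -- t₀ + β at most μ.
  set δ : ℝ := min (r / 11) (μ / (4 * (C + 1))) with hδ
  have hδ0 : 0 < δ := by positivity
  refine ((Metric.nhds_basis_ball (x := a)).prod (nhdsGT_basis (0 : ℝ))).eventually_iff.2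
    ⟨(δ, min θ₁ 1), ⟨hδ0, by positivity⟩, ?_⟩
  rintro ⟨x, θ⟩ ⟨hx, hθ⟩ hpos s h hdec hperp
  simp only at hx hθ hpos hdec
  have hθ0 : 0 < θ := hθ.1
  have hθ1 : θ < 1 := hθ.2.trans_le (min_le_right _ _)
  have hθ' : θ ∈ Ioo 0 θ₁ := ⟨hθ.1, hθ.2.trans_le (min_le_left _ _)⟩
  have hB : ∀ b ∈ Metric.ball a r, _ := fun b hb => hball (x := (b, θ)) ⟨hb, hθ'⟩
  simp only at hB
  set yz := gStarLine Γ g a y₀ z₀ v θ with hyz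
  set d : Eu n → Eu n := fun b => gradQuot Γ g a y₀ z₀ v b θ with hd
  have hder : ∀ b ∈ Metric.ball a r, HasFDerivAt (fun b => unc g (b, yz) - g b y₀ z₀)
      (innerSL ℝ (θ • d b)) b := by
    intro b hb
    have h1 := (hg.hasFDerivAt_fst' (hB b hb).1).fun_sub (hg.hasFDerivAt_fst (hB b hb).2.1)
    have h2 : θ • d b = uncGx g (b, yz) - gx g b y₀ z₀ := by
      rw [hd]
      simp only [gradQuot]
      rw [smul_smul, mul_inv_cancel₀ hθ0.ne', one_smul]
    rwa [h2, map_sub]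
  have hder' : ∀ b ∈ Metric.ball a r,
      HasFDerivAt (fun b => -(θ⁻¹ * (unc g (b, yz) - g b y₀ z₀))) (-innerSL ℝ (d b)) b := by
    intro b hb
    have := ((hder b hb).const_mul θ⁻¹).fun_neg
    rwa [map_smul, smul_smul, inv_mul_cancel₀ hθ0.ne', one_smul] at this
  -- Dividing by θ makes the gradient of F close to -v uniformly in θ; with this sign F grows in the
  -- direction -ν, as the touching lemma requires.
  set F : Eu n → ℝ := fun b => -(θ⁻¹ * (unc g (b, yz) - g b y₀ z₀)) with hF
  have ha : a ∈ Metric.ball a r := Metric.mem_ball_self hr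
  have hFapp : ∀ b ∈ Metric.ball a r, ∀ b' ∈ Metric.ball a r,
      |F b - F b' - (-innerSL ℝ v) (b - b')| ≤ κ * ‖b - b'‖ := by
    intro b hb b' hb'
    refine Convex.norm_image_sub_le_of_norm_hasFDerivWithin_le'
      (fun b hb => (hder' b hb).hasFDerivWithinAt) (fun b hb => ?_) (convex_ball a r) hb' hb
    rw [neg_sub_neg, ← map_sub, innerSL_apply_norm, norm_sub_rev]
    exact (hB b hb).2.2.1
  have hmid : gx g a y₀ z₀ + θ • v ∈ USet Γ g a (g a y₀ z₀) := by
    refine hseg ⟨1 - θ, θ, by linarith, hθ0.le, by ring, ?_⟩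
    rw [← hv]
    module
  have hsp := YZ_spec hmid
  have hda : d a = v := by
    have h1 : uncGx g (a, yz) = gx g a y₀ z₀ + θ • v := hsp.2.2
    simp only [hd, gradQuot]
    rw [← hyz, h1, add_sub_cancel_left, smul_smul, inv_mul_cancel₀ hθ0.ne', one_smul]
  have hFa : F a = 0 := by
    have h1 : unc g (a, yz) = g a y₀ z₀ := hsp.2.1
    simp [hF, h1]
  have hFd : HasFDerivAt F (-innerSL ℝ v) a := by
    have := hder' a ha
    rwa [hda] at this
  have hFx : F x < 0 := by
    have : 0 < θ⁻¹ * (unc g (x, yz) - g x y₀ z₀) := mul_pos (inv_pos.2 hθ0) (by linarith)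
    simp only [hF]
    linarith
  have hνh : inner ℝ h ν = 0 := by
    rw [hν, inner_smul_right, real_inner_comm, hperp, mul_zero]
  have hnorm : ‖h‖ ≤ ‖x - a‖ := by
    rw [hdec]
    have h1 : ‖h + s • ν‖ ^ 2 = ‖h‖ ^ 2 + ‖s • ν‖ ^ 2 := by
      rw [norm_add_sq_real, inner_smul_right, hνh]
      ring
    refine le_of_sq_le_sq ?_ (norm_nonneg _)
    rw [h1]
    linarith [sq_nonneg ‖s • ν‖]
  have hxδ : ‖x - a‖ < δ := mem_ball_iff_norm.1 hx
  have hδr : δ ≤ r / 11 := min_le_left _ _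
  have hxr : x ∈ Metric.ball a r := mem_ball_iff_norm.2 (by linarith)
  by_contra! hcon
  set T : ℝ := ‖h‖ with hT
  rcases (norm_nonneg h).eq_or_lt with hT0 | hT0
  -- Here x lies below a on the axis of the paraboloid, and near-linearity of F alone excludes F x <
  -- 0.
  · have hh : h = 0 := norm_eq_zero.1 hT0.symm
    have hs : s < 0 := by
      rw [hT, hh] at hcon
      simp at hcon
      exact neg_of_mul_neg_left hcon hlam0.le
    have h1 := hFapp x hxr a ha
    rw [hFa, hdec, hh, zero_add, norm_smul, hν1, neg_apply, innerSL_apply_apply, inner_smul_right,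
      hvν, Real.norm_eq_abs, abs_of_neg hs] at h1
    have := (abs_le.1 h1).1
    nlinarith
  · set ξ : Eu n := T⁻¹ • h with hξ
    have hTξ : T • ξ = h := by rw [hξ, smul_smul, mul_inv_cancel₀ hT0.ne', one_smul]
    have hξ1 : ‖ξ‖ = 1 := by
      rw [hξ, norm_smul, norm_inv, hT, norm_norm, inv_mul_cancel₀ hT0.ne']
    have hvξ : inner ℝ v ξ = 0 := by rw [hξ, inner_smul_right, hperp, mul_zero]
    set k : ℝ := inner ℝ (K ξ) ξ with hk
    have hKh : inner ℝ (K h) h = k * T ^ 2 := by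
      rw [← hTξ, map_smul, inner_smul_left, inner_smul_right, hk]
      simp
      ring
    have hkM : |k| ≤ M := by simpa [hξ1] using abs_inner_apply_le K ξ ξ
    -- With this coefficient the parabola -c t² is the boundary of the claimed region in the plane
    -- of ξ and ν. The point x lies below it, so F is negative at its point over T.
    set c : ℝ := (k + ε) / (2 * lam) with hc
    have hcC : |c| ≤ C := by
      rw [hc, hC, abs_div, abs_of_pos (show 0 < 2 * lam by positivity)]
      gcongr
      exact (abs_add_le _ _).trans (by rw [abs_of_pos hε]; linarith)
    have hclam : 2 * c * lam = k + ε := by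
      rw [hc]
      field_simp
    have hTδ : T < δ := hnorm.trans_lt hxδ
    have hCT : C * T ≤ μ / 4 := by
      have h1 : T ≤ μ / (4 * (C + 1)) := hTδ.le.trans (min_le_right _ _)
      rw [le_div_iff₀ (by positivity)] at h1
      nlinarith
    have hcT : |c| * T ≤ 1 := (mul_le_mul_of_nonneg_right hcC hT0.le).trans (by linarith)
    have hs : s < -(c * T ^ 2) := by
      rw [hKh] at hcon
      have : s * lam < -(c * T ^ 2) * lam := by
        have : c * T ^ 2 * lam = (k + ε) * T ^ 2 / 2 := by rw [← hclam]; ring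
        linarith
      exact lt_of_mul_lt_mul_right this hlam0.le
    have hpt : a + (T • ξ + (c * T ^ 2) • (-ν)) ∈ Metric.ball a r := by
      rw [mem_ball_iff_norm, add_sub_cancel_left]
      calc ‖T • ξ + (c * T ^ 2) • (-ν)‖ ≤ ‖T • ξ‖ + ‖(c * T ^ 2) • (-ν)‖ := norm_add_le _ _
        _ = T + |c| * T * T := by
          rw [norm_smul T ξ, norm_smul _ (-ν), norm_neg, hξ1, hν1, Real.norm_eq_abs,
            Real.norm_eq_abs, abs_of_pos (show 0 < T from hT0), abs_mul, abs_of_nonneg (sq_nonneg T)]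
          ring
        _ ≤ T + 1 * T := by gcongr
        _ < r := by linarith
    have hneg : F (a + (T • ξ + (c * T ^ 2) • (-ν))) < 0 := by
      have h1 := hFapp _ hpt x hxr
      have h2 : a + (T • ξ + (c * T ^ 2) • (-ν)) - x = (-(c * T ^ 2) - s) • ν := by
        have : x = a + (h + s • ν) := by rw [← hdec]; abel
        rw [this, hTξ]
        module
      rw [h2, norm_smul, hν1, neg_apply, innerSL_apply_apply, inner_smul_right, hvν,
        Real.norm_eq_abs, abs_of_pos (show 0 < -(c * T ^ 2) - s by linarith)] at h1
      have := (abs_le.1 h1).2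
      nlinarith
    obtain ⟨β, hβ, k', t₀, ht₀, hz, hle, hbd⟩ := exists_touching_parabola (F := F)
      (L := -innerSL ℝ v) (ν := -ν) (η := μ / 2) (κ := κ) hFapp hFa hFd (by simp [hvξ]) hκ0.le
      (by simp [hvν]; linarith) hξ1.le (by rw [norm_neg, hν1]) hT0 (by linarith) hcT
      (by positivity) hneg
    set b := a + (t₀ • ξ + (c * t₀ ^ 2 + (β * t₀ + k')) • (-ν)) with hb
    have ht₀' : t₀ ∈ Icc 0 T := ⟨ht₀.1.le, ht₀.2.le⟩
    have hbr : b ∈ Metric.ball a r := by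
      rw [mem_ball_iff_norm, hb, add_sub_cancel_left]
      exact (hbd t₀ ht₀').trans_lt (by linarith)
    have hzero : unc g (b, yz) = g b y₀ z₀ := by
      have : θ⁻¹ * (unc g (b, yz) - g b y₀ z₀) = 0 := neg_eq_zero.1 hz
      rcases mul_eq_zero.1 this with h1 | h1
      · exact absurd h1 (inv_ne_zero hθ0.ne')
      · linarith
    have hH : HasFDerivAt (fun b => θ • d b) (gxx g b yz.1 yz.2 - gxx g b y₀ z₀) b := by
      have h1 : HasFDerivAt (fun b => uncGx g (b, yz)) (gxx g b yz.1 yz.2) b :=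
        hg.hasFDerivAt_gx_fst (hB b hbr).1
      refine (h1.fun_sub (hg.hasFDerivAt_gx_fst (hB b hbr).2.1)).congr_of_eventuallyEq
        (Eventually.of_forall fun b' => ?_)
      simp only [hd, gradQuot]
      rw [smul_smul, mul_inv_cancel₀ hθ0.ne', one_smul]
    have hmin : IsLocalMin (fun t => unc g (a + (t • ξ + (c * t ^ 2 + (β * t + k')) • (-ν)), yz) -
        g (a + (t • ξ + (c * t ^ 2 + (β * t + k')) • (-ν))) y₀ z₀) t₀ := by
      filter_upwards [Icc_mem_nhds ht₀.1 ht₀.2] with t ht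
      have h1 := hle t ht
      simp only [hF] at h1
      have h2 : 0 ≤ θ⁻¹ * (unc g (a + (t • ξ + (c * t ^ 2 + (β * t + k')) • (-ν)), yz) -
        g (a + (t • ξ + (c * t ^ 2 + (β * t + k')) • (-ν))) y₀ z₀) := by linarith
      rw [← hb, hzero, sub_self]
      exact nonneg_of_mul_nonneg_right h2 (inv_pos.2 hθ0)
    -- At the contact point the difference of the two functions vanishes and is minimal along the
    -- parabola. The first order condition makes τ orthogonal to d, which admits τ in A3w.
    obtain ⟨hτ, hnn⟩ := inner_eq_zero_and_nonneg_of_isLocalMin_parabola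
      (G := fun b => unc g (b, yz) - g b y₀ z₀) (G' := fun b => θ • d b)
      (by filter_upwards [Metric.isOpen_ball.mem_nhds hbr] with b' hb' using hder b' hb')
      hH hmin
    rw [← hb] at hτ hnn
    set m : ℝ := 2 * c * t₀ + β with hm
    have hmμ : |m| ≤ μ := by
      calc |m| ≤ |2 * c * t₀| + |β| := abs_add_le _ _
        _ = 2 * (|c| * t₀) + β := by
          rw [abs_mul, abs_mul, abs_of_pos ht₀.1, abs_of_pos hβ.1, abs_of_pos two_pos]
          ring
        _ ≤ 2 * (C * T) + μ / 2 := by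
          gcongr
          · exact ht₀.1.le
          · exact ht₀.2.le
          · exact hβ.2.le
        _ ≤ μ := by linarith
    set τ : Eu n := ξ + m • (-ν) with hτdef
    have hdτ : inner ℝ (d b) τ = 0 := by
      rw [inner_smul_left] at hτ
      simpa [hθ0.ne'] using hτ
    have hA := (hB b hbr).2.2.2 hzero τ hdτ
    have hdν : |inner ℝ (d b) ν - lam| ≤ κ := by
      rw [← hvν, ← inner_sub_left]
      refine (abs_real_inner_le_norm _ _).trans ?_
      rw [hν1, mul_one]
      exact (hB b hbr).2.2.1
    have h1 : 0 ≤ inner ℝ (K τ) τ + κ * ‖τ‖ ^ 2 - 2 * c * inner ℝ (d b) ν := by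
      rw [inner_neg_right, inner_smul_left] at hnn
      simp only [conj_trivial] at hnn
      have : 0 ≤ θ * (inner ℝ (K τ) τ + κ * ‖τ‖ ^ 2 - 2 * c * inner ℝ (d b) ν) := by linarith
      exact nonneg_of_mul_nonneg_right this hθ0
    have h3 : ‖τ‖ ^ 2 ≤ 4 :=
      norm_add_smul_sq_le hξ1 (by rw [norm_neg, hν1]) (hmμ.trans hμ1)
    have h4 : inner ℝ (K τ) τ ≤ k + 3 * M * μ :=
      inner_apply_add_smul_le K hξ1 (by rw [norm_neg, hν1]) hmμ hμ1
    have h5 : -(2 * c * inner ℝ (d b) ν) ≤ -(k + ε) + 2 * C * κ := by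
      have h6 : |2 * c * (inner ℝ (d b) ν - lam)| ≤ 2 * C * κ := by
        rw [abs_mul, abs_mul, abs_of_pos two_pos]
        gcongr
      have := (abs_le.1 h6).1
      linarith
    have h6 : κ * ‖τ‖ ^ 2 ≤ κ * 4 := by gcongr
    -- Together these bounds would give 0 ≤ -ε + 3Mμ + (4 + 2C)κ ≤ -ε/2.
    linarith

end GenFun

/-! ### The limit θ → 0: half-spaces in the coordinates Q. -/

namespace GenFun

variable {n : ℕ} {Γ : Set (Eu n × Eu n × ℝ)} {g : Eu n → Eu n → ℝ → ℝ}

/-- Taylor's lower bound of second order for a function whose gradient is differentiable at `a`. -/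
theorem eventually_taylor_le {E : Type*} [NormedAddCommGroup E] [InnerProductSpace ℝ E]
    {G : E → ℝ} {G' : E → E} {H : E →L[ℝ] E} {a : E}
    (hG : ∀ᶠ x in 𝓝 a, HasFDerivAt G (innerSL ℝ (G' x)) x) (hH : HasFDerivAt G' H a) {ε : ℝ}
    (hε : 0 < ε) :
    ∀ᶠ x in 𝓝 a, G a + inner ℝ (G' a) (x - a) + inner ℝ (H (x - a)) (x - a) / 2 -
      ε * ‖x - a‖ ^ 2 ≤ G x := by
  obtain ⟨r, hr, hball⟩ := Metric.eventually_nhds_iff_ball.1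
    (hG.and ((hasFDerivAt_iff_isLittleO.1 hH).def hε))
  filter_upwards [Metric.ball_mem_nhds a hr] with x hx
  set h := x - a with hh
  have hmem : ∀ t ∈ Icc (0 : ℝ) 1, a + t • h ∈ Metric.ball a r := by
    intro t ht
    rw [mem_ball_iff_norm] at hx ⊢
    rw [add_sub_cancel_left, norm_smul, Real.norm_eq_abs, abs_of_nonneg ht.1]
    exact (mul_le_of_le_one_left (norm_nonneg _) ht.2).trans_lt hx
  set φ : ℝ → ℝ := fun t => G (a + t • h) - t * inner ℝ (G' a) h - t ^ 2 * (inner ℝ (H h) h / 2) +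
    t ^ 2 * (ε * ‖h‖ ^ 2 / 2) with hφ
  have hder : ∀ t ∈ Icc (0 : ℝ) 1, HasDerivAt φ (inner ℝ (G' (a + t • h)) h - inner ℝ (G' a) h -
      2 * t * (inner ℝ (H h) h / 2) + 2 * t * (ε * ‖h‖ ^ 2 / 2)) t := by
    intro t ht
    have h1 : HasDerivAt (fun t : ℝ => a + t • h) h t := by
      simpa using ((hasDerivAt_id t).smul_const h).const_add a
    have h2 : HasDerivAt (fun t : ℝ => G (a + t • h)) (inner ℝ (G' (a + t • h)) h) t :=
      HasFDerivAt.comp_hasDerivAt (f := fun t : ℝ => a + t • h) t (hball _ (hmem t ht)).1 h1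
    have h3 : ∀ A : ℝ, HasDerivAt (fun t : ℝ => t ^ 2 * A) (2 * t * A) t := fun A => by
      simpa using (hasDerivAt_pow 2 t).mul_const A
    have h4 : HasDerivAt (fun t : ℝ => t * inner ℝ (G' a) h) (inner ℝ (G' a) h) t := by
      simpa using (hasDerivAt_id t).mul_const (inner ℝ (G' a) h)
    exact ((h2.fun_sub h4).fun_sub (h3 _)).fun_add (h3 _)
  have hmono : MonotoneOn φ (Icc 0 1) := by
    refine monotoneOn_of_deriv_nonneg (convex_Icc 0 1)
      (fun t ht => (hder t ht).continuousAt.continuousWithinAt)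
      (fun t ht => (hder t (interior_subset ht)).differentiableAt.differentiableWithinAt) ?_
    intro t ht
    have ht' := interior_subset ht
    rw [(hder t ht').deriv]
    have h1 := (hball _ (hmem t ht')).2
    rw [add_sub_cancel_left, map_smul, norm_smul, Real.norm_eq_abs, abs_of_nonneg ht'.1] at h1
    have h2 : |inner ℝ (G' (a + t • h) - G' a - t • H h) h| ≤ ε * (t * ‖h‖) * ‖h‖ :=
      (abs_real_inner_le_norm _ _).trans (by gcongr)
    rw [inner_sub_left, inner_sub_left, inner_smul_left, conj_trivial] at h2
    have h3 := (abs_le.1 h2).1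
    have e : ε * (t * ‖h‖) * ‖h‖ = 2 * t * (ε * ‖h‖ ^ 2 / 2) := by ring
    linarith
  have h01 := hmono (left_mem_Icc.2 zero_le_one) (right_mem_Icc.2 zero_le_one) zero_le_one
  have hx' : a + h = x := by rw [hh]; abel
  simp only [hφ, zero_smul, add_zero, one_smul, hx'] at h01
  have : 0 ≤ ε * ‖h‖ ^ 2 := by positivity
  linarith

theorem IsGeneratingFunction.gy_eq (hg : IsGeneratingFunction Γ g) {x y : Eu n} {z : ℝ}
    (hw : (x, y, z) ∈ Γ) : gy g x y z = -(gz g x y z • Q g x y z) := by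
  have hz : gz g x y z ≠ 0 := hg.gz_ne_zero hw
  rw [Q, smul_neg, smul_smul, mul_inv_cancel₀ hz, one_smul, neg_neg]

/-- The first variation of `g` along a `g*`-segment. -/
theorem IsGeneratingFunction.eventually_lt_gStarLine (hg : IsGeneratingFunction Γ g)
    (hA1 : CondA1 Γ g) (hA2 : CondA2 Γ g) {a x y v η : Eu n} {z : ℝ} (hw : (a, y, z) ∈ Γ)
    (hx : (x, y, z) ∈ Γ) (hη : matE g a y z η = v)
    (hpos : 0 < inner ℝ (Q g x y z - Q g a y z) η) :
    ∀ᶠ θ in 𝓝[>] (0 : ℝ), g x y z < unc g (x, gStarLine Γ g a y z v θ) := by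
  have hd := hg.hasDerivAt_YZ_line hA1 hA2 hw hη
  have h0 : gStarLine Γ g a y z v 0 = (y, z) := hA1.gStarLine_zero hw
  have hd' : HasDerivAt (fun θ => unc g (x, gStarLine Γ g a y z v θ)) _ 0 :=
    HasFDerivAt.comp_hasDerivAt_of_eq (0 : ℝ) (hg.hasFDerivAt hx)
      ((hasDerivAt_const (0 : ℝ) x).prodMk hd) (by rw [h0])
  set c : ℝ := -((gz g a y z)⁻¹ * inner ℝ (gy g a y z) η) with hc
  have hza : gz g a y z ≠ 0 := hg.gz_ne_zero hw
  have hcQ : c = inner ℝ (Q g a y z) η := by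
    rw [hc, Q, inner_neg_left, inner_smul_left, conj_trivial]
  have es : (0, η, c) = ((0, η, 0) : Eu n × Eu n × ℝ) + c • (0, 0, 1) := by simp
  have hval : fderiv ℝ (unc g) (x, y, z) (0, η, c) =
      -gz g x y z * inner ℝ (Q g x y z - Q g a y z) η := by
    rw [es, map_add, map_smul, ← hg.inner_gy hx, ← hg.gz_eq hx]
    simp only [uncGy, uncGz]
    rw [hg.gy_eq hx, hcQ, inner_neg_left, inner_smul_left, inner_sub_left, conj_trivial,
      smul_eq_mul]
    ring
  rw [hval] at hd'
  have hgz := hg.gz_neg x y z hx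
  have hL : 0 < -gz g x y z * inner ℝ (Q g x y z - Q g a y z) η := mul_pos (by linarith) hpos
  have h3 := (hasDerivAt_iff_tendsto_slope.1 hd').eventually (lt_mem_nhds hL)
  have h4 := h3.filter_mono (nhdsWithin_mono (0 : ℝ) (fun t (ht : 0 < t) => ht.ne'))
  filter_upwards [h4, self_mem_nhdsWithin] with t ht ht0
  have ht0' : (0 : ℝ) < t := ht0
  rw [slope_def_field, sub_zero, h0] at ht
  have := (div_pos_iff_of_pos_right ht0').1 ht
  simpa using this

set_option maxHeartbeats 400000 in
/-- The set `{⟨Q(x, y₀, z₀) - Q(a, y₀, z₀), η⟩ > 0}` lies in `{g(·, y₁, z₁) ≥ g(·, y₀, z₀)}` up to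
second order at `a`. -/
theorem CondA3w.eventually_neg_sq_le (hA3w : CondA3w Γ g) (hg : IsGeneratingFunction Γ g)
    (hA1 : CondA1 Γ g) (hA2 : CondA2 Γ g) {a y₀ y₁ v η : Eu n} {z₀ z₁ : ℝ}
    (hw₀ : (a, y₀, z₀) ∈ Γ) (hw₁ : (a, y₁, z₁) ∈ Γ) (hu : g a y₁ z₁ = g a y₀ z₀)
    (hv : gx g a y₁ z₁ - gx g a y₀ z₀ = v) (hv0 : v ≠ 0)
    (hseg : segment ℝ (gx g a y₀ z₀) (gx g a y₁ z₁) ⊆ USet Γ g a (g a y₀ z₀))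
    (hη : matE g a y₀ z₀ η = v) {ε : ℝ} (hε : 0 < ε) :
    ∀ᶠ x in 𝓝 a, 0 < inner ℝ (Q g x y₀ z₀ - Q g a y₀ z₀) η →
      -(ε * ‖x - a‖ ^ 2) ≤ g x y₁ z₁ - g x y₀ z₀ := by
  -- Currying fixes x first and then chooses θ small depending on x, within a neighbourhood of a
  -- that does not depend on θ.
  have hpar := (hA3w.eventually_paraboloid hg hA1 hA2 hw₀ hw₁ hu hv hv0 hseg
    (half_pos hε)).curry
  set K := gxx g a y₁ z₁ - gxx g a y₀ z₀ with hK
  have hsl : ∀ {y : Eu n} {z : ℝ}, (a, y, z) ∈ Γ → ∀ᶠ x in 𝓝 a, (x, y, z) ∈ Γ := by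
    intro y z hw
    have : Continuous fun x : Eu n => (x, y, z) := by fun_prop
    exact (this.tendsto a).eventually (hg.eventually_mem hw)
  have htaylor := eventually_taylor_le (G := fun x => g x y₁ z₁ - g x y₀ z₀)
    (G' := fun x => gx g x y₁ z₁ - gx g x y₀ z₀) (H := K) (a := a) (by
      filter_upwards [hsl hw₀, hsl hw₁] with x h0 h1
      rw [map_sub]
      exact (hg.hasFDerivAt_fst h1).fun_sub (hg.hasFDerivAt_fst h0))
    ((hg.hasFDerivAt_gx_fst hw₁).fun_sub (hg.hasFDerivAt_gx_fst hw₀)) (ε := ε / 4) (by positivity)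
  set lam : ℝ := ‖v‖ with hlam
  have hlam0 : 0 < lam := norm_pos_iff.2 hv0
  set M := ‖K‖ with hM
  have hM0 : 0 ≤ M := norm_nonneg _
  set ρ : ℝ := ε / (6 * M + 1) with hρ
  have hρ0 : 0 < ρ := by positivity
  have hρM : 3 * M * ρ ≤ ε / 2 := by
    have : ρ * (6 * M + 1) = ε := by rw [hρ]; field_simp
    linarith
  set δ : ℝ := lam * ρ / (M + ε) with hδ
  have hδ0 : 0 < δ := by positivity
  have hδ1 : (M + ε) * δ = lam * ρ := by rw [hδ]; field_simp
  filter_upwards [hpar, htaylor, hsl hw₀, Metric.ball_mem_nhds a hδ0] with x hx1 hx2 hx3 hx4 hpos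
  obtain ⟨θ, hθ1, hθ2⟩ :=
    (hx1.and (hg.eventually_lt_gStarLine hA1 hA2 hw₀ hx3 hη hpos)).exists
  set d := x - a with hd
  set ν : Eu n := lam⁻¹ • v with hν
  have hν1 : ‖ν‖ = 1 := by
    rw [hν, norm_smul, norm_inv, norm_norm, ← hlam, inv_mul_cancel₀ hlam0.ne']
  have hvν : inner ℝ v ν = lam := by
    rw [hν, inner_smul_right, real_inner_self_eq_norm_sq, ← hlam]
    field_simp
  set s : ℝ := inner ℝ v d / lam with hs
  set h : Eu n := d - s • ν with hh
  have hslam : s * lam = inner ℝ v d := by rw [hs]; field_simp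
  have hperp : inner ℝ v h = 0 := by
    rw [hh, inner_sub_right, inner_smul_right, hvν, hslam, sub_self]
  have hkey := hθ1 hθ2 s h (by rw [hh]; abel) hperp
  have hνh : inner ℝ h ν = 0 := by
    rw [hν, inner_smul_right, real_inner_comm, hperp, mul_zero]
  have hd2 : ‖d‖ ^ 2 = ‖h‖ ^ 2 + s ^ 2 := by
    have : d = h + s • ν := by rw [hh]; abel
    rw [this, norm_add_sq_real, inner_smul_right, hνh, norm_smul, hν1, Real.norm_eq_abs, mul_one,
      sq_abs]
    ring
  have hhd : ‖h‖ ≤ ‖d‖ := by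
    refine le_of_sq_le_sq ?_ (norm_nonneg _)
    linarith [sq_nonneg s]
  have hsd : |s| ≤ ‖d‖ := by
    refine le_of_sq_le_sq ?_ (norm_nonneg _)
    rw [sq_abs]
    linarith [sq_nonneg ‖h‖]
  have hdδ : ‖d‖ < δ := mem_ball_iff_norm.1 hx4
  have hd0 := norm_nonneg d
  rw [hu, sub_self, zero_add, hv, ← hslam] at hx2
  have hMh : |inner ℝ (K h) h| ≤ M * ‖d‖ ^ 2 := by
    refine (abs_inner_apply_le K h h).trans ?_
    rw [mul_assoc, sq]
    gcongr
  have hMd : |inner ℝ (K d) d| ≤ M * ‖d‖ ^ 2 := by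
    refine (abs_inner_apply_le K d d).trans ?_
    rw [mul_assoc, sq]
  have hsmall : (M + ε) * ‖d‖ ^ 2 ≤ lam * (ρ * ‖d‖) := by
    calc (M + ε) * ‖d‖ ^ 2 = (M + ε) * ‖d‖ * ‖d‖ := by ring
      _ ≤ (M + ε) * δ * ‖d‖ := by gcongr
      _ = lam * (ρ * ‖d‖) := by rw [hδ1]; ring
  have hh2 : ε * ‖h‖ ^ 2 ≤ ε * ‖d‖ ^ 2 := by gcongr
  have hεd : 0 ≤ ε * ‖d‖ ^ 2 := by positivity
  have hMd0 : 0 ≤ M * ‖d‖ ^ 2 := by positivity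
  have hslow : -(lam * (ρ * ‖d‖)) ≤ s * lam := by
    have := (abs_le.1 hMh).2
    linarith
  -- If s is small compared with ‖d‖, replacing h by d in the quadratic form costs little and the
  -- paraboloid bound carries over. Otherwise the linear term s‖v‖ dominates all quadratic ones.
  rcases le_or_gt s (ρ * ‖d‖) with hcase | hcase
  · have hs1 : |s| ≤ ρ * ‖d‖ := by
      refine abs_le.2 ⟨?_, hcase⟩
      refine le_of_mul_le_mul_right ?_ hlam0
      linarith
    have hdiff : |inner ℝ (K d) d - inner ℝ (K h) h| ≤ ε / 2 * ‖d‖ ^ 2 := by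
      have e : inner ℝ (K d) d - inner ℝ (K h) h =
          s * inner ℝ (K h) ν + s * inner ℝ (K ν) d := by
        have : d = h + s • ν := by rw [hh]; abel
        rw [this]
        simp only [map_add, map_smul, inner_add_left, inner_add_right, inner_smul_left,
          inner_smul_right, conj_trivial]
        ring
      have b1 : |inner ℝ (K h) ν| ≤ M * ‖d‖ := by
        refine (abs_inner_apply_le K h ν).trans ?_
        rw [hν1, mul_one]
        gcongr
      have b2 : |inner ℝ (K ν) d| ≤ M * ‖d‖ := by
        refine (abs_inner_apply_le K ν d).trans ?_
        rw [hν1, mul_one]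
      rw [e]
      calc |s * inner ℝ (K h) ν + s * inner ℝ (K ν) d|
          ≤ |s| * |inner ℝ (K h) ν| + |s| * |inner ℝ (K ν) d| := by
            rw [← abs_mul, ← abs_mul]
            exact abs_add_le _ _
        _ ≤ (ρ * ‖d‖) * (M * ‖d‖) + (ρ * ‖d‖) * (M * ‖d‖) := by gcongr
        _ = (2 * M * ρ) * ‖d‖ ^ 2 := by ring
        _ ≤ ε / 2 * ‖d‖ ^ 2 := by
          gcongr
          have : 0 ≤ M * ρ := by positivity
          linarith
    have := (abs_le.1 hdiff).1
    linarith
  · have h1 : lam * (ρ * ‖d‖) ≤ s * lam := by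
      rw [mul_comm s]
      gcongr
    have := (abs_le.1 hMd).1
    linarith

end GenFun

/-! ### The tangent hyperplane in the coordinates Q. -/

namespace GenFun

variable {n : ℕ} {Γ : Set (Eu n × Eu n × ℝ)} {g : Eu n → Eu n → ℝ → ℝ}

theorem IsGeneratingFunction.hasStrictFDerivAt_fst (hg : IsGeneratingFunction Γ g) {x y : Eu n}
    {z : ℝ} (hw : (x, y, z) ∈ Γ) :
    HasStrictFDerivAt (fun x' => g x' y z) (innerSL ℝ (gx g x y z)) x := by
  have h1 : ContDiffAt ℝ 2 (fun x' : Eu n => unc g (x', y, z)) x :=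
    ContDiffAt.comp (f := fun x' : Eu n => (x', y, z)) x (hg.contDiffAt hw)
      (contDiffAt_id.prodMk contDiffAt_const)
  have h2 := h1.hasStrictFDerivAt (by norm_num)
  have h3 : fderiv ℝ (fun x' : Eu n => unc g (x', y, z)) x = innerSL ℝ (gx g x y z) :=
    (hg.hasFDerivAt_fst hw).fderiv
  rw [h3] at h2
  exact h2

theorem IsGeneratingFunction.hasFDerivAt_Q_fst (hg : IsGeneratingFunction Γ g) {x y : Eu n}
    {z : ℝ} (hw : (x, y, z) ∈ Γ) :
    HasFDerivAt (fun x' => Q g x' y z) ((fderiv ℝ (uncQ g) (x, y, z)).comp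
      (ContinuousLinearMap.inl ℝ (Eu n) (Eu n × ℝ))) x :=
  hasFDerivAt_slice_fst (f := uncQ g)
    ((hg.contDiffAt_Q hw).differentiableAt (by norm_num)).hasFDerivAt

/-- Testing against the η with E η = v reduces the equation to ⟨v, v⟩ = 0. -/
theorem IsGeneratingFunction.fderiv_Q_injective (hg : IsGeneratingFunction Γ g) (hA2 : CondA2 Γ g)
    {x y : Eu n} {z : ℝ} (hw : (x, y, z) ∈ Γ) {v : Eu n}
    (hv : fderiv ℝ (uncQ g) (x, y, z) (v, 0, 0) = 0) : v = 0 := by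
  obtain ⟨η, hη⟩ := hA2.matE_surjective hw v
  have h := hg.inner_fderiv_Q hw v η
  have hz : gz g x y z ≠ 0 := hg.gz_ne_zero hw
  rw [hv, inner_zero_left, hη, eq_comm, neg_eq_zero] at h
  rcases mul_eq_zero.1 h with h1 | h1
  · exact absurd h1 (inv_ne_zero hz)
  · exact inner_self_eq_zero.1 h1

theorem IsGeneratingFunction.exists_hasStrictFDerivAt_Q (hg : IsGeneratingFunction Γ g)
    (hA2 : CondA2 Γ g) {x y : Eu n} {z : ℝ} (hw : (x, y, z) ∈ Γ) :
    ∃ e : Eu n ≃L[ℝ] Eu n, HasStrictFDerivAt (fun x' => Q g x' y z) (e : Eu n →L[ℝ] Eu n) x := by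
  have h1 : ContDiffAt ℝ 1 (fun x' : Eu n => uncQ g (x', y, z)) x :=
    ContDiffAt.comp (f := fun x' : Eu n => (x', y, z)) x (hg.contDiffAt_Q hw)
      (contDiffAt_id.prodMk contDiffAt_const)
  have h2 := h1.hasStrictFDerivAt (by norm_num)
  obtain ⟨e, he⟩ := continuousLinearEquiv_of_injective
    (fderiv ℝ (fun x' : Eu n => uncQ g (x', y, z)) x) (fun v hv => by
      have h3 : fderiv ℝ (fun x' : Eu n => uncQ g (x', y, z)) x = _ :=
        (hg.hasFDerivAt_Q_fst hw).fderiv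
      rw [h3] at hv
      exact hg.fderiv_Q_injective hA2 hw hv) rfl
  exact ⟨e, he ▸ h2⟩

theorem hasDerivAt_parabola {E : Type*} [NormedAddCommGroup E] [NormedSpace ℝ E] (q τ ν : E)
    (c : ℝ) : HasDerivAt (fun h : ℝ => q + (h • τ + (c * h ^ 2) • ν)) τ 0 := by
  have h1 : HasDerivAt (fun h : ℝ => c * h ^ 2) 0 0 := by
    simpa using (hasDerivAt_pow 2 (0 : ℝ)).const_mul c
  have h2 := (((hasDerivAt_id (0 : ℝ)).smul_const τ).fun_add (h1.smul_const ν)).const_add q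
  simpa using h2

/-- In the coordinates `q = Q(x, y₀, z₀)`, the function `g(·, y₁, z₁) - g(·, y₀, z₀)` is nonnegative
up to second order along parabolas bending into the side where its derivative is positive. -/
theorem CondA3w.eventually_parabola_ge (hA3w : CondA3w Γ g) (hg : IsGeneratingFunction Γ g)
    (hA1 : CondA1 Γ g) (hA2 : CondA2 Γ g) {a y₀ y₁ v : Eu n} {z₀ z₁ : ℝ}
    (hw₀ : (a, y₀, z₀) ∈ Γ) (hw₁ : (a, y₁, z₁) ∈ Γ) (hu : g a y₁ z₁ = g a y₀ z₀)
    (hv : gx g a y₁ z₁ - gx g a y₀ z₀ = v) (hv0 : v ≠ 0)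
    (hseg : segment ℝ (gx g a y₀ z₀) (gx g a y₁ z₁) ⊆ USet Γ g a (g a y₀ z₀))
    {X : Eu n → Eu n} {X' : Eu n →L[ℝ] Eu n} {q τ ν : Eu n} (hXq : X q = a)
    (hX : HasFDerivAt X X' q) (hQX : ∀ᶠ q' in 𝓝 q, Q g (X q') y₀ z₀ = q')
    (hτ : inner ℝ v (X' τ) = 0) (hν : 0 < inner ℝ v (X' ν)) {c ε : ℝ} (hc : 0 < c) (hε : 0 < ε) :
    ∀ᶠ h in 𝓝[≠] (0 : ℝ), -(ε * h ^ 2) ≤ g (X (q + (h • τ + (c * h ^ 2) • ν))) y₁ z₁ -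
      g (X (q + (h • τ + (c * h ^ 2) • ν))) y₀ z₀ := by
  obtain ⟨η, hη⟩ := hA2.matE_surjective hw₀ v
  have hz := hg.gz_neg _ _ _ hw₀
  have hDX : ∀ w, fderiv ℝ (uncQ g) (a, y₀, z₀) (X' w, 0, 0) = w := by
    have h1 : HasFDerivAt (fun q' => Q g (X q') y₀ z₀) _ q :=
      HasFDerivAt.comp (g := fun x => Q g x y₀ z₀) q (hXq ▸ hg.hasFDerivAt_Q_fst hw₀) hX
    have h2 := h1.unique ((hasFDerivAt_id q).congr_of_eventuallyEq hQX)
    intro w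
    have := congrArg (fun T : Eu n →L[ℝ] Eu n => T w) h2
    rw [hXq] at this
    exact this
  -- X' inverts D_xQ, so pairing with η is pairing X' w with v, up to the positive factor -1/g_z.
  -- Hence τ is orthogonal to η and the bent curve enters the open half-space.
  have hinner : ∀ w, inner ℝ w η = -((gz g a y₀ z₀)⁻¹ * inner ℝ v (X' w)) := by
    intro w
    have := hg.inner_fderiv_Q hw₀ (X' w) η
    rwa [hDX, hη, real_inner_comm v] at this
  have hτη : inner ℝ τ η = 0 := by rw [hinner, hτ, mul_zero, neg_zero]
  have hνη : 0 < inner ℝ ν η := by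
    rw [hinner, ← neg_mul]
    exact mul_pos (neg_pos.2 (inv_lt_zero.2 hz)) hν
  have hline := hasDerivAt_parabola q τ ν c
  set p : ℝ → Eu n := fun h => q + (h • τ + (c * h ^ 2) • ν) with hp
  have hp0 : p 0 = q := by simp [hp]
  have hpt : Tendsto p (𝓝 0) (𝓝 q) := by
    have := hline.continuousAt.tendsto
    rwa [hp0] at this
  have hXp : HasDerivAt (fun h => X (p h)) (X' τ) 0 :=
    HasFDerivAt.comp_hasDerivAt_of_eq (0 : ℝ) hX hline hp0.symm
  have hXpt : Tendsto (fun h => X (p h)) (𝓝 0) (𝓝 a) := by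
    have := hXp.continuousAt.tendsto
    rwa [hp0, hXq] at this
  obtain ⟨C, hC0, hC⟩ := hXp.isBigO_sub.exists_pos
  have hS := hA3w.eventually_neg_sq_le hg hA1 hA2 hw₀ hw₁ hu hv hv0 hseg hη
    (ε := ε / C ^ 2) (by positivity)
  have hQa : Q g a y₀ z₀ = q := by rw [← hXq]; exact hQX.self_of_nhds
  have hall := (hXpt.eventually hS).and (hC.bound.and (hpt.eventually hQX))
  filter_upwards [hall.filter_mono nhdsWithin_le_nhds, self_mem_nhdsWithin] with h ⟨h1, h2, h3⟩ hne
  have hne' : h ≠ 0 := hne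
  rw [h3, hQa] at h1
  have h4 := h1 (by
    have : p h - q = h • τ + (c * h ^ 2) • ν := by simp [hp]
    rw [this, inner_add_left, inner_smul_left, inner_smul_left, hτη, mul_zero, zero_add,
      conj_trivial]
    positivity)
  rw [hp0, hXq, sub_zero, Real.norm_eq_abs] at h2
  have h5 : ‖X (p h) - a‖ ^ 2 ≤ C ^ 2 * h ^ 2 := by
    rw [← sq_abs h, ← mul_pow]
    gcongr
  have h6 : ε / C ^ 2 * ‖X (p h) - a‖ ^ 2 ≤ ε * h ^ 2 := by
    calc ε / C ^ 2 * ‖X (p h) - a‖ ^ 2 ≤ ε / C ^ 2 * (C ^ 2 * h ^ 2) := by gcongr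
      _ = ε * h ^ 2 := by field_simp
  linarith

set_option maxHeartbeats 800000 in
/-- In the coordinates `q = Q(x, y₀, z₀)`, the set `{g(·, y₁, z₁) ≥ g(·, y₀, z₀)}` contains its
tangent hyperplane at `a` locally. -/
theorem CondA3w.exists_tangent_nonneg (hA3w : CondA3w Γ g) (hg : IsGeneratingFunction Γ g)
    (hA1 : CondA1 Γ g) (hA2 : CondA2 Γ g) {a y₀ y₁ v : Eu n} {z₀ z₁ : ℝ}
    (hw₀ : (a, y₀, z₀) ∈ Γ) (hw₁ : (a, y₁, z₁) ∈ Γ) (hu : g a y₁ z₁ = g a y₀ z₀)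
    (hv : gx g a y₁ z₁ - gx g a y₀ z₀ = v) (hv0 : v ≠ 0)
    (hseg : segment ℝ (gx g a y₀ z₀) (gx g a y₁ z₁) ⊆ USet Γ g a (g a y₀ z₀)) :
    ∃ (X : Eu n → Eu n) (X' : Eu n →L[ℝ] Eu n) (r : ℝ), 0 < r ∧ X (Q g a y₀ z₀) = a ∧
      HasFDerivAt X X' (Q g a y₀ z₀) ∧ (∀ᶠ x in 𝓝 a, X (Q g x y₀ z₀) = x) ∧
      ∀ w, inner ℝ v (X' w) = 0 → ‖w‖ < r →
        g (X (Q g a y₀ z₀ + w)) y₀ z₀ ≤ g (X (Q g a y₀ z₀ + w)) y₁ z₁ := by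
  obtain ⟨e, he⟩ := hg.exists_hasStrictFDerivAt_Q hA2 hw₀
  set Ψ := he.toOpenPartialHomeomorph (fun x => Q g x y₀ z₀) with hΨ
  have haΨ : a ∈ Ψ.source := he.mem_toOpenPartialHomeomorph_source
  set qa : Eu n := Q g a y₀ z₀ with hqa
  have hqt : qa ∈ Ψ.target := he.image_mem_toOpenPartialHomeomorph_target
  have hΨX : ∀ x, Ψ x = Q g x y₀ z₀ := fun x => rfl
  set X : Eu n → Eu n := (Ψ.symm : Eu n → Eu n)
  have hXqa : X qa = a := Ψ.left_inv haΨ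
  have hXs : HasStrictFDerivAt X (e.symm : Eu n →L[ℝ] Eu n) qa := he.to_localInverse
  have hleft : ∀ᶠ x in 𝓝 a, X (Q g x y₀ z₀) = x := Ψ.eventually_left_inverse haΨ
  set F : Eu n → ℝ := fun q => g (X q) y₁ z₁ - g (X q) y₀ z₀ with hF
  have hFgen : ∀ {q : Eu n} {X' : Eu n →L[ℝ] Eu n}, (X q, y₀, z₀) ∈ Γ → (X q, y₁, z₁) ∈ Γ →
      HasFDerivAt X X' q → HasFDerivAt F ((innerSL ℝ (gx g (X q) y₁ z₁ -
        gx g (X q) y₀ z₀)).comp X') q := by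
    intro q X' h0 h1 hX
    rw [map_sub]
    exact HasFDerivAt.comp (g := fun x => g x y₁ z₁ - g x y₀ z₀) q
      ((hg.hasFDerivAt_fst h1).fun_sub (hg.hasFDerivAt_fst h0)) hX
  set L : Eu n →L[ℝ] ℝ := (innerSL ℝ v).comp (e.symm : Eu n →L[ℝ] Eu n) with hL
  have hFs : HasStrictFDerivAt F L qa := by
    have h1 : HasStrictFDerivAt (fun x => g x y₁ z₁ - g x y₀ z₀) (innerSL ℝ v) (X qa) := by
      rw [hXqa, ← hv, map_sub]
      exact (hg.hasStrictFDerivAt_fst hw₁).fun_sub (hg.hasStrictFDerivAt_fst hw₀)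
    exact h1.comp qa hXs
  have hFqa : F qa = 0 := by simp [hF, hXqa, hu]
  obtain ⟨ν, hν1, hLν⟩ : ∃ ν : Eu n, ‖ν‖ = 1 ∧ 0 < L ν := by
    have hev : e v ≠ 0 := by simpa using hv0
    refine ⟨‖e v‖⁻¹ • e v, ?_, ?_⟩
    · rw [norm_smul, norm_inv, norm_norm, inv_mul_cancel₀ (norm_ne_zero_iff.2 hev)]
    · rw [map_smul]
      have : L (e v) = ‖v‖ ^ 2 := by simp [hL]
      rw [this, smul_eq_mul]
      have := norm_pos_iff.2 hev
      have := norm_pos_iff.2 hv0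
      positivity
  -- A quarter meets the condition 2κ < L ν, keeps the derivative in direction ν positive at nearby
  -- points, and leaves a margin in the final comparison.
  set κ : ℝ := L ν / 4 with hκ
  have hκ0 : 0 < κ := by positivity
  have hstrict : ∀ᶠ q : Eu n × Eu n in 𝓝 (qa, qa),
      |F q.1 - F q.2 - L (q.1 - q.2)| ≤ κ * ‖q.1 - q.2‖ :=
    (hasStrictFDerivAt_iff_isLittleO.1 hFs).def hκ0
  rw [nhds_prod_eq, Metric.nhds_basis_ball.prod_self.eventually_iff] at hstrict
  obtain ⟨r₁, hr₁, hball₁⟩ := hstrict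
  have hXc : Tendsto X (𝓝 qa) (𝓝 a) := by
    have := hXs.continuousAt.tendsto
    rwa [hXqa] at this
  have hsl : ∀ {y : Eu n} {z : ℝ}, (a, y, z) ∈ Γ →
      Tendsto (fun q => (X q, y, z)) (𝓝 qa) (𝓝 (a, y, z)) := fun _ =>
    hXc.prodMk_nhds tendsto_const_nhds
  have hgood : ∀ᶠ q in 𝓝 qa, (X q, y₀, z₀) ∈ Γ ∧ (X q, y₁, z₁) ∈ Γ ∧ q ∈ Ψ.target ∧
      gx g (X q) y₁ z₁ - gx g (X q) y₀ z₀ ≠ 0 ∧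
      segment ℝ (gx g (X q) y₀ z₀) (gx g (X q) y₁ z₁) ⊆ USet Γ g (X q) (g (X q) y₀ z₀) := by
    have e0 := (hsl hw₀).eventually (hg.eventually_mem hw₀)
    have e1 := (hsl hw₁).eventually (hg.eventually_mem hw₁)
    have t0 : Tendsto (fun q => gx g (X q) y₀ z₀) (𝓝 qa) (𝓝 (gx g a y₀ z₀)) :=
      (hg.contDiffAt_gx hw₀).continuousAt.tendsto.comp (hsl hw₀)
    have t1 : Tendsto (fun q => gx g (X q) y₁ z₁) (𝓝 qa) (𝓝 (gx g a y₁ z₁)) :=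
      (hg.contDiffAt_gx hw₁).continuousAt.tendsto.comp (hsl hw₁)
    have tu : Tendsto (fun q => g (X q) y₀ z₀) (𝓝 qa) (𝓝 (g a y₀ z₀)) :=
      (hg.contDiffAt hw₀).continuousAt.tendsto.comp (hsl hw₀)
    have e2 := (t1.sub t0).eventually_ne (hv ▸ hv0)
    have e3 := (hXc.prodMk_nhds (tu.prodMk_nhds (t0.prodMk_nhds t1))).eventually
      (hg.eventually_segment_subset hA1 hA2 hseg)
    filter_upwards [e0, e1, Ψ.open_target.mem_nhds hqt, e2, e3] with q h0 h1 h2 h3 h4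
    exact ⟨h0, h1, h2, h3, h4⟩
  obtain ⟨r₂, hr₂, hball₂⟩ := Metric.eventually_nhds_iff_ball.1 hgood
  set r := min r₁ r₂ with hr
  have hr0 : 0 < r := lt_min hr₁ hr₂
  have hFapp : ∀ b ∈ Metric.ball qa r, ∀ b' ∈ Metric.ball qa r,
      |F b - F b' - L (b - b')| ≤ κ * ‖b - b'‖ := fun b hb b' hb' =>
    hball₁ (x := (b, b')) ⟨Metric.ball_subset_ball (min_le_left _ _) hb,
      Metric.ball_subset_ball (min_le_left _ _) hb'⟩
  have hFgood := fun b (hb : b ∈ Metric.ball qa r) =>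
    hball₂ b (Metric.ball_subset_ball (min_le_right _ _) hb)
  refine ⟨X, e.symm, r / 20, by positivity, hXqa, hXs.hasFDerivAt, hleft, fun w hw hwr => ?_⟩
  by_contra! hcon
  have hFw : F (qa + w) < 0 := by simp only [hF]; linarith
  have hw0 : w ≠ 0 := by
    rintro rfl
    rw [add_zero, hFqa] at hFw
    exact lt_irrefl _ hFw
  set T := ‖w‖ with hT
  have hT0 : 0 < T := norm_pos_iff.2 hw0
  set ξ : Eu n := T⁻¹ • w with hξ
  have hTξ : T • ξ = w := by rw [hξ, smul_smul, mul_inv_cancel₀ hT0.ne', one_smul]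
  have hξ1 : ‖ξ‖ = 1 := by rw [hξ, norm_smul, norm_inv, hT, norm_norm, inv_mul_cancel₀ hT0.ne']
  have hLw : L w = 0 := hw
  have hLξ : L ξ = 0 := by rw [hξ, map_smul, hLw, smul_zero]
  have hwr' : qa + w ∈ Metric.ball qa r := by
    rw [mem_ball_iff_norm, add_sub_cancel_left]
    linarith
  have hFcont : ContinuousAt F (qa + w) := by
    obtain ⟨h0, h1, h2, -, -⟩ := hFgood _ hwr'
    obtain ⟨e', he'⟩ := hg.exists_hasStrictFDerivAt_Q hA2 h0
    exact (hFgen h0 h1 (Ψ.hasFDerivAt_symm h2 he'.hasFDerivAt)).continuousAt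
  -- Bending the tangent line slightly upwards keeps its endpoint in {F < 0} and gives the strict
  -- curvature that yields the contradiction.
  obtain ⟨c, hc0, hcT, hcneg⟩ : ∃ c : ℝ, 0 < c ∧ c * T ≤ 1 ∧
      F (qa + (T • ξ + (c * T ^ 2) • ν)) < 0 := by
    have h1 : Tendsto (fun c : ℝ => qa + (T • ξ + (c * T ^ 2) • ν)) (𝓝 0) (𝓝 (qa + w)) := by
      have : Continuous (fun c : ℝ => qa + (T • ξ + (c * T ^ 2) • ν)) := by fun_prop
      have := this.tendsto 0
      simpa [hTξ] using this
    have h2 := (h1.eventually (hFcont.eventually_lt continuousAt_const hFw)).filter_mono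
      (nhdsWithin_le_nhds (s := Ioi 0))
    obtain ⟨c, hc1, hc2⟩ := (h2.and (Ioo_mem_nhdsGT (show (0 : ℝ) < 1 / T by positivity))).exists
    exact ⟨c, hc2.1, ((lt_div_iff₀ hT0).1 hc2.2).le, hc1⟩
  obtain ⟨β, hβ, k, t₀, ht₀, hz, hle, hbd⟩ := exists_touching_parabola (F := F) (L := L) (e := qa)
    (ξ := ξ) (ν := ν) (r := r) (κ := κ) (c := c) (T := T) (η := 1) hFapp hFqa hFs.hasFDerivAt hLξ
    hκ0.le (by linarith) hξ1.le hν1.le hT0 (by linarith) (by rwa [abs_of_pos hc0]) one_pos hcneg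
  set q := qa + (t₀ • ξ + (c * t₀ ^ 2 + (β * t₀ + k)) • ν) with hq
  have hqr : q ∈ Metric.ball qa r := by
    rw [mem_ball_iff_norm, hq, add_sub_cancel_left]
    exact (hbd t₀ ⟨ht₀.1.le, ht₀.2.le⟩).trans_lt (by linarith)
  obtain ⟨h0, h1, h2, h3, h4⟩ := hFgood q hqr
  obtain ⟨e', he'⟩ := hg.exists_hasStrictFDerivAt_Q hA2 h0
  have hX' : HasFDerivAt X (e'.symm : Eu n →L[ℝ] Eu n) q := Ψ.hasFDerivAt_symm h2 he'.hasFDerivAt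
  have hFq := hFgen h0 h1 hX'
  set L' : Eu n →L[ℝ] ℝ := (innerSL ℝ (gx g (X q) y₁ z₁ - gx g (X q) y₀ z₀)).comp
    (e'.symm : Eu n →L[ℝ] Eu n) with hL'
  have hLL : ‖L' - L‖ ≤ κ := by
    refine (hFq.fun_sub L.hasFDerivAt).le_of_lip' hκ0.le ?_
    filter_upwards [Metric.isOpen_ball.mem_nhds hqr] with b hb
    have := hFapp b hb q hqr
    rw [map_sub] at this
    rw [Real.norm_eq_abs]
    convert this using 2
    ring
  have hL'ν : 0 < L' ν := by
    have := (L' - L).le_opNorm ν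
    rw [hν1, mul_one, Real.norm_eq_abs, sub_apply] at this
    have := (abs_le.1 (this.trans hLL)).1
    linarith
  set τ : Eu n := ξ + (2 * c * t₀ + β) • ν with hτ
  -- Recentred at the contact point, the touching curve keeps the quadratic coefficient c and has
  -- tangent τ.
  have hshift : ∀ h : ℝ, q + (h • τ + (c * h ^ 2) • ν) =
      qa + ((t₀ + h) • ξ + (c * (t₀ + h) ^ 2 + (β * (t₀ + h) + k)) • ν) := by
    intro h
    rw [hq, hτ]
    module
  have hnear : ∀ᶠ h in 𝓝 (0 : ℝ), F (q + (h • τ + (c * h ^ 2) • ν)) ≤ 0 := by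
    have h5 : Tendsto (fun h : ℝ => t₀ + h) (𝓝 0) (𝓝 t₀) := by
      have : Continuous (fun h : ℝ => t₀ + h) := by fun_prop
      simpa using this.tendsto 0
    filter_upwards [h5.eventually (Icc_mem_nhds ht₀.1 ht₀.2)] with h hh
    rw [hshift]
    exact hle _ hh
  have hL'τ : L' τ = 0 := by
    have h5 : HasDerivAt (fun h : ℝ => F (q + (h • τ + (c * h ^ 2) • ν))) (L' τ) 0 :=
      HasFDerivAt.comp_hasDerivAt_of_eq (0 : ℝ) hFq (hasDerivAt_parabola q τ ν c) (by simp)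
    refine IsLocalMax.hasDerivAt_eq_zero ?_ h5
    filter_upwards [hnear] with h hh
    simpa [hz] using hh
  have hu' : g (X q) y₁ z₁ = g (X q) y₀ z₀ := sub_eq_zero.1 hz
  -- On the flatter parabola with coefficient c/2 one has F ≥ -κ c h²/2. Moving up by c h²/2 in
  -- direction ν raises F by at least 3κ c h²/2, so F > 0 on the touching parabola near the contact
  -- point.
  have hpar := hA3w.eventually_parabola_ge hg hA1 hA2 h0 h1 hu' rfl h3 h4 (τ := τ) (ν := ν)
    (c := c / 2) (ε := κ * c / 2) rfl hX' (Ψ.eventually_right_inverse h2) hL'τ hL'ν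
    (by positivity) (by positivity)
  have hmem : ∀ c' : ℝ, ∀ᶠ h in 𝓝 (0 : ℝ), q + (h • τ + (c' * h ^ 2) • ν) ∈ Metric.ball qa r := by
    intro c'
    have h5 := (hasDerivAt_parabola q τ ν c').continuousAt.tendsto
    have h6 : q + ((0 : ℝ) • τ + (c' * (0 : ℝ) ^ 2) • ν) = q := by simp
    rw [h6] at h5
    exact h5.eventually (Metric.isOpen_ball.mem_nhds hqr)
  obtain ⟨h, hh1, ⟨hh2, hh3, hh4⟩, hh5⟩ := (hpar.and
    (((hnear.and ((hmem c).and (hmem (c / 2)))).filter_mono nhdsWithin_le_nhds).and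
      self_mem_nhdsWithin)).exists
  have hne : h ≠ 0 := hh5
  have h5 := hFapp _ hh3 _ hh4
  have h6 : q + (h • τ + (c * h ^ 2) • ν) - (q + (h • τ + (c / 2 * h ^ 2) • ν)) =
      (c / 2 * h ^ 2) • ν := by module
  have hpos : 0 < c / 2 * h ^ 2 := by positivity
  rw [h6, map_smul, norm_smul, hν1, mul_one, Real.norm_eq_abs, abs_of_pos hpos, smul_eq_mul] at h5
  have h7 := (abs_le.1 h5).1
  have h8 : L ν = 4 * κ := by rw [hκ]; ring
  rw [h8] at h7
  have h9 : -(κ * c / 2 * h ^ 2) ≤ F (q + (h • τ + (c / 2 * h ^ 2) • ν)) := hh1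
  have h10 : 0 < κ * (c / 2 * h ^ 2) := by positivity
  linarith

/-- Along a `g`-segment with respect to `(y₀, z₀)`, the function `g(·, y₁, z₁) - g(·, y₀, z₀)` cannot
have a strict local maximum zero. -/
theorem CondA3w.eventually_le_of_gSegment (hA3w : CondA3w Γ g) (hg : IsGeneratingFunction Γ g)
    (hA1 : CondA1 Γ g) (hA2 : CondA2 Γ g) {a y₀ y₁ d : Eu n} {z₀ z₁ t₀ : ℝ}
    (hw₀ : (a, y₀, z₀) ∈ Γ) (hw₁ : (a, y₁, z₁) ∈ Γ) (hu : g a y₁ z₁ = g a y₀ z₀)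
    (hseg : segment ℝ (gx g a y₀ z₀) (gx g a y₁ z₁) ⊆ USet Γ g a (g a y₀ z₀))
    {x : ℝ → Eu n} (hx : Tendsto x (𝓝 t₀) (𝓝 a))
    (hQ : ∀ᶠ t in 𝓝 t₀, Q g (x t) y₀ z₀ = Q g a y₀ z₀ + (t - t₀) • d)
    (hle : ∀ᶠ t in 𝓝 t₀, g (x t) y₁ z₁ ≤ g (x t) y₀ z₀) :
    ∀ᶠ t in 𝓝 t₀, g (x t) y₀ z₀ ≤ g (x t) y₁ z₁ := by
  -- If the gradients agree, A1 identifies the two functions.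
  by_cases hv0 : gx g a y₁ z₁ - gx g a y₀ z₀ = 0
  · have h1 := hA1.YZ_eq hw₀ rfl rfl
    rw [hA1.YZ_eq hw₁ hu (sub_eq_zero.1 hv0), Prod.mk.injEq] at h1
    obtain ⟨rfl, rfl⟩ := h1
    exact Eventually.of_forall fun t => le_rfl
  · obtain ⟨X, X', r, hr, hXa, hX, hleft, hnn⟩ :=
      hA3w.exists_tangent_nonneg hg hA1 hA2 hw₀ hw₁ hu rfl hv0 hseg
    have hxX : ∀ᶠ t in 𝓝 t₀, x t = X (Q g a y₀ z₀ + (t - t₀) • d) := by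
      filter_upwards [hx.eventually hleft, hQ] with t h1 h2
      rw [← h2, h1]
    have hline : HasDerivAt (fun t : ℝ => Q g a y₀ z₀ + (t - t₀) • d) d t₀ := by
      simpa using (((hasDerivAt_id t₀).sub_const t₀).smul_const d).const_add (Q g a y₀ z₀)
    have hder : HasDerivAt (fun t => g (X (Q g a y₀ z₀ + (t - t₀) • d)) y₁ z₁ -
        g (X (Q g a y₀ z₀ + (t - t₀) • d)) y₀ z₀)
        (inner ℝ (gx g a y₁ z₁ - gx g a y₀ z₀) (X' d)) t₀ := by
      have h1 : HasDerivAt (fun t => X (Q g a y₀ z₀ + (t - t₀) • d)) (X' d) t₀ :=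
        HasFDerivAt.comp_hasDerivAt_of_eq t₀ hX hline (by simp)
      have h2 : HasFDerivAt (fun x => g x y₁ z₁ - g x y₀ z₀)
          (innerSL ℝ (gx g a y₁ z₁ - gx g a y₀ z₀)) a := by
        rw [map_sub]
        exact (hg.hasFDerivAt_fst hw₁).fun_sub (hg.hasFDerivAt_fst hw₀)
      exact HasFDerivAt.comp_hasDerivAt_of_eq t₀ h2 h1 (by simp [hXa])
    -- The local maximum zero at t₀ makes d tangent, so the straight line traced by Q lies in the
    -- hyperplane of the preceding lemma.
    have hzero : inner ℝ (gx g a y₁ z₁ - gx g a y₀ z₀) (X' d) = 0 := by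
      refine IsLocalMax.hasDerivAt_eq_zero ?_ hder
      filter_upwards [hxX, hle] with t h1 h2
      rw [← h1, sub_self, zero_smul, add_zero, hXa, hu, sub_self]
      linarith
    have hsmall : ∀ᶠ t in 𝓝 t₀, ‖(t - t₀) • d‖ < r := by
      have : Tendsto (fun t : ℝ => ‖(t - t₀) • d‖) (𝓝 t₀) (𝓝 0) := by
        have : Continuous (fun t : ℝ => ‖(t - t₀) • d‖) := by fun_prop
        simpa using this.tendsto t₀
      exact this.eventually (gt_mem_nhds hr)
    filter_upwards [hxX, hsmall] with t h1 h2
    rw [h1]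
    refine hnn _ ?_ h2
    rw [map_smul, inner_smul_right, hzero, mul_zero]

end GenFun

/-! ### The dual function g* and local supports. -/

namespace GenFun

variable {n : ℕ} {Γ : Set (Eu n × Eu n × ℝ)} {g : Eu n → Eu n → ℝ → ℝ}

theorem gStar_spec {x y : Eu n} {u : ℝ} (h : (x, y, u) ∈ GammaStar Γ g) :
    (x, y, gStar Γ g x y u) ∈ Γ ∧ g x y (gStar Γ g x y u) = u := by
  have h' : ∃ z : ℝ, (x, y, z) ∈ Γ ∧ g x y z = u := h
  rw [gStar, dif_pos h']
  exact h'.choose_spec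

theorem IsGeneratingFunction.strictAntiOn (hg : IsGeneratingFunction Γ g) (x y : Eu n) :
    StrictAntiOn (g x y) {z | (x, y, z) ∈ Γ} := by
  have hd : ∀ z, (x, y, z) ∈ Γ → DifferentiableAt ℝ (g x y) z := fun z hz =>
    (hasFDerivAt_slice_thd (f := unc g) (hg.hasFDerivAt hz)).differentiableAt
  exact strictAntiOn_of_deriv_neg (hg.interval x y).convex
    (fun z hz => (hd z hz).continuousAt.continuousWithinAt)
    fun z hz => hg.gz_neg x y z (show z ∈ {z | (x, y, z) ∈ Γ} from interior_subset hz)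

theorem IsGeneratingFunction.gStar_eq (hg : IsGeneratingFunction Γ g) {x y : Eu n} {z u : ℝ}
    (hw : (x, y, z) ∈ Γ) (hu : g x y z = u) : gStar Γ g x y u = z := by
  have h := gStar_spec (Γ := Γ) (g := g) (x := x) (y := y) (u := u) ⟨z, hw, hu⟩
  exact (hg.strictAntiOn x y).injOn h.1 hw (h.2.trans hu.symm)

/-- By monotonicity in `z`, a level on either side of the value is separated from it by a strict
inequality between `g` and `u`, which persists nearby. -/
theorem IsGeneratingFunction.continuousAt_gStar (hg : IsGeneratingFunction Γ g) {u : Eu n → ℝ}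
    {x y : Eu n} (hu : ContinuousAt u x) (hΓ : ∀ᶠ x' in 𝓝 x, (x', y, u x') ∈ GammaStar Γ g) :
    ContinuousAt (fun x' => gStar Γ g x' y (u x')) x := by
  obtain ⟨hw, hz⟩ := gStar_spec hΓ.self_of_nhds
  set z := gStar Γ g x y (u x) with hzdef
  have hI : ∀ᶠ z' in 𝓝 z, (x, y, z') ∈ Γ := by
    have : Continuous fun z' : ℝ => (x, y, z') := by fun_prop
    exact (this.tendsto z).eventually (hg.eventually_mem hw)
  have hnear : ∀ z', (x, y, z') ∈ Γ → ∀ᶠ x' in 𝓝 x, (x', y, z') ∈ Γ := by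
    intro z' hz'
    have : Continuous fun x' : Eu n => (x', y, z') := by fun_prop
    exact (this.tendsto x).eventually (hg.eventually_mem hz')
  have hcont : ∀ z', (x, y, z') ∈ Γ → ContinuousAt (fun x' => g x' y z') x := fun z' hz' =>
    (hg.hasFDerivAt_fst hz').continuousAt
  refine tendsto_order.2 ⟨fun b hb => ?_, fun b hb => ?_⟩
  · obtain ⟨z', hz'1, hz'2⟩ := ((hI.filter_mono nhdsWithin_le_nhds).and
      (Ioo_mem_nhdsLT hb)).exists
    have hlt : u x < g x y z' := by
      rw [← hz]
      exact hg.strictAntiOn x y hz'1 hw hz'2.2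
    filter_upwards [hnear z' hz'1, hu.eventually_lt (hcont z' hz'1) hlt, hΓ] with x' h1 h2 h3
    obtain ⟨h4, h5⟩ := gStar_spec h3
    rw [← h5] at h2
    exact hz'2.1.trans (((hg.strictAntiOn x' y).lt_iff_gt h4 h1).1 h2)
  · obtain ⟨z', hz'1, hz'2⟩ := ((hI.filter_mono nhdsWithin_le_nhds).and
      (Ioo_mem_nhdsGT hb)).exists
    have hlt : g x y z' < u x := by
      rw [← hz]
      exact hg.strictAntiOn x y hw hz'1 hz'2.1
    filter_upwards [hnear z' hz'1, (hcont z' hz'1).eventually_lt hu hlt, hΓ] with x' h1 h2 h3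
    obtain ⟨h4, h5⟩ := gStar_spec h3
    rw [← h5] at h2
    exact (((hg.strictAntiOn x' y).lt_iff_gt h1 h4).1 h2).trans hz'2.2

/-- The gradient of a local support is a subgradient of `u`, and A1 recovers y from it. -/
theorem IsGeneratingFunction.mem_SigmaSet (hg : IsGeneratingFunction Γ g) (hA1 : CondA1 Γ g)
    {u : Eu n → ℝ} {Ω N : Set (Eu n)} {x y : Eu n} {z : ℝ} (hx : x ∈ Ω) (hN : N ∈ 𝓝 x)
    (h : IsGSupport Γ g u N x y z) : y ∈ SigmaSet Γ g u Ω := by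
  obtain ⟨h1, h2, h3⟩ := h
  have hw := h1 x (mem_of_mem_nhds hN)
  refine ⟨x, hx, gx g x y z, fun ε hε => ?_, ⟨y, z, hw, h2.symm, rfl⟩, ?_⟩
  · filter_upwards [(hasFDerivAt_iff_isLittleO.1 (hg.hasFDerivAt_fst hw)).def hε, hN]
      with x' h4 h5
    rw [innerSL_apply_apply, Real.norm_eq_abs] at h4
    have := (abs_le.1 h4).1
    have := h3 x' h5
    linarith
  · rw [hA1.YZ_eq hw h2.symm rfl]

/-! ### g-segments and their continuity. -/

/-- The inverse of the map `Q(·, y, z)` on `Ω`. -/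
noncomputable def QInv (g : Eu n → Eu n → ℝ → ℝ) (Ω : Set (Eu n)) (y : Eu n) (z : ℝ) (q : Eu n) :
    Eu n :=
  Function.invFunOn (fun x => Q g x y z) Ω q

/-- The `g`-segment with respect to `(y, z)` joining `x₀` and `x₁`. -/
noncomputable def gSegment (g : Eu n → Eu n → ℝ → ℝ) (Ω : Set (Eu n)) (y : Eu n) (z : ℝ)
    (x₀ x₁ : Eu n) (t : ℝ) : Eu n :=
  QInv g Ω y z ((1 - t) • Q g x₀ y z + t • Q g x₁ y z)

variable {Ω : Set (Eu n)} {y x₀ x₁ : Eu n} {z : ℝ}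

theorem CondA1Star.QInv_Q (hA1s : CondA1Star Γ g) (hΩ : IsGConvexSet Γ g Ω y z) {x : Eu n}
    (hx : x ∈ Ω) : QInv g Ω y z (Q g x y z) = x :=
  InjOn.leftInvOn_invFunOn ((hA1s y z).mono fun x hx => hΩ.1 x hx) hx

theorem IsGConvexSet.mem_image (hΩ : IsGConvexSet Γ g Ω y z) (h₀ : x₀ ∈ Ω) (h₁ : x₁ ∈ Ω) {t : ℝ}
    (ht : t ∈ Icc (0 : ℝ) 1) :
    (1 - t) • Q g x₀ y z + t • Q g x₁ y z ∈ (fun x => Q g x y z) '' Ω :=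
  hΩ.2 (mem_image_of_mem _ h₀) (mem_image_of_mem _ h₁) (by linarith [ht.2]) ht.1 (by ring)

theorem IsGConvexSet.gSegment_mem (hΩ : IsGConvexSet Γ g Ω y z) (h₀ : x₀ ∈ Ω) (h₁ : x₁ ∈ Ω)
    {t : ℝ} (ht : t ∈ Icc (0 : ℝ) 1) : gSegment g Ω y z x₀ x₁ t ∈ Ω :=
  Function.invFunOn_mem (hΩ.mem_image h₀ h₁ ht)

theorem IsGConvexSet.Q_gSegment (hΩ : IsGConvexSet Γ g Ω y z) (h₀ : x₀ ∈ Ω) (h₁ : x₁ ∈ Ω)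
    {t : ℝ} (ht : t ∈ Icc (0 : ℝ) 1) :
    Q g (gSegment g Ω y z x₀ x₁ t) y z = (1 - t) • Q g x₀ y z + t • Q g x₁ y z :=
  Function.invFunOn_eq (hΩ.mem_image h₀ h₁ ht)

theorem CondA1Star.gSegment_zero (hA1s : CondA1Star Γ g) (hΩ : IsGConvexSet Γ g Ω y z)
    (h₀ : x₀ ∈ Ω) : gSegment g Ω y z x₀ x₁ 0 = x₀ := by
  rw [gSegment, sub_zero, one_smul, zero_smul, add_zero, hA1s.QInv_Q hΩ h₀]

theorem CondA1Star.gSegment_one (hA1s : CondA1Star Γ g) (hΩ : IsGConvexSet Γ g Ω y z)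
    (h₁ : x₁ ∈ Ω) : gSegment g Ω y z x₀ x₁ 1 = x₁ := by
  rw [gSegment, sub_self, one_smul, zero_smul, zero_add, hA1s.QInv_Q hΩ h₁]

theorem CondA1Star.gSegment_self (hA1s : CondA1Star Γ g) (hΩ : IsGConvexSet Γ g Ω y z)
    (h₀ : x₀ ∈ Ω) (t : ℝ) : gSegment g Ω y z x₀ x₀ t = x₀ := by
  rw [gSegment, ← add_smul, sub_add_cancel, one_smul, hA1s.QInv_Q hΩ h₀]

/-- The map `(x, z) ↦ (Q(x, y, z), z)` is open. -/
theorem IsGeneratingFunction.map_nhds_Q (hg : IsGeneratingFunction Γ g) (hA2 : CondA2 Γ g)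
    {x : Eu n} (hw : (x, y, z) ∈ Γ) :
    map (fun q : Eu n × ℝ => (Q g q.1 y q.2, q.2)) (𝓝 (x, z)) = 𝓝 (Q g x y z, z) := by
  set ι : Eu n × ℝ → Eu n × Eu n × ℝ := fun q => (q.1, y, q.2) with hι
  have h1 : HasFDerivAt ι ((ContinuousLinearMap.fst ℝ (Eu n) ℝ).prod
      ((0 : Eu n × ℝ →L[ℝ] Eu n).prod (ContinuousLinearMap.snd ℝ (Eu n) ℝ))) (x, z) :=
    _root_.hasFDerivAt_fst.prodMk ((hasFDerivAt_const y (x, z)).prodMk _root_.hasFDerivAt_snd)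
  have h2 : ContDiffAt ℝ 1 (fun q => uncQ g (ι q)) (x, z) :=
    ContDiffAt.comp (g := uncQ g) (f := ι) (x, z) (hg.contDiffAt_Q hw)
      (contDiffAt_fst.prodMk (contDiffAt_const.prodMk contDiffAt_snd))
  have h3 : HasFDerivAt (fun q => uncQ g (ι q)) _ (x, z) :=
    HasFDerivAt.comp (g := uncQ g) (x, z)
      ((hg.contDiffAt_Q hw).differentiableAt (by norm_num)).hasFDerivAt h1
  have h4 := h2.hasStrictFDerivAt (by norm_num)
  obtain ⟨e, he⟩ := continuousLinearEquiv_of_injective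
    ((fderiv ℝ (fun q => uncQ g (ι q)) (x, z)).prod (ContinuousLinearMap.snd ℝ (Eu n) ℝ))
    (fun v hv => by
      obtain ⟨v, c⟩ := v
      rw [h3.fderiv] at hv
      simp only [ContinuousLinearMap.prod_apply, ContinuousLinearMap.coe_snd',
        Prod.mk_eq_zero] at hv
      obtain ⟨hv1, rfl⟩ := hv
      have : v = 0 := hg.fderiv_Q_injective hA2 hw hv1
      rw [this]
      rfl) rfl
  have h5 : HasStrictFDerivAt (fun q : Eu n × ℝ => (Q g q.1 y q.2, q.2))
      (e : Eu n × ℝ →L[ℝ] Eu n × ℝ) (x, z) := he ▸ h4.prodMk hasStrictFDerivAt_snd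
  exact h5.map_nhds_eq_of_equiv

/-- Openness of (x, z) ↦ (Q, z) gives joint continuity of its inverse, which A1* identifies with
`QInv`. The level is a variable because it is raised during the deformation. -/
theorem CondA1Star.continuousOn_QInv (hA1s : CondA1Star Γ g) (hg : IsGeneratingFunction Γ g)
    (hA2 : CondA2 Γ g) (hΩo : IsOpen Ω) {J : Set ℝ} (hJ : ∀ z ∈ J, IsGConvexSet Γ g Ω y z) :
    ContinuousOn (fun p : Eu n × ℝ => QInv g Ω y p.2 p.1)
      {p | p.2 ∈ J ∧ p.1 ∈ (fun x => Q g x y p.2) '' Ω} := by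
  rintro ⟨q, z⟩ ⟨hz, x, hx, hq⟩
  replace hz : z ∈ J := hz
  obtain rfl : Q g x y z = q := hq
  have hval : QInv g Ω y z (Q g x y z) = x := hA1s.QInv_Q (hJ z hz) hx
  intro N hN
  simp only [hval] at hN
  have hN' : (N ∩ Ω) ×ˢ (univ : Set ℝ) ∈ 𝓝 (x, z) :=
    prod_mem_nhds (inter_mem hN (hΩo.mem_nhds hx)) univ_mem
  have him := image_mem_map (m := fun q : Eu n × ℝ => (Q g q.1 y q.2, q.2)) hN'
  rw [hg.map_nhds_Q hA2 ((hJ z hz).1 x hx)] at him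
  refine mem_map.2 (mem_of_superset (inter_mem (mem_nhdsWithin_of_mem_nhds him)
    self_mem_nhdsWithin) ?_)
  rintro ⟨q', z'⟩ ⟨⟨⟨x', z''⟩, ⟨⟨hx'N, hx'Ω⟩, -⟩, heq⟩, hz', -⟩
  simp only [Prod.mk.injEq] at heq hz'
  obtain ⟨rfl, rfl⟩ := heq
  show QInv g Ω y z'' (Q g x' y z'') ∈ N
  rw [hA1s.QInv_Q (hJ _ hz') hx'Ω]
  exact hx'N

theorem CondA1Star.continuousOn_gSegment (hA1s : CondA1Star Γ g) (hg : IsGeneratingFunction Γ g)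
    (hA2 : CondA2 Γ g) (hΩo : IsOpen Ω) {J : Set ℝ} (hJ : ∀ z ∈ J, IsGConvexSet Γ g Ω y z)
    (hx₀ : x₀ ∈ Ω) {ζ : ℝ → ℝ} {γ : ℝ → Eu n} (hζ : ContinuousOn ζ (Icc 0 1))
    (hγ : ContinuousOn γ (Icc 0 1)) (hζJ : ∀ s ∈ Icc (0 : ℝ) 1, ζ s ∈ J)
    (hγΩ : ∀ s ∈ Icc (0 : ℝ) 1, γ s ∈ Ω) :
    ContinuousOn (fun p : ℝ × ℝ => gSegment g Ω y (ζ p.1) x₀ (γ p.1) p.2)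
      (Icc 0 1 ×ˢ Icc 0 1) := by
  have hQ : ∀ {γ : ℝ → Eu n}, ContinuousOn γ (Icc 0 1) → (∀ s ∈ Icc (0 : ℝ) 1, γ s ∈ Ω) →
      ContinuousOn (fun s => Q g (γ s) y (ζ s)) (Icc 0 1) := by
    intro γ hγ hγΩ s hs
    exact ContinuousAt.comp_continuousWithinAt (f := fun s => (γ s, y, ζ s)) (g := uncQ g)
      (hg.contDiffAt_Q ((hJ _ (hζJ s hs)).1 _ (hγΩ s hs))).continuousAt
      ((hγ s hs).prodMk (continuousWithinAt_const.prodMk (hζ s hs)))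
  have hfst : ContinuousOn (fun p : ℝ × ℝ => p.1) (Icc (0 : ℝ) 1 ×ˢ Icc (0 : ℝ) 1) := by fun_prop
  have hm : MapsTo (fun p : ℝ × ℝ => p.1) (Icc (0 : ℝ) 1 ×ˢ Icc (0 : ℝ) 1) (Icc 0 1) :=
    fun p hp => hp.1
  have h0 : ContinuousOn (fun p : ℝ × ℝ => Q g x₀ y (ζ p.1)) (Icc (0 : ℝ) 1 ×ˢ Icc (0 : ℝ) 1) :=
    ContinuousOn.comp (g := fun s => Q g x₀ y (ζ s))
      (hQ (γ := fun _ => x₀) continuousOn_const fun _ _ => hx₀) hfst hm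
  have h1 : ContinuousOn (fun p : ℝ × ℝ => Q g (γ p.1) y (ζ p.1))
      (Icc (0 : ℝ) 1 ×ˢ Icc (0 : ℝ) 1) :=
    ContinuousOn.comp (g := fun s => Q g (γ s) y (ζ s)) (hQ hγ hγΩ) hfst hm
  have hζ' : ContinuousOn (fun p : ℝ × ℝ => ζ p.1) (Icc (0 : ℝ) 1 ×ˢ Icc (0 : ℝ) 1) :=
    ContinuousOn.comp (g := ζ) hζ hfst hm
  have hl : ContinuousOn (fun p : ℝ × ℝ => 1 - p.2) (Icc (0 : ℝ) 1 ×ˢ Icc (0 : ℝ) 1) := by fun_prop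
  have hr : ContinuousOn (fun p : ℝ × ℝ => p.2) (Icc (0 : ℝ) 1 ×ˢ Icc (0 : ℝ) 1) := by fun_prop
  have h2 : ContinuousOn (fun p : ℝ × ℝ => ((1 - p.2) • Q g x₀ y (ζ p.1) +
      p.2 • Q g (γ p.1) y (ζ p.1), ζ p.1)) (Icc (0 : ℝ) 1 ×ˢ Icc (0 : ℝ) 1) :=
    ((hl.smul h0).add (hr.smul h1)).prodMk hζ'
  have hmaps : MapsTo (fun p : ℝ × ℝ => ((1 - p.2) • Q g x₀ y (ζ p.1) +
      p.2 • Q g (γ p.1) y (ζ p.1), ζ p.1)) (Icc (0 : ℝ) 1 ×ˢ Icc (0 : ℝ) 1)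
      {p | p.2 ∈ J ∧ p.1 ∈ (fun x => Q g x y p.2) '' Ω} := by
    intro p hp
    have hm := (hJ _ (hζJ _ hp.1)).mem_image hx₀ (hγΩ _ hp.1) hp.2
    rw [mem_ofPred_eq]
    exact ⟨hζJ _ hp.1, hm⟩
  have h3 := (hA1s.continuousOn_QInv hg hA2 hΩo hJ).comp h2 hmaps
  simpa only [gSegment, Function.comp_def] using h3

theorem CondA1Star.continuousOn_gSegment_right (hA1s : CondA1Star Γ g)
    (hg : IsGeneratingFunction Γ g) (hA2 : CondA2 Γ g) (hΩo : IsOpen Ω)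
    (hΩ : IsGConvexSet Γ g Ω y z) (h₀ : x₀ ∈ Ω) (h₁ : x₁ ∈ Ω) :
    ContinuousOn (gSegment g Ω y z x₀ x₁) (Icc 0 1) := by
  have h := hA1s.continuousOn_gSegment hg hA2 hΩo (y := y) (J := {z})
    (fun z' hz' => by rw [mem_singleton_iff.1 hz']; exact hΩ) h₀
    (ζ := fun _ => z) (γ := fun _ => x₁) continuousOn_const continuousOn_const
    (fun _ _ => rfl) fun _ _ => h₁
  have h' : ContinuousOn (fun t : ℝ => ((0 : ℝ), t)) (Icc 0 1) := by fun_prop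
  have hm : MapsTo (fun t : ℝ => ((0 : ℝ), t)) (Icc 0 1) (Icc 0 1 ×ˢ Icc 0 1) :=
    fun t ht => mk_mem_prod ⟨le_rfl, zero_le_one⟩ ht
  have h3 := h.comp h' hm
  simpa only [Function.comp_def] using h3

/-! ### The strong minimum principle and the continuity method. -/

/-- At a point where `g*(·, y, u)` touches its lower bound `z` along a `g`-segment with respect to
`(y, z)`, it is locally constant. -/
theorem CondA3w.eventually_gStar_eq (hA3w : CondA3w Γ g) (hg : IsGeneratingFunction Γ g)
    (hA1 : CondA1 Γ g) (hA2 : CondA2 Γ g) (hΩo : IsOpen Ω) {u : Eu n → ℝ}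
    (hloc : IsLocallyGConvex Γ g u Ω) (hii : IsSubGStarConvex Γ g (SigmaSet Γ g u Ω) u Ω)
    (hy : y ∈ SigmaSet Γ g u Ω) (hz : ∀ x ∈ Ω, (x, y, z) ∈ Γ) {σ : ℝ → Eu n} {t₀ : ℝ} {d : Eu n}
    (hσ : ContinuousAt σ t₀) (hσΩ : σ t₀ ∈ Ω)
    (hQ : ∀ᶠ t in 𝓝 t₀, Q g (σ t) y z = Q g (σ t₀) y z + (t - t₀) • d)
    (heq : gStar Γ g (σ t₀) y (u (σ t₀)) = z)
    (hge : ∀ᶠ t in 𝓝 t₀, z ≤ gStar Γ g (σ t) y (u (σ t))) :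
    ∀ᶠ t in 𝓝 t₀, gStar Γ g (σ t) y (u (σ t)) = z := by
  -- A local support at the touching point gives g(·, y₁, z₁) ≤ u ≤ g(·, y, z) along σ with equality
  -- at t₀. Both y and y₁ lie in Σ_u(Ω), so sub g*-convexity supplies the segment for A3w.
  obtain ⟨N, hN, hNΩ, y₁, z₁, hsupp⟩ := hloc.2 (σ t₀) hσΩ
  have hy₁ := hg.mem_SigmaSet hA1 hσΩ hN hsupp
  obtain ⟨hs1, hs2, hs3⟩ := hsupp
  have hw₀ := hz _ hσΩ
  have hw₁ := hs1 _ (mem_of_mem_nhds hN)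
  obtain ⟨hΓs, hconv⟩ := hii (σ t₀) hσΩ
  have hu₀ : g (σ t₀) y z = u (σ t₀) := by
    have := (gStar_spec (hΓs y hy)).2
    rwa [heq] at this
  have hseg := hconv y hy y₁ hy₁
  rw [P, P, heq, hg.gStar_eq hw₁ hs2.symm, ← hu₀] at hseg
  have hΩev : ∀ᶠ t in 𝓝 t₀, σ t ∈ Ω := hσ.eventually (hΩo.mem_nhds hσΩ)
  have hNev : ∀ᶠ t in 𝓝 t₀, σ t ∈ N := hσ.eventually hN
  have hspec : ∀ x ∈ Ω, (x, y, gStar Γ g x y (u x)) ∈ Γ ∧ g x y (gStar Γ g x y (u x)) = u x :=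
    fun x hx => gStar_spec ((hii x hx).1 y hy)
  have hle : ∀ᶠ t in 𝓝 t₀, g (σ t) y₁ z₁ ≤ g (σ t) y z := by
    filter_upwards [hΩev, hNev, hge] with t h1 h2 h3
    obtain ⟨h4, h5⟩ := hspec _ h1
    have h6 := (hg.strictAntiOn (σ t) y).antitoneOn (hz _ h1) h4 h3
    exact (hs3 _ h2).trans (h5 ▸ h6)
  have hfin := hA3w.eventually_le_of_gSegment hg hA1 hA2 hw₀ hw₁ (hs2.symm.trans hu₀.symm) hseg hσ
    hQ hle
  filter_upwards [hΩev, hNev, hge, hfin] with t h1 h2 h3 h4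
  obtain ⟨h5, h6⟩ := hspec _ h1
  refine le_antisymm ?_ h3
  have h7 : g (σ t) y z ≤ g (σ t) y (gStar Γ g (σ t) y (u (σ t))) := by
    rw [h6]
    exact h4.trans (hs3 _ h2)
  exact ((hg.strictAntiOn (σ t) y).le_iff_ge (hz _ h1) h5).1 h7

/-- A strong minimum principle along `g`-segments. -/
theorem CondA3w.gStar_gSegment_eq (hA3w : CondA3w Γ g) (hg : IsGeneratingFunction Γ g)
    (hA1 : CondA1 Γ g) (hA2 : CondA2 Γ g) (hA1s : CondA1Star Γ g) (hΩo : IsOpen Ω) {u : Eu n → ℝ}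
    (hloc : IsLocallyGConvex Γ g u Ω) (hii : IsSubGStarConvex Γ g (SigmaSet Γ g u Ω) u Ω)
    (hy : y ∈ SigmaSet Γ g u Ω) (hz : IsGConvexSet Γ g Ω y z) (h₀ : x₀ ∈ Ω) (h₁ : x₁ ∈ Ω)
    (hge : ∀ t ∈ Icc (0 : ℝ) 1, z ≤ gStar Γ g (gSegment g Ω y z x₀ x₁ t) y
      (u (gSegment g Ω y z x₀ x₁ t))) {t₀ : ℝ} (ht₀ : t₀ ∈ Ioo (0 : ℝ) 1)
    (heq : gStar Γ g (gSegment g Ω y z x₀ x₁ t₀) y (u (gSegment g Ω y z x₀ x₁ t₀)) = z) :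
    ∀ t ∈ Icc (0 : ℝ) 1,
      gStar Γ g (gSegment g Ω y z x₀ x₁ t) y (u (gSegment g Ω y z x₀ x₁ t)) = z := by
  set σ := gSegment g Ω y z x₀ x₁ with hσdef
  have hσ : ContinuousOn σ (Icc 0 1) := hA1s.continuousOn_gSegment_right hg hA2 hΩo hz h₀ h₁
  have hσΩ : ∀ t ∈ Icc (0 : ℝ) 1, σ t ∈ Ω := fun t ht => hz.gSegment_mem h₀ h₁ ht
  set v : Eu n → ℝ := fun x => gStar Γ g x y (u x) with hv
  have hvc : ∀ x ∈ Ω, ContinuousAt v x := fun x hx =>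
    hg.continuousAt_gStar (hloc.1.continuousAt (hΩo.mem_nhds hx))
      (by filter_upwards [hΩo.mem_nhds hx] with x' hx' using (hii x' hx').1 y hy)
  have hvσ : ContinuousOn (fun t => v (σ t)) (Icc 0 1) := fun t ht =>
    (hvc _ (hσΩ t ht)).comp_continuousWithinAt (hσ t ht)
  have hopen : IsOpen {t | t ∈ Ioo (0 : ℝ) 1 ∧ v (σ t) = z} := by
    rw [isOpen_iff_mem_nhds]
    rintro t ⟨ht, hvt⟩
    have ht' := Ioo_subset_Icc_self ht
    have hnh : ∀ᶠ t' in 𝓝 t, t' ∈ Ioo (0 : ℝ) 1 := Ioo_mem_nhds ht.1 ht.2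
    have := hA3w.eventually_gStar_eq hg hA1 hA2 hΩo hloc hii hy hz.1 (σ := σ) (t₀ := t)
      (d := Q g x₁ y z - Q g x₀ y z)
      (hσ.continuousAt (Icc_mem_nhds ht.1 ht.2)) (hσΩ t ht') (by
        filter_upwards [hnh] with t' h'
        rw [hz.Q_gSegment h₀ h₁ (Ioo_subset_Icc_self h'), hz.Q_gSegment h₀ h₁ ht']
        module) hvt (by
        filter_upwards [hnh] with t' h' using hge t' (Ioo_subset_Icc_self h'))
    filter_upwards [hnh, this] with t' h1 h2 using ⟨h1, h2⟩
  -- The contact set is open by the local lemma and relatively closed by continuity; endpoints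
  -- follow by passing to the closure.
  have hsub : Ioo (0 : ℝ) 1 ⊆ {t | t ∈ Ioo (0 : ℝ) 1 ∧ v (σ t) = z} := by
    refine isPreconnected_Ioo.subset_of_closure_inter_subset hopen ⟨t₀, ht₀, ht₀, heq⟩ ?_
    rintro t ⟨htc, ht⟩
    refine ⟨ht, ?_⟩
    have hc : ContinuousAt (fun t => v (σ t)) t := hvσ.continuousAt (Icc_mem_nhds ht.1 ht.2)
    by_contra hne
    obtain ⟨t', h1, h2⟩ := mem_closure_iff_nhds.1 htc _ (hc.eventually_ne hne)
    exact h1 h2.2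
  have hEq : EqOn (fun t => v (σ t)) (fun _ => z) (Ioo 0 1) := fun t ht => (hsub ht).2
  exact hEq.of_subset_closure hvσ continuousOn_const Ioo_subset_Icc_self
    (closure_Ioo zero_ne_one).ge

/-- The good parameters form a closed set, and the strict inequality with compactness in t extends
it to the right. -/
theorem forall_le_of_continuity_method {w : ℝ → ℝ → ℝ} {ζ : ℝ → ℝ}
    (hw : ContinuousOn (fun p : ℝ × ℝ => w p.1 p.2) (Icc 0 1 ×ˢ Icc 0 1))
    (hζ : ContinuousOn ζ (Icc 0 1)) (h0 : ∀ t ∈ Icc (0 : ℝ) 1, ζ 0 ≤ w 0 t)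
    (hstep : ∀ s ∈ Ico (0 : ℝ) 1, (∀ t ∈ Icc (0 : ℝ) 1, ζ s ≤ w s t) →
      ∀ t ∈ Icc (0 : ℝ) 1, ζ s < w s t) :
    ∀ s ∈ Icc (0 : ℝ) 1, ∀ t ∈ Icc (0 : ℝ) 1, ζ s ≤ w s t := by
  set π : ℝ → ℝ := fun s => (projIcc (0 : ℝ) 1 zero_le_one s : ℝ) with hπ
  have hπc : Continuous π := continuous_subtype_val.comp continuous_projIcc
  have hπm : ∀ s, π s ∈ Icc (0 : ℝ) 1 := fun s => (projIcc (0 : ℝ) 1 zero_le_one s).2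
  have hπe : ∀ s ∈ Icc (0 : ℝ) 1, π s = s := fun s hs => by simp [hπ, projIcc_of_mem _ hs]
  have hw' : Continuous (fun p : ℝ × ℝ => w (π p.1) (π p.2)) :=
    hw.comp_continuous (f := fun p : ℝ × ℝ => (π p.1, π p.2)) (by fun_prop)
      fun p => ⟨hπm _, hπm _⟩
  have hζ' : Continuous fun s => ζ (π s) := hζ.comp_continuous hπc hπm
  have hsub : Icc (0 : ℝ) 1 ⊆ {s | ∀ t, ζ (π s) ≤ w (π s) (π t)} := by
    refine IsClosed.Icc_subset_of_forall_exists_gt (IsClosed.inter ?_ isClosed_Icc) ?_ ?_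
    · rw [ofPred_forall]
      refine isClosed_iInter fun t => isClosed_le hζ' ?_
      exact hw'.comp (by fun_prop : Continuous fun s : ℝ => (s, t))
    · intro t
      rw [hπe 0 ⟨le_rfl, zero_le_one⟩]
      exact h0 _ (hπm t)
    · rintro s ⟨hs, hsI⟩ b hb
      have hse := hπe s (Ico_subset_Icc_self hsI)
      have hlt : ∀ t ∈ Icc (0 : ℝ) 1, ζ s < w s t := by
        refine hstep s hsI fun t ht => ?_
        have := hs t
        rwa [hse, hπe t ht] at this
      have hev : ∀ᶠ s' in 𝓝 s, ∀ t ∈ Icc (0 : ℝ) 1, ζ (π s') < w (π s') (π t) := by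
        refine isCompact_Icc.eventually_forall_of_forall_eventually fun t ht => ?_
        refine ContinuousAt.eventually_lt (f := fun p : ℝ × ℝ => ζ (π p.1))
          (g := fun p : ℝ × ℝ => w (π p.1) (π p.2)) (hζ'.comp continuous_fst).continuousAt
          hw'.continuousAt ?_
        simp only [hse, hπe t ht]
        exact hlt t ht
      obtain ⟨s', h1, h2⟩ := ((hev.filter_mono nhdsWithin_le_nhds).and
        (Ioo_mem_nhdsGT (show s < b from hb))).exists
      refine ⟨s', fun t => ?_, h2.1, h2.2.le⟩
      have := (h1 (π t) (hπm t)).le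
      rwa [hπe (π t) (hπm t)] at this
  intro s hs t ht
  have := hsub hs t
  rwa [hπe s hs, hπe t ht] at this

/-- A local `g`-support of a locally `g`-convex function is a global one. -/
theorem CondA3w.gStar_le_of_isGSupport (hA3w : CondA3w Γ g) (hg : IsGeneratingFunction Γ g)
    (hA1 : CondA1 Γ g) (hA2 : CondA2 Γ g) (hA1s : CondA1Star Γ g) (hΩo : IsOpen Ω)
    (hΩc : IsConnected Ω) {u : Eu n → ℝ} (hloc : IsLocallyGConvex Γ g u Ω)
    (hii : IsSubGStarConvex Γ g (SigmaSet Γ g u Ω) u Ω) (hy : y ∈ SigmaSet Γ g u Ω)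
    (hconv : ∀ x ∈ Ω, IsGConvexSet Γ g Ω y (gStar Γ g x y (u x))) (h₀ : x₀ ∈ Ω)
    {N : Set (Eu n)} (hN : N ∈ 𝓝 x₀) (hNΩ : N ⊆ Ω) (hsupp : IsGSupport Γ g u N x₀ y z)
    (h₁ : x₁ ∈ Ω) : gStar Γ g x₁ y (u x₁) ≤ z := by
  by_contra! hlt
  set v : Eu n → ℝ := fun x => gStar Γ g x y (u x) with hv
  have hv₀ : v x₀ = z := hg.gStar_eq (hsupp.1 _ (mem_of_mem_nhds hN)) hsupp.2.1.symm
  have hspec : ∀ x ∈ Ω, (x, y, v x) ∈ Γ ∧ g x y (v x) = u x := fun x hx =>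
    gStar_spec ((hii x hx).1 y hy)
  have hvc : ∀ x ∈ Ω, ContinuousAt v x := fun x hx =>
    hg.continuousAt_gStar (hloc.1.continuousAt (hΩo.mem_nhds hx))
      (by filter_upwards [hΩo.mem_nhds hx] with x' hx' using (hii x' hx').1 y hy)
  have hvcon : ContinuousOn v Ω := fun x hx => (hvc x hx).continuousWithinAt
  -- Only levels attained by v are used, since for these Ω is g-convex. Connectedness of Ω makes J
  -- an interval, so intermediate levels are admissible.
  set J : Set ℝ := v '' Ω with hJdef
  have hJ : ∀ z ∈ J, IsGConvexSet Γ g Ω y z := by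
    rintro _ ⟨x, hx, rfl⟩
    exact hconv x hx
  have hJo : J.OrdConnected := (hΩc.isPreconnected.image v hvcon).ordConnected
  have hvJ : ∀ x ∈ Ω, v x ∈ J := fun x hx => mem_image_of_mem v hx
  have hwc : ∀ {ζ : ℝ → ℝ} {γ : ℝ → Eu n}, ContinuousOn ζ (Icc 0 1) → ContinuousOn γ (Icc 0 1) →
      (∀ s ∈ Icc (0 : ℝ) 1, ζ s ∈ J) → (∀ s ∈ Icc (0 : ℝ) 1, γ s ∈ Ω) →
      ContinuousOn (fun p : ℝ × ℝ => v (gSegment g Ω y (ζ p.1) x₀ (γ p.1) p.2))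
        (Icc 0 1 ×ˢ Icc 0 1) := by
    intro ζ γ hζ hγ hζJ hγΩ
    have hmaps : MapsTo (fun p : ℝ × ℝ => gSegment g Ω y (ζ p.1) x₀ (γ p.1) p.2)
        (Icc 0 1 ×ˢ Icc 0 1) Ω := fun p hp =>
      (hJ _ (hζJ _ hp.1)).gSegment_mem h₀ (hγΩ _ hp.1) hp.2
    have h := hvcon.comp (hA1s.continuousOn_gSegment hg hA2 hΩo hJ h₀ hζ hγ hζJ hγΩ) hmaps
    simpa only [Function.comp_def] using h
  -- Contact at an interior parameter would spread to the whole segment and give v x₀ = z'.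
  have hstrict : ∀ z' ∈ J, ∀ x ∈ Ω, z' < v x₀ → z' < v x →
      (∀ t ∈ Icc (0 : ℝ) 1, z' ≤ v (gSegment g Ω y z' x₀ x t)) →
      ∀ t ∈ Icc (0 : ℝ) 1, z' < v (gSegment g Ω y z' x₀ x t) := by
    intro z' hz' x hx hlt0 hltx hge t ht
    refine lt_of_le_of_ne (hge t ht) fun heq => ?_
    have hs0 := hA1s.gSegment_zero (x₁ := x) (hJ z' hz') h₀
    have hs1 := hA1s.gSegment_one (x₀ := x₀) (hJ z' hz') hx
    rcases ht.1.eq_or_lt with h | h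
    · rw [← h, hs0] at heq
      linarith
    rcases ht.2.eq_or_lt with h' | h'
    · rw [h', hs1] at heq
      linarith
    have := hA3w.gStar_gSegment_eq hg hA1 hA2 hA1s hΩo hloc hii hy (hJ z' hz') h₀ hx hge ⟨h, h'⟩
      heq.symm 0 ⟨le_rfl, zero_le_one⟩
    rw [hs0] at this
    have : v x₀ = z' := this
    linarith
  obtain ⟨m, hmJ, hmz, hm⟩ : ∃ m ∈ J, m ≤ z ∧
      ∀ t ∈ Icc (0 : ℝ) 1, m ≤ v (gSegment g Ω y m x₀ x₁ t) := by
    obtain ⟨γ, hγΩ⟩ := (hΩo.isConnected_iff_isPathConnected.1 hΩc).joinedIn x₀ h₀ x₁ h₁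
    have hγc : Continuous γ.extend := γ.continuous_extend
    have hγm : ∀ s ∈ Icc (0 : ℝ) 1, γ.extend s ∈ Ω := fun s hs => by
      rw [γ.extend_apply hs]
      exact hγΩ _
    have hvγ : ContinuousOn (fun s => v (γ.extend s)) (Icc 0 1) :=
      hvcon.comp hγc.continuousOn hγm
    obtain ⟨s₀, hs₀, hmin⟩ := isCompact_Icc.exists_isMinOn (nonempty_Icc.2 zero_le_one) hvγ
    have hmin' : ∀ s ∈ Icc (0 : ℝ) 1, v (γ.extend s₀) ≤ v (γ.extend s) := fun s hs => hmin hs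
    have hmz : v (γ.extend s₀) ≤ z := by
      have := hmin' 0 ⟨le_rfl, zero_le_one⟩
      rwa [γ.extend_zero, hv₀] at this
    -- If the minimum over the path is a minimum over Ω, it serves as m at once. Otherwise m is a
    -- value of v strictly below it, so every endpoint on the path lies strictly above the level.
    -- The deformation starts from the constant segment at x₀.
    by_cases hall : ∀ x ∈ Ω, v (γ.extend s₀) ≤ v x
    · exact ⟨v (γ.extend s₀), hvJ _ (hγm _ hs₀), hmz, fun t ht =>
        hall _ ((hJ _ (hvJ _ (hγm _ hs₀))).gSegment_mem h₀ h₁ ht)⟩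
    · push Not at hall
      obtain ⟨x₂, hx₂, hlt₂⟩ := hall
      refine ⟨v x₂, hvJ _ hx₂, hlt₂.le.trans hmz, fun t ht => ?_⟩
      have key := forall_le_of_continuity_method (ζ := fun _ => v x₂)
        (w := fun s t => v (gSegment g Ω y (v x₂) x₀ (γ.extend s) t))
        (hwc (ζ := fun _ => v x₂) continuousOn_const hγc.continuousOn (fun _ _ => hvJ _ hx₂) hγm)
        continuousOn_const (fun t ht => by
          rw [γ.extend_zero, hA1s.gSegment_self (hJ _ (hvJ _ hx₂)) h₀, hv₀]
          linarith)
        (fun s hs => hstrict _ (hvJ _ hx₂) _ (hγm s (Ico_subset_Icc_self hs))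
          (by rw [hv₀]; linarith) (hlt₂.trans_le (hmin' s (Ico_subset_Icc_self hs))))
        1 ⟨zero_le_one, le_rfl⟩ t ht
      rwa [γ.extend_one] at key
  have hzJ : z ∈ J := hv₀ ▸ hvJ x₀ h₀
  have hgood : ∀ t ∈ Icc (0 : ℝ) 1, z ≤ v (gSegment g Ω y z x₀ x₁ t) := by
    rcases hmz.eq_or_lt with rfl | hmz
    · exact hm
    have hζJ : ∀ s ∈ Icc (0 : ℝ) 1, (1 - s) * m + s * z ∈ J := by
      intro s hs
      refine hJo.out hmJ hzJ ⟨?_, ?_⟩ <;> nlinarith [hs.1, hs.2]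
    -- The endpoints are now fixed. For s < 1 the level is below z = v x₀ < v x₁, so the strict step
    -- applies, and the closed inequality remains at s = 1.
    have key := forall_le_of_continuity_method (ζ := fun s => (1 - s) * m + s * z)
      (w := fun s t => v (gSegment g Ω y ((1 - s) * m + s * z) x₀ x₁ t))
      (hwc (ζ := fun s => (1 - s) * m + s * z) (γ := fun _ => x₁) (by fun_prop)
        continuousOn_const hζJ fun _ _ => h₁)
      (by fun_prop) (fun t ht => by simpa using hm t ht)
      (fun s hs => hstrict _ (hζJ s (Ico_subset_Icc_self hs)) _ h₁
        (by rw [hv₀]; nlinarith [hs.1, hs.2])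
        (lt_of_le_of_lt (by nlinarith [hs.1, hs.2]) hlt))
      1 ⟨zero_le_one, le_rfl⟩
    simpa using key
  have hs0 := hA1s.gSegment_zero (x₁ := x₁) (hJ z hzJ) h₀
  have hs1 := hA1s.gSegment_one (x₀ := x₀) (hJ z hzJ) h₁
  have hσ : ContinuousOn (gSegment g Ω y z x₀ x₁) (Icc 0 1) :=
    hA1s.continuousOn_gSegment_right hg hA2 hΩo (hJ z hzJ) h₀ h₁
  -- A small positive parameter stays in N, where the support forces v ≤ z; this is the interior
  -- contact point.
  obtain ⟨t, htN, ht⟩ : ∃ t, gSegment g Ω y z x₀ x₁ t ∈ N ∧ t ∈ Ioo (0 : ℝ) 1 := by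
    have h := hσ 0 ⟨le_rfl, zero_le_one⟩
    have h2 : ∀ᶠ t in 𝓝[Icc (0 : ℝ) 1] 0, gSegment g Ω y z x₀ x₁ t ∈ N :=
      h.eventually_mem (by rw [hs0]; exact hN)
    have h3 := h2.filter_mono (nhdsWithin_mono (0 : ℝ) Ioo_subset_Icc_self)
    rw [nhdsWithin_Ioo_eq_nhdsGT zero_lt_one] at h3
    exact (h3.and (Ioo_mem_nhdsGT zero_lt_one)).exists
  have hvt : v (gSegment g Ω y z x₀ x₁ t) = z := by
    refine le_antisymm ?_ (hgood t (Ioo_subset_Icc_self ht))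
    obtain ⟨h5, h6⟩ := hspec _ (hNΩ htN)
    refine ((hg.strictAntiOn _ y).le_iff_ge (hsupp.1 _ htN) h5).1 ?_
    rw [h6]
    exact hsupp.2.2 _ htN
  have hend := hA3w.gStar_gSegment_eq hg hA1 hA2 hA1s hΩo hloc hii hy (hJ z hzJ) h₀ h₁ hgood ht
    hvt 1 ⟨zero_le_one, le_rfl⟩
  rw [hs1] at hend
  exact hlt.ne' hend

end GenFun

/-! ### From local to global supports. -/

theorem theorem3p2 (n : ℕ) (Γ : Set (GenFun.Eu n × GenFun.Eu n × ℝ))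
    (g : GenFun.Eu n → GenFun.Eu n → ℝ → ℝ)
    (hg : GenFun.IsGeneratingFunction Γ g)
    (hA1 : GenFun.CondA1 Γ g) (hA2 : GenFun.CondA2 Γ g)
    (hA1s : GenFun.CondA1Star Γ g) (hA3w : GenFun.CondA3w Γ g)
    (Ω : Set (GenFun.Eu n)) (hΩo : IsOpen Ω) (hΩc : IsConnected Ω)
    (u : GenFun.Eu n → ℝ) (hu : ContinuousOn u (closure Ω))
    (hloc : GenFun.IsLocallyGConvex Γ g u Ω)
    (hi : ∀ y ∈ GenFun.SigmaSet Γ g u Ω, ∀ z ∈ GenFun.gStarImage Γ g u (closure Ω) y,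
      GenFun.IsGConvexSet Γ g Ω y z)
    (hii : GenFun.IsSubGStarConvex Γ g (GenFun.SigmaSet Γ g u Ω) u Ω) :
    GenFun.IsGConvex Γ g u Ω := by
  refine ⟨hloc.1, fun x₀ h₀ => ?_⟩
  obtain ⟨N, hN, hNΩ, y, z, hsupp⟩ := hloc.2 x₀ h₀
  have hy := hg.mem_SigmaSet hA1 h₀ hN hsupp
  have hconv : ∀ x ∈ Ω, GenFun.IsGConvexSet Γ g Ω y (GenFun.gStar Γ g x y (u x)) :=
    fun x hx => hi y hy _ ⟨x, subset_closure hx, (hii x hx).1 y hy, rfl⟩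
  have hz : GenFun.gStar Γ g x₀ y (u x₀) = z :=
    hg.gStar_eq (hsupp.1 _ (mem_of_mem_nhds hN)) hsupp.2.1.symm
  -- Here z is the value of g*(·, y, u) at x₀, so the convexity assumption already gives the domain
  -- condition.
  have hzΓ : ∀ x ∈ Ω, (x, y, z) ∈ Γ := hz ▸ (hconv x₀ h₀).1
  refine ⟨y, z, hzΓ, hsupp.2.1, fun x hx => ?_⟩
  have hle := hA3w.gStar_le_of_isGSupport hg hA1 hA2 hA1s hΩo hΩc hloc hii hy hconv h₀ hN hNΩ
    hsupp hx
  obtain ⟨h1, h2⟩ := GenFun.gStar_spec ((hii x hx).1 y hy)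
  have h3 := (hg.strictAntiOn x y).antitoneOn h1 (hzΓ x hx) hle
  rwa [h2] at h3
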